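/- Let $m\ge 1$, $M\ge 0$ be integers and $N_S\ge 0$ real. A single-mode phase-insensitive bosonic Gaussian channel with transmissivity/gain $\mu\ge 0$ and output noise $E\ge 0$ is a quantum channel acting in the Heisenberg picture as $a\mapsto\sqrt{\mu}\,a+\text{noise}$ (covariant case) or $a\mapsto\sqrt{\mu}\,a^\dagger+\text{noise}$ (contravariant case), i.e. on the displacement operators $D(\xi)=\exp(\xi a^\dagger-\bar\xi a)$ by $D(\xi)\mapsto e^{-(2E+1-\mu)|\xi|^2/2}D(\sqrt\mu\,\xi)$, respectively $D(\xi)\mapsto e^{-(2E+1-\mu)|\xi|^2/2}D(-\sqrt\mu\,\bar\xi)$. Let $\Phi_T$ and $\Phi_B$ be two such channels, both covariant or both contravariant, with parameters $(\mu_T,E_T)$ and $(\mu_B,E_B)$. Consider $m$ subsystems $S_1,\dots,S_m$, where $S_k$ carries $M_k$ bosonic modes. For $n=1,\dots,m$ let $\mathcal E_n$ be the channel that applies $\Phi_T^{\otimes M_n}$ to $S_n$ and $\Phi_B^{\otimes M_k}$ to $S_k$ for every $k\ne n$. For an input state $\rho$ put $$P_{H,LB}(\rho)=\sum_{n'>n}\frac1{m^2}F^2\big(\mathcal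 E_{n'}(\rho),\mathcal E_n(\rho)\big),\qquad F(\rho,\sigma)=\mathrm{tr}\sqrt{\sqrt\rho\,\sigma\sqrt\rho},$$ the fidelity-based lower bound on the mean error probability of discriminating the equiprobable $\mathcal E_1,\dots,\mathcal E_m$ with input $\rho$. A classical state is a state with positive P-representation, i.e. a mixture $\int dP(\alpha)\,|\alpha\rangle\langle\alpha|$ of multimode coherent states with respect to a probability measure $P$. Inputs are classical states of all the modes whose mean total photon number is at most $mMN_S$. (1) Let $M_k=M$ for all $k$. The minimum of $P_{H,LB}$ over these inputs is $$\frac{m-1}{2m}\,c_{E_B,E_T}^{2M}\exp\left[-\frac{2MN_S(\sqrt{\mu_B}-\sqrt{\mu_T})^2}{1+E_B+E_T}\right],\qquad c_{E_B,E_T}=\Big[1+\big(\sqrt{E_B(1+E_T)}-\sqrt{E_T(1+E_B)}\big)^2\Big]^{-1},$$ and it is attained by every tensor product of coherent states $\bigotimes_{k=1}^m\bigotimes_{k'=1}^M\big|e^{i\theta_k^{(k')}}\sqrt{N_k^{(k')}}\big\rangle$ with arbitrary phases and $\sum_{k'}N_k^{(k')}=MN_S$ for every $k$. If moreover $m\ge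 3$ and $\mu_B\ne\mu_T$, then among the tensor products of coherent states with mean total photon number at most $mMN_S$ only these attain it. (2) Let $E_T=E_B=E$. For arbitrary numbers of modes $M_1,\dots,M_m$, every classical input with mean total photon number at most $mMN_S$ satisfies $$P_{H,LB}\ \ge\ \frac{m-1}{2m}\exp\left[-\frac{2MN_S(\sqrt{\mu_B}-\sqrt{\mu_T})^2}{1+2E}\right],$$ with equality for every tensor product of coherent states with $MN_S$ mean photons on each subsystem, in particular for $\bigotimes_{k=1}^m|\sqrt{MN_S}\rangle_{S_k}$ with one mode per subsystem. -/

import Mathlib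

open scoped InnerProductSpace ENNReal

namespace CPF

/-- The Hilbert space `ℓ²(X)` with orthonormal basis labelled by `X`.  `Hil ℕ` is the Fock space of
one bosonic mode, written in its number basis; `Hil (ι → ℕ)` is the Fock space of the modes `ι`, that
is the Hilbert tensor product of `ι` copies of `Hil ℕ`, with basis the occupation numbers. -/
def Hil (X : Type) : Type := lp (fun _ : X => ℂ) 2

noncomputable instance {X : Type} : NormedAddCommGroup (Hil X) :=
  inferInstanceAs (NormedAddCommGroup (lp (fun _ : X => ℂ) 2))

noncomputable instance {X : Type} : InnerProductSpace ℂ (Hil X) :=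
  inferInstanceAs (InnerProductSpace ℂ (lp (fun _ : X => ℂ) 2))

instance {X : Type} : CompleteSpace (Hil X) :=
  inferInstanceAs (CompleteSpace (lp (fun _ : X => ℂ) 2))

instance {X : Type} : FunLike (Hil X) X ℂ where
  coe f := f.1
  coe_injective _ _ h := Subtype.ext h

theorem Hil.ext {X : Type} {f g : Hil X} (h : ∀ x, f x = g x) : f = g :=
  DFunLike.ext _ _ h

theorem memℓp_two_of_bound {X : Type} (f : X → ℂ) (C : ℝ)
    (h : ∀ s : Finset X, ∑ x ∈ s, ‖f x‖ ^ 2 ≤ C) : Memℓp f 2 := by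
  refine memℓp_gen' (C := C) fun s => ?_
  simpa using h s

theorem sum_norm_sq_le {X : Type} (f : Hil X) (s : Finset X) :
    ∑ x ∈ s, ‖f x‖ ^ 2 ≤ ‖f‖ ^ 2 := by
  have := lp.sum_rpow_le_norm_rpow (p := 2) (E := fun _ : X => ℂ) (by simp) f s
  rw [ENNReal.toReal_ofNat] at this
  simp only [Real.rpow_two] at this
  exact this

theorem norm_le_of_sum_le {X : Type} (f : Hil X) {C : ℝ} (hC : 0 ≤ C)
    (h : ∀ s : Finset X, ∑ x ∈ s, ‖f x‖ ^ 2 ≤ C ^ 2) : ‖f‖ ≤ C := by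
  refine lp.norm_le_of_forall_sum_le (p := 2) (E := fun _ : X => ℂ) (by simp) hC fun s => ?_
  rw [ENNReal.toReal_ofNat]
  simp only [Real.rpow_two]
  exact h s

theorem hasSum_norm_sq {X : Type} (f : Hil X) : HasSum (fun x => ‖f x‖ ^ 2) (‖f‖ ^ 2) := by
  have := lp.hasSum_norm (p := 2) (E := fun _ : X => ℂ) (by simp) f
  rw [ENNReal.toReal_ofNat] at this
  simp only [Real.rpow_two] at this
  exact this

theorem hasSum_inner {X : Type} (f g : Hil X) :
    HasSum (fun x => g x * star (f x)) ⟪f, g⟫_ℂ :=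
  lp.hasSum_inner (𝕜 := ℂ) (G := fun _ : X => ℂ) f g

/-- The basis vector labelled by `x`; for modes, the number (Fock) state. -/
noncomputable def ket {X : Type} [DecidableEq X] (x : X) : Hil X := lp.single 2 x (1 : ℂ)

/-! ### Product vectors and tensor products of operators -/

theorem memℓp_prod {ι : Type} [Fintype ι]
    (ψ : ι → Hil ℕ) :
    Memℓp (fun n : ι → ℕ => ∏ i, ψ i (n i)) 2 := by
  classical
  refine memℓp_two_of_bound _ (∏ i, ‖ψ i‖ ^ 2) fun s => ?_
  calc ∑ n ∈ s, ‖∏ i, ψ i (n i)‖ ^ 2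
      ≤ ∑ n ∈ Fintype.piFinset (fun i => s.image (fun n => n i)), ‖∏ i, ψ i (n i)‖ ^ 2 := by
        refine Finset.sum_le_sum_of_subset_of_nonneg ?_ fun _ _ _ => by positivity
        intro n hn
        exact Fintype.mem_piFinset.2 fun i => Finset.mem_image_of_mem _ hn
    _ = ∏ i, ∑ k ∈ s.image (fun n => n i), ‖ψ i k‖ ^ 2 := by
        rw [Finset.prod_univ_sum]
        simp [norm_prod, Finset.prod_pow]
    _ ≤ ∏ i, ‖ψ i‖ ^ 2 :=
        Finset.prod_le_prod (fun _ _ => by positivity) fun i _ => sum_norm_sq_le _ _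

/-- The product vector `⊗ᵢ ψᵢ`. -/
noncomputable def prodVec {ι : Type} [Fintype ι]
    (ψ : ι → Hil ℕ) : Hil (ι → ℕ) :=
  ⟨fun n => ∏ i, ψ i (n i), memℓp_prod ψ⟩

theorem prodVec_apply {ι : Type} [Fintype ι]
    (ψ : ι → Hil ℕ) (n : ι → ℕ) : prodVec ψ n = ∏ i, ψ i (n i) := rfl

theorem memℓp_slice {ι : Type} [DecidableEq ι]
    (i : ι) (f : Hil (ι → ℕ)) (n : ι → ℕ) :
    Memℓp (fun k : ℕ => f (Function.update n i k)) 2 := by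
  refine memℓp_two_of_bound _ (‖f‖ ^ 2) fun s => ?_
  have := sum_norm_sq_le f (s.map ⟨Function.update n i, Function.update_injective n i⟩)
  simpa using this

/-- The vector of mode `i` obtained by fixing the occupation numbers of the other modes. -/
noncomputable def slice {ι : Type} [DecidableEq ι]
    (i : ι) (f : Hil (ι → ℕ)) (n : ι → ℕ) : Hil ℕ :=
  ⟨fun k => f (Function.update n i k), memℓp_slice i f n⟩

theorem slice_apply {ι : Type} [DecidableEq ι]
    (i : ι) (f : Hil (ι → ℕ)) (n : ι → ℕ) (k : ℕ) :
    slice i f n k = f (Function.update n i k) := rfl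

theorem slice_update {ι : Type} [DecidableEq ι]
    (i : ι) (f : Hil (ι → ℕ)) (n : ι → ℕ) (l : ℕ) :
    slice i f (Function.update n i l) = slice i f n := by
  exact Hil.ext fun k => by simp [slice_apply]

theorem sum_slice_le {ι : Type} [DecidableEq ι]
    (i : ι) (f : Hil (ι → ℕ)) (R : Finset (ι → ℕ)) (hR : ∀ r ∈ R, r i = 0) :
    ∑ r ∈ R, ‖slice i f r‖ ^ 2 ≤ ‖f‖ ^ 2 := by
  classical
  have h : HasSum (fun k => ∑ r ∈ R, ‖slice i f r k‖ ^ 2) (∑ r ∈ R, ‖slice i f r‖ ^ 2) :=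
    hasSum_sum fun r _ => hasSum_norm_sq _
  refine hasSum_le_of_sum_le h fun K => ?_
  have hinj : Set.InjOn (fun p : ℕ × (ι → ℕ) => Function.update p.2 i p.1)
      (K ×ˢ R : Finset (ℕ × (ι → ℕ))) := by
    rintro ⟨k, r⟩ h1 ⟨k', r'⟩ h2 h
    simp only [Finset.coe_product, Set.mem_prod, Finset.mem_coe] at h1 h2
    have hk : k = k' := by simpa using congrFun h i
    refine Prod.ext hk (funext fun j => ?_)
    by_cases hj : j = i
    · subst hj
      exact (hR r h1.2).trans (hR r' h2.2).symm
    · simpa [hj] using congrFun h j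
  have := sum_norm_sq_le f ((K ×ˢ R).image fun p => Function.update p.2 i p.1)
  rw [Finset.sum_image hinj, Finset.sum_product] at this
  exact this

theorem sum_site_le {ι : Type} [DecidableEq ι]
    (i : ι) (A : Hil ℕ →L[ℂ] Hil ℕ) (f : Hil (ι → ℕ)) (s : Finset (ι → ℕ)) :
    ∑ n ∈ s, ‖A (slice i f n) (n i)‖ ^ 2 ≤ (‖A‖ * ‖f‖) ^ 2 := by
  classical
  set R := s.image (fun n => Function.update n i 0)
  set K := s.image (fun n => n i)
  have hinj : Set.InjOn (fun n : ι → ℕ => (Function.update n i 0, n i)) s := by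
    intro n _ n' _ h
    simp only [Prod.mk.injEq] at h
    funext j
    by_cases hj : j = i
    · subst hj; exact h.2
    · simpa [hj] using congrFun h.1 j
  calc ∑ n ∈ s, ‖A (slice i f n) (n i)‖ ^ 2
      = ∑ p ∈ s.image (fun n : ι → ℕ => (Function.update n i 0, n i)),
          ‖A (slice i f p.1) p.2‖ ^ 2 := by
        rw [Finset.sum_image hinj]
        simp [slice_update]
    _ ≤ ∑ p ∈ R ×ˢ K, ‖A (slice i f p.1) p.2‖ ^ 2 := by
        refine Finset.sum_le_sum_of_subset_of_nonneg ?_ fun _ _ _ => by positivity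
        intro p hp
        obtain ⟨n, hn, rfl⟩ := Finset.mem_image.1 hp
        exact Finset.mem_product.2 ⟨Finset.mem_image_of_mem _ hn, Finset.mem_image_of_mem _ hn⟩
    _ = ∑ r ∈ R, ∑ k ∈ K, ‖A (slice i f r) k‖ ^ 2 := Finset.sum_product _ _ _
    _ ≤ ∑ r ∈ R, ‖A‖ ^ 2 * ‖slice i f r‖ ^ 2 := by
        refine Finset.sum_le_sum fun r _ => (sum_norm_sq_le _ _).trans ?_
        rw [← mul_pow]
        gcongr
        exact A.le_opNorm _
    _ ≤ (‖A‖ * ‖f‖) ^ 2 := by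
        rw [← Finset.mul_sum, mul_pow]
        gcongr
        refine sum_slice_le i f R fun r hr => ?_
        obtain ⟨n, _, rfl⟩ := Finset.mem_image.1 hr
        simp

theorem exists_siteOp {ι : Type} [Fintype ι] [DecidableEq ι]
    (i : ι) (A : Hil ℕ →L[ℂ] Hil ℕ) :
    ∃ T : Hil (ι → ℕ) →L[ℂ] Hil (ι → ℕ),
      ∀ ψ : ι → Hil ℕ, T (prodVec ψ) = prodVec (Function.update ψ i (A (ψ i))) := by
  let T₀ : Hil (ι → ℕ) →ₗ[ℂ] Hil (ι → ℕ) :=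
    { toFun := fun f => ⟨fun n => A (slice i f n) (n i), memℓp_two_of_bound _ _ (sum_site_le i A f)⟩
      map_add' := fun f g => by
        refine Hil.ext fun n => ?_
        have : slice i (f + g) n = slice i f n + slice i g n := Hil.ext fun k => rfl
        change A (slice i (f + g) n) (n i) = A (slice i f n) (n i) + A (slice i g n) (n i)
        rw [this, map_add]; rfl
      map_smul' := fun c f => by
        refine Hil.ext fun n => ?_
        have : slice i (c • f) n = c • slice i f n := Hil.ext fun k => rfl
        change A (slice i (c • f) n) (n i) = c • A (slice i f n) (n i)
        rw [this, map_smul]; rfl }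
  refine ⟨T₀.mkContinuous ‖A‖ fun f => ?_, fun ψ => ?_⟩
  · exact norm_le_of_sum_le _ (by positivity) fun s => sum_site_le i A f s
  · refine Hil.ext fun n => ?_
    change A (slice i (prodVec ψ) n) (n i) = _
    have : slice i (prodVec ψ) n = (∏ j ∈ Finset.univ.erase i, ψ j (n j)) • ψ i := by
      refine Hil.ext fun k => ?_
      rw [slice_apply, prodVec_apply, ← Finset.prod_erase_mul _ _ (Finset.mem_univ i)]
      simp only [Function.update_self]
      change _ = (∏ j ∈ Finset.univ.erase i, ψ j (n j)) * ψ i k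
      congr 1
      refine Finset.prod_congr rfl fun j hj => ?_
      rw [Function.update_of_ne (Finset.ne_of_mem_erase hj)]
    rw [this, map_smul, prodVec_apply, ← Finset.prod_erase_mul _ _ (Finset.mem_univ i)]
    simp only [Function.update_self]
    change (∏ j ∈ Finset.univ.erase i, ψ j (n j)) * A (ψ i) (n i) = _
    congr 1
    refine Finset.prod_congr rfl fun j hj => ?_
    rw [Function.update_of_ne (Finset.ne_of_mem_erase hj)]

theorem exists_tensorOp {ι : Type} [Fintype ι] [DecidableEq ι]
    (A : ι → Hil ℕ →L[ℂ] Hil ℕ) :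
    ∃ T : Hil (ι → ℕ) →L[ℂ] Hil (ι → ℕ),
      ∀ ψ : ι → Hil ℕ, T (prodVec ψ) = prodVec (fun i => A i (ψ i)) := by
  suffices h : ∀ s : Finset ι, ∃ T : Hil (ι → ℕ) →L[ℂ] Hil (ι → ℕ),
      ∀ ψ : ι → Hil ℕ, T (prodVec ψ) = prodVec (fun i => if i ∈ s then A i (ψ i) else ψ i) by
    simpa using h Finset.univ
  intro s
  induction s using Finset.induction_on with
  | empty => exact ⟨ContinuousLinearMap.id ℂ _, fun ψ => by simp⟩
  | insert a s ha ih =>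
    obtain ⟨T, hT⟩ := ih
    obtain ⟨S, hS⟩ := exists_siteOp a (A a)
    refine ⟨S.comp T, fun ψ => ?_⟩
    rw [ContinuousLinearMap.comp_apply, hT, hS]
    congr 1
    funext j
    by_cases hj : j = a
    · subst hj; simp [ha]
    · simp [hj]

/-- The tensor product `⊗ᵢ Aᵢ` of bounded operators on single modes.  It is the bounded operator with
`(⊗ᵢ Aᵢ)(⊗ᵢ ψᵢ) = ⊗ᵢ Aᵢ ψᵢ`; this determines it, since the number states are product vectors. -/
noncomputable def tensorOp {ι : Type} [Fintype ι] [DecidableEq ι] (A : ι → Hil ℕ →L[ℂ] Hil ℕ) :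
    Hil (ι → ℕ) →L[ℂ] Hil (ι → ℕ) :=
  (exists_tensorOp A).choose

theorem tensorOp_prodVec {ι : Type} [Fintype ι] [DecidableEq ι] (A : ι → Hil ℕ →L[ℂ] Hil ℕ)
    (ψ : ι → Hil ℕ) : tensorOp A (prodVec ψ) = prodVec (fun i => A i (ψ i)) :=
  (exists_tensorOp A).choose_spec ψ

/-! ### Coherent vectors and displacement operators -/

theorem hasSum_exp_sq (α : ℂ) : HasSum (fun n : ℕ => ‖α ^ n / (Real.sqrt n.factorial : ℂ)‖ ^ 2)
    (Real.exp (‖α‖ ^ 2)) := by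
  have := NormedSpace.expSeries_div_hasSum_exp (‖α‖ ^ 2 : ℝ)
  rw [← Real.exp_eq_exp_ℝ] at this
  refine this.congr_fun ?_
  intro n
  rw [norm_div, norm_pow, div_pow, Complex.norm_real, Real.norm_eq_abs, sq_abs,
    Real.sq_sqrt (by positivity), ← pow_mul, ← pow_mul, mul_comm]

theorem memℓp_coh (α : ℂ) : Memℓp (fun n : ℕ =>
    (Real.exp (-‖α‖ ^ 2 / 2) : ℂ) * (α ^ n / (Real.sqrt n.factorial : ℂ))) 2 := by
  refine Memℓp.const_mul (memℓp_gen ?_) _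
  simpa using (hasSum_exp_sq α).summable

/-- The single-mode coherent vector `|α⟩ = e^{-|α|²/2} ∑ₙ αⁿ/√(n!) |n⟩`. -/
noncomputable def coh (α : ℂ) : Hil ℕ :=
  ⟨fun n => (Real.exp (-‖α‖ ^ 2 / 2) : ℂ) * (α ^ n / (Real.sqrt n.factorial : ℂ)), memℓp_coh α⟩

theorem coh_apply (α : ℂ) (n : ℕ) : coh α n =
    (Real.exp (-‖α‖ ^ 2 / 2) : ℂ) * (α ^ n / (Real.sqrt n.factorial : ℂ)) := rfl

theorem sqrt_factorial_ne_zero (n : ℕ) : (Real.sqrt n.factorial : ℂ) ≠ 0 := by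
  simp [Nat.factorial_ne_zero]

theorem inner_coh (α β : ℂ) : ⟪coh α, coh β⟫_ℂ =
    Complex.exp (-(‖α‖ ^ 2 / 2 : ℝ) - (‖β‖ ^ 2 / 2 : ℝ) + star α * β) := by
  have h := NormedSpace.expSeries_div_hasSum_exp (star α * β)
  rw [← Complex.exp_eq_exp_ℂ] at h
  have h2 := h.mul_left ((Real.exp (-‖α‖ ^ 2 / 2) : ℂ) * (Real.exp (-‖β‖ ^ 2 / 2) : ℂ))
  have h3 := hasSum_inner (coh α) (coh β)
  have key : ∀ n : ℕ, coh β n * star (coh α n) =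
      (Real.exp (-‖α‖ ^ 2 / 2) : ℂ) * (Real.exp (-‖β‖ ^ 2 / 2) : ℂ) *
        ((star α * β) ^ n / (n.factorial : ℂ)) := by
    intro n
    have hf : (Real.sqrt n.factorial : ℂ) * (Real.sqrt n.factorial : ℂ) = n.factorial := by
      rw [← Complex.ofReal_mul, Real.mul_self_sqrt (by positivity)]; simp
    have h0 := sqrt_factorial_ne_zero n
    rw [coh_apply, coh_apply, ← hf, ← starRingEnd_apply, ← starRingEnd_apply]
    simp only [map_mul, map_div₀, map_pow, Complex.conj_ofReal, mul_pow]
    field_simp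
  refine (h3.congr_fun fun n => (key n).symm).unique h2 |>.trans ?_
  rw [Complex.ofReal_exp, Complex.ofReal_exp, ← Complex.exp_add, ← Complex.exp_add]
  congr 1
  push_cast
  ring

/-- The coherent vectors are total. -/
theorem coh_total (x : Hil ℕ) (hx : ∀ α, ⟪x, coh α⟫_ℂ = 0) : x = 0 := by
  let c : ℕ → ℂ := fun n => star (x n) / (Real.sqrt n.factorial : ℂ)
  have hs : ∀ α : ℂ, HasSum (fun n => α ^ n • c n) 0 := by
    intro α
    have h := hasSum_inner x (coh α)
    rw [hx α] at h
    have h0 : (Real.exp (-‖α‖ ^ 2 / 2) : ℂ) ≠ 0 := by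
      exact_mod_cast (Real.exp_pos _).ne'
    have h2 := h.mul_left (Real.exp (-‖α‖ ^ 2 / 2) : ℂ)⁻¹
    rw [mul_zero] at h2
    refine h2.congr_fun fun n => ?_
    rw [coh_apply, smul_eq_mul]
    change α ^ n * (star (x n) / (Real.sqrt n.factorial : ℂ)) = _
    field_simp
  have hp : HasFPowerSeriesAt (0 : ℂ → ℂ) (FormalMultilinearSeries.ofScalars ℂ c) 0 := by
    rw [hasFPowerSeriesAt_iff]
    refine Filter.Eventually.of_forall fun z => ?_
    simpa [FormalMultilinearSeries.coeff_ofScalars] using hs z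
  have h0 := hp.eq_zero
  refine Hil.ext fun n => ?_
  change x n = 0
  have h1 : c n = 0 := by
    have := FormalMultilinearSeries.coeff_ofScalars (𝕜 := ℂ) (p := c) (n := n)
    rw [← this, h0]; rfl
  simpa [c, sqrt_factorial_ne_zero n] using h1

/-- The vector `D(ξ)|α⟩ = e^{(ξ ᾱ - ξ̄ α)/2} |α + ξ⟩`. -/
noncomputable def shiftedCoh (ξ α : ℂ) : Hil ℕ :=
  Complex.exp ((ξ * star α - star ξ * α) / 2) • coh (α + ξ)

/-- The displacement (Weyl) operator `D(ξ) = exp(ξ a† - ξ̄ a)`: the bounded operator with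
`D(ξ)|α⟩ = e^{(ξ ᾱ - ξ̄ α)/2} |α + ξ⟩` for all `α` (see `displacement_coh`), obtained by continuous
extension from the dense span of the coherent vectors. -/
noncomputable def displacement (ξ : ℂ) : Hil ℕ →L[ℂ] Hil ℕ :=
  (Finsupp.linearCombination ℂ (shiftedCoh ξ)).extendOfNorm (Finsupp.linearCombination ℂ coh)

theorem denseRange_cohComb : DenseRange (Finsupp.linearCombination ℂ coh) := by
  have : (LinearMap.range (Finsupp.linearCombination ℂ coh)).topologicalClosure = ⊤ := by
    rw [Submodule.topologicalClosure_eq_top_iff, Submodule.eq_bot_iff]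
    intro x hx
    refine coh_total x fun α => ?_
    refine (Submodule.mem_orthogonal' _ _).1 hx _ ⟨Finsupp.single α 1, by simp⟩
  rw [DenseRange, ← LinearMap.coe_range]
  exact Submodule.dense_iff_topologicalClosure_eq_top.2 this

theorem inner_shiftedCoh (ξ α β : ℂ) :
    ⟪shiftedCoh ξ α, shiftedCoh ξ β⟫_ℂ = ⟪coh α, coh β⟫_ℂ := by
  rw [shiftedCoh, shiftedCoh, inner_smul_left, inner_smul_right, inner_coh, inner_coh,
    ← Complex.exp_conj, ← Complex.exp_add, ← Complex.exp_add]
  congr 1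
  simp only [Complex.ofReal_div, Complex.ofReal_pow, ← Complex.conj_mul', map_div₀, map_sub,
    map_mul, map_add, starRingEnd_apply, star_star, star_add, star_ofNat, Complex.ofReal_ofNat]
  ring

theorem displacement_coh (ξ α : ℂ) :
    displacement ξ (coh α) = Complex.exp ((ξ * star α - star ξ * α) / 2) • coh (α + ξ) := by
  have hn : ∀ x : ℂ →₀ ℂ, ‖Finsupp.linearCombination ℂ (shiftedCoh ξ) x‖
      ≤ 1 * ‖Finsupp.linearCombination ℂ coh x‖ := by
    intro x
    rw [one_mul, norm_eq_sqrt_re_inner (𝕜 := ℂ), norm_eq_sqrt_re_inner (𝕜 := ℂ)]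
    refine le_of_eq ?_
    congr 2
    simp only [Finsupp.linearCombination_apply, Finsupp.sum, sum_inner, inner_sum,
      inner_smul_left, inner_smul_right, inner_shiftedCoh]
  have := LinearMap.extendOfNorm_eq (f := Finsupp.linearCombination ℂ (shiftedCoh ξ))
    denseRange_cohComb ⟨1, hn⟩ (Finsupp.single α 1)
  simpa [displacement, shiftedCoh] using this

/-! ### States, fidelity, energy -/

/-- The trace, in the number basis. -/
noncomputable def trace {X : Type} [DecidableEq X] (T : Hil X →L[ℂ] Hil X) : ℂ :=
  ∑' x, ⟪ket x, T (ket x)⟫_ℂ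

/-- Density operators: positive, of trace one. -/
def IsState {X : Type} [DecidableEq X] (ρ : Hil X →L[ℂ] Hil X) : Prop :=
  0 ≤ ρ ∧ HasSum (fun x => ⟪ket x, ρ (ket x)⟫_ℂ) 1

/-- The Bures fidelity `F(ρ, σ) = tr √(√ρ σ √ρ)`. -/
noncomputable def fidelity {X : Type} [DecidableEq X] (ρ σ : Hil X →L[ℂ] Hil X) : ℝ :=
  (trace (CFC.sqrt (CFC.sqrt ρ * σ * CFC.sqrt ρ))).re

/-- The fidelity-based lower bound `∑_{k' > k} p_{k'} p_k F²(ρ_{k'}, ρ_k)` on the error probability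
of discriminating the states `ρ_k` with prior probabilities `p_k`. -/
noncomputable def fidelityLowerBound {X : Type} [DecidableEq X] {m : ℕ} (p : Fin m → ℝ)
    (ρ : Fin m → Hil X →L[ℂ] Hil X) : ℝ :=
  ∑ k, ∑ k' ∈ Finset.Ioi k, p k' * p k * fidelity (ρ k') (ρ k) ^ 2

/-- The projector onto the product coherent vector `⊗ᵢ |αᵢ⟩`. -/
noncomputable def coherentState {ι : Type} [Fintype ι] (α : ι → ℂ) :
    Hil (ι → ℕ) →L[ℂ] Hil (ι → ℕ) :=
  InnerProductSpace.rankOne ℂ (prodVec fun i => coh (α i)) (prodVec fun i => coh (α i))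

/-- Classical states: density operators with a positive P-representation, i.e. mixtures
`ρ = ∫ |α⟩⟨α| dP(α)` (weakly) of multimode coherent states, `P` an arbitrary probability measure. -/
def IsClassical {ι : Type} [Fintype ι] [DecidableEq ι] (ρ : Hil (ι → ℕ) →L[ℂ] Hil (ι → ℕ)) : Prop :=
  IsState ρ ∧ ∃ P : MeasureTheory.Measure (ι → ℂ), MeasureTheory.IsProbabilityMeasure P ∧
    ∀ x y, ⟪x, ρ y⟫_ℂ = ∫ α, ⟪x, coherentState α y⟫_ℂ ∂P

/-- The mean total photon number `∑ₙ (∑ᵢ nᵢ) ⟨n|ρ|n⟩`, possibly infinite. -/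
noncomputable def meanPhotonNumber {ι : Type} [Fintype ι] [DecidableEq ι]
    (ρ : Hil (ι → ℕ) →L[ℂ] Hil (ι → ℕ)) : ℝ≥0∞ :=
  ∑' n : ι → ℕ, ((∑ i, n i : ℕ) : ℝ≥0∞) * ENNReal.ofReal (⟪ket n, ρ (ket n)⟫_ℂ).re

/-! ### Channels -/

/-- A quantum channel on one mode: a normal completely positive trace-preserving map, given by Kraus
operators with `∑ⱼ Kⱼ† Kⱼ = 1`.  (The mode is separable, so countably many operators suffice.) -/
structure QuantumChannel where
  kraus : ℕ → (Hil ℕ →L[ℂ] Hil ℕ)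
  complete : ∀ x, HasSum (fun j => ‖kraus j x‖ ^ 2) (‖x‖ ^ 2)

/-- The map `ρ ↦ ∑ⱼ Kⱼ ρ Kⱼ†`. -/
noncomputable def applyKraus {X J : Type} (K : J → Hil X →L[ℂ] Hil X) (ρ : Hil X →L[ℂ] Hil X) :
    Hil X →L[ℂ] Hil X :=
  ∑' j, K j ∘L ρ ∘L ContinuousLinearMap.adjoint (K j)

/-- The Kraus operators `⊗ᵢ K⁽ⁱ⁾_{jᵢ}` of the tensor product `⊗ᵢ Φᵢ` of single-mode channels. -/
noncomputable def tensorKraus {ι : Type} [Fintype ι] [DecidableEq ι] (Φ : ι → QuantumChannel) :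
    (ι → ℕ) → Hil (ι → ℕ) →L[ℂ] Hil (ι → ℕ) :=
  fun j => tensorOp fun i => (Φ i).kraus (j i)

/-- The two kinds of phase-insensitive channels: `a ↦ √μ a + noise` (thermal loss, noisy amplifier,
additive noise), and `a ↦ √μ a† + noise` (conjugate thermal amplifier). -/
inductive PhaseKind
  | covariant
  | contravariant

/-- The transformation of the argument of the displacement operator: substituting `√μ a`, resp.
`√μ a†`, for `a` in `exp(ξ a† - ξ̄ a)`. -/
noncomputable def PhaseKind.scale (κ : PhaseKind) (μ : ℝ) (ξ : ℂ) : ℂ :=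
  match κ with
  | .covariant => (Real.sqrt μ : ℂ) * ξ
  | .contravariant => -((Real.sqrt μ : ℂ) * star ξ)

/-- `Φ` is the phase-insensitive bosonic Gaussian channel with transmissivity/gain `μ` and output
noise `E` (mean number of photons at the output for vacuum input).  In the Heisenberg picture
`a ↦ √μ a + noise` (resp. `√μ a† + noise`) with phase-invariant Gaussian noise, i.e.
`Φ*(D(ξ)) = e^{-(2E+1-μ)|ξ|²/2} D(√μ ξ)` (resp. `D(-√μ ξ̄)`); the exponent makes the output
covariance matrix for coherent input equal to `(2E+1) I` (vacuum noise being `1`). -/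
def IsPhaseInsensitiveGaussian (κ : PhaseKind) (μ E : ℝ) (Φ : QuantumChannel) : Prop :=
  0 ≤ μ ∧ 0 ≤ E ∧ ∀ ξ x y,
    HasSum (fun j => ⟪Φ.kraus j x, displacement ξ (Φ.kraus j y)⟫_ℂ)
      ((Real.exp (-((2 * E + 1 - μ) * ‖ξ‖ ^ 2 / 2)) : ℂ) * ⟪x, displacement (κ.scale μ ξ) y⟫_ℂ)

/-! ### Channel-position finding -/

/-- The modes: subsystem `k` carries `Mk k` modes. -/
abbrev Modes {m : ℕ} (Mk : Fin m → ℕ) : Type := Σ k : Fin m, Fin (Mk k)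

/-- The output, for input `ρ`, of the global channel with target in position `n`:
every mode of subsystem `n` goes through `ΦT`, every other mode through `ΦB`. -/
noncomputable def cpfOutput {m : ℕ} (Mk : Fin m → ℕ) (ΦT ΦB : QuantumChannel)
    (ρ : Hil (Modes Mk → ℕ) →L[ℂ] Hil (Modes Mk → ℕ)) (n : Fin m) :
    Hil (Modes Mk → ℕ) →L[ℂ] Hil (Modes Mk → ℕ) :=
  applyKraus (tensorKraus fun i : Modes Mk => if i.1 = n then ΦT else ΦB) ρ

/-- The fidelity-based lower bound for equiprobable target positions and input `ρ`. -/
noncomputable def cpfLowerBound {m : ℕ} (Mk : Fin m → ℕ) (ΦT ΦB : QuantumChannel)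
    (ρ : Hil (Modes Mk → ℕ) →L[ℂ] Hil (Modes Mk → ℕ)) : ℝ :=
  fidelityLowerBound (fun _ : Fin m => 1 / (m : ℝ)) (cpfOutput Mk ΦT ΦB ρ)

/-- The classical inputs irradiating at most `e` mean photons in total. -/
def classicalInputs {m : ℕ} (Mk : Fin m → ℕ) (e : ℝ) :
    Set (Hil (Modes Mk → ℕ) →L[ℂ] Hil (Modes Mk → ℕ)) :=
  {ρ | IsClassical ρ ∧ meanPhotonNumber ρ ≤ ENNReal.ofReal e}

/-- The tensor product of coherent states with phases `θ` and mean photon numbers `N`. -/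
noncomputable def coherentInput {m : ℕ} (Mk : Fin m → ℕ) (θ N : (k : Fin m) → Fin (Mk k) → ℝ) :
    Hil (Modes Mk → ℕ) →L[ℂ] Hil (Modes Mk → ℕ) :=
  coherentState fun i : Modes Mk =>
    Complex.exp (Complex.I * (θ i.1 i.2 : ℂ)) * (Real.sqrt (N i.1 i.2) : ℂ)

/-- The constant `c_{E_B,E_T}`. -/
noncomputable def noiseConst (EB ET : ℝ) : ℝ :=
  (1 + (Real.sqrt (EB * (1 + ET)) - Real.sqrt (ET * (1 + EB))) ^ 2)⁻¹

end CPF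

/-! On a coherent input a phase-insensitive channel produces a displaced thermal state, with
amplitude `√μ α` (or `√μ ᾱ`) and `E` thermal photons. Two global channels `k ≠ k'` differ only on
the subsystems `k` and `k'`, so the fidelity of the outputs for a product of coherent states is a
product of single-mode fidelities. It depends on the input only through the energies `x k`, `x k'`
of these two subsystems, and its square is `c ^ (Mk k' + Mk k) * exp (-q (x k' + x k))` with `q =
(√μB - √μT)² / (1 + EB + ET)`.

A classical input is a mixture of coherent ones. Joint concavity of the fidelity bounds its output
fidelity below by the average of the coherent values. Convexity of `exp` then replaces the random
energies by their means (Jensen), and once more replaces the energies of the pairs by their average,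
which the energy constraint controls. Uniform coherent inputs turn all these inequalities into
equalities. Strict convexity forces `x k + x k' = 2L` for every pair, where `L = M N_S`, and three
indices are then enough to give `x k = L`.

The fidelity is handled by two dual bounds. If `|⟪x, T y⟫|² ≤ ⟪x, ρ x⟫ ⟪y, σ y⟫` then `|tr T| ≤ F(ρ,
σ)` (`norm_trace_le_fidelity`); if `ρ = A A†`, `σ = B B†` and `B† A ≥ 0` then `F(ρ, σ) ≤ tr (B† A)`
(`fidelity_le_of_factor`). For displaced thermal states `thermalFactor_align` gives factors `A`, `B`
with `B† A` positive and of known trace, so both bounds meet. Integrating `A B†` over the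
P-representation gives the operator `T` that proves the concavity (`integral_le_fidelity`). That
coherent inputs give displaced thermal states is read off the characteristic function by
Fourier–Weyl inversion (`weyl_inversion`, `hasSum_of_characteristic`). -/

namespace CPF

/-! ### Factorization of operators and Hilbert–Schmidt sums -/

/-- Douglas factorization: `S x ↦ T x` is well defined and bounded on the range of `S`, extends to
its closure by continuity and to `H` by zero on the orthogonal complement. The last clause is what
locates the range of `C†` in `exists_sandwich`. -/
theorem exists_factor {H : Type} [NormedAddCommGroup H] [InnerProductSpace ℂ H] [CompleteSpace H]
    (S T : H →L[ℂ] H) {c : ℝ} (hc : 0 ≤ c) (h : ∀ x, ‖T x‖ ≤ c * ‖S x‖) :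
    ∃ C : H →L[ℂ] H, ‖C‖ ≤ c ∧ T = C ∘L S ∧ ∀ z, (∀ x, ⟪S x, z⟫_ℂ = 0) → C z = 0 := by
  let K : Submodule ℂ H := (LinearMap.range (S : H →ₗ[ℂ] H)).topologicalClosure
  have : CompleteSpace K :=
    (Submodule.isClosed_topologicalClosure _).completeSpace_coe
  have hmem : ∀ x, (S : H →ₗ[ℂ] H) x ∈ K := fun x =>
    Submodule.le_topologicalClosure _ ⟨x, rfl⟩
  let e : H →ₗ[ℂ] K := (S : H →ₗ[ℂ] H).codRestrict K hmem
  have hden : DenseRange e := by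
    intro y
    rw [Metric.mem_closure_iff]
    intro ε hε
    obtain ⟨_, ⟨x, rfl⟩, hx⟩ := Metric.mem_closure_iff.1
      (show (y : H) ∈ closure (LinearMap.range (S : H →ₗ[ℂ] H) : Set H) from y.2) ε hε
    exact ⟨e x, ⟨x, rfl⟩, hx⟩
  have hn : ∀ x, ‖(T : H →ₗ[ℂ] H) x‖ ≤ c * ‖e x‖ := h
  refine ⟨((T : H →ₗ[ℂ] H).extendOfNorm e).comp K.orthogonalProjectionOnto, ?_, ?_, ?_⟩
  · refine ContinuousLinearMap.opNorm_le_bound _ hc fun x => ?_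
    refine (LinearMap.norm_extendOfNorm_apply_le hden c hn _).trans ?_
    gcongr
    exact K.norm_orthogonalProjectionOnto_apply_le x
  · ext x
    have : K.orthogonalProjectionOnto (S x) = e x :=
      Submodule.orthogonalProjectionOnto_mem_subspace_eq_self (K := K) (e x)
    rw [ContinuousLinearMap.comp_apply, ContinuousLinearMap.comp_apply, this,
      LinearMap.extendOfNorm_eq hden ⟨c, hn⟩]
    rfl
  · intro z hz
    have : K.orthogonalProjectionOnto z = 0 := by
      rw [Submodule.orthogonalProjectionOnto_eq_zero_iff, Submodule.orthogonal_closure,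
        Submodule.mem_orthogonal]
      rintro _ ⟨x, rfl⟩
      exact hz x
    rw [ContinuousLinearMap.comp_apply, this, map_zero]

theorem norm_inner_self_eq_sq {H : Type} [NormedAddCommGroup H] [InnerProductSpace ℂ H] (x : H) :
    ‖⟪x, x⟫_ℂ‖ = ‖x‖ ^ 2 := by
  rw [inner_self_eq_norm_sq_to_K]
  simp

/-- Two successive Douglas factorizations. The first has only the crude constant `‖S‖`; the sharp
constant 1 is recovered in the second, because the range of `E†` lies in the closure of the range of
`R`, where the hypothesis tests the norm exactly. -/
theorem exists_sandwich {H : Type} [NormedAddCommGroup H] [InnerProductSpace ℂ H] [CompleteSpace H]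
    (R S X : H →L[ℂ] H) (h : ∀ x y, ‖⟪x, X y⟫_ℂ‖ ≤ ‖R x‖ * ‖S y‖) :
    ∃ C : H →L[ℂ] H, ‖C‖ ≤ 1 ∧ X = R.adjoint ∘L C ∘L S := by
  have h1 : ∀ x, ‖X.adjoint x‖ ≤ ‖S‖ * ‖R x‖ := by
    intro x
    have h2 := h x (X.adjoint x)
    rw [← ContinuousLinearMap.adjoint_inner_left, norm_inner_self_eq_sq] at h2
    by_contra! hlt
    have h3 : ‖S (X.adjoint x)‖ ≤ ‖S‖ * ‖X.adjoint x‖ := S.le_opNorm _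
    have h4 : 0 < ‖X.adjoint x‖ := lt_of_le_of_lt (by positivity) hlt
    nlinarith [norm_nonneg (R x)]
  obtain ⟨E, -, hE, hE0⟩ := exists_factor R X.adjoint (norm_nonneg S) h1
  have hX : X = R.adjoint ∘L E.adjoint := by
    rw [← ContinuousLinearMap.adjoint_comp, ← hE, ContinuousLinearMap.adjoint_adjoint]
  have h5 : ∀ y, ‖E.adjoint y‖ ≤ 1 * ‖S y‖ := by
    intro y
    set q := E.adjoint y
    have hq : q ∈ (LinearMap.range (R : H →ₗ[ℂ] H)).topologicalClosure := by
      rw [← Submodule.orthogonal_orthogonal_eq_closure, Submodule.mem_orthogonal]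
      intro z hz
      rw [ContinuousLinearMap.adjoint_inner_right, hE0 z, inner_zero_left]
      intro x
      exact (Submodule.mem_orthogonal _ _).1 hz _ ⟨x, rfl⟩
    -- On `u = R x` this is the hypothesis; both sides are continuous in `u`. It is then used at `u
    -- = q` itself.
    have h6 : ∀ u ∈ closure (LinearMap.range (R : H →ₗ[ℂ] H) : Set H),
        ‖⟪u, q⟫_ℂ‖ ≤ ‖u‖ * ‖S y‖ := by
      intro u hu
      refine closure_minimal (t := {u | ‖⟪u, q⟫_ℂ‖ ≤ ‖u‖ * ‖S y‖}) ?_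
        (isClosed_le (by fun_prop) (by fun_prop)) hu
      rintro _ ⟨x, rfl⟩
      have := h x y
      rwa [hX, ContinuousLinearMap.comp_apply, ContinuousLinearMap.adjoint_inner_right] at this
    have h7 := h6 q hq
    rw [norm_inner_self_eq_sq] at h7
    by_contra! hlt
    have h4 : 0 < ‖q‖ := lt_of_le_of_lt (by positivity) hlt
    nlinarith
  obtain ⟨C, hC, hEC, -⟩ := exists_factor S E.adjoint zero_le_one h5
  exact ⟨C, hC, by rw [hX, hEC]⟩

/-! ### Traces and Hilbert–Schmidt norms on `ℓ²(X)` -/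

section HilbertSchmidt

variable {X : Type}

theorem norm_inner_le_half (f g : Hil X) : ‖⟪f, g⟫_ℂ‖ ≤ (‖f‖ ^ 2 + ‖g‖ ^ 2) / 2 := by
  nlinarith [norm_inner_le_norm (𝕜 := ℂ) f g, sq_nonneg (‖f‖ - ‖g‖)]

theorem ofReal_norm_sq (f : Hil X) :
    ENNReal.ofReal (‖f‖ ^ 2) = ∑' x, ENNReal.ofReal (‖f x‖ ^ 2) := by
  rw [← (hasSum_norm_sq f).tsum_eq, ENNReal.ofReal_tsum_of_nonneg (fun _ => by positivity)
    (hasSum_norm_sq f).summable]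

theorem norm_sqrt_apply_sq {P : Hil X →L[ℂ] Hil X} (hP : 0 ≤ P) (x : Hil X) :
    ((‖CFC.sqrt P x‖ ^ 2 : ℝ) : ℂ) = ⟪x, P x⟫_ℂ := by
  have h1 : (CFC.sqrt P).IsPositive :=
    (ContinuousLinearMap.nonneg_iff_isPositive _).1 (CFC.sqrt_nonneg P)
  conv_rhs => rw [← CFC.sqrt_mul_sqrt_self P hP]
  rw [mul_apply_eq_comp, ← ContinuousLinearMap.adjoint_inner_left,
    h1.isSelfAdjoint.adjoint_eq, inner_self_eq_norm_sq_to_K]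
  push_cast
  rfl

theorem adjoint_sqrt (P : Hil X →L[ℂ] Hil X) :
    (CFC.sqrt P).adjoint = CFC.sqrt P :=
  ((ContinuousLinearMap.nonneg_iff_isPositive _).1 (CFC.sqrt_nonneg P)).isSelfAdjoint.adjoint_eq

theorem norm_sqrt_apply_of_eq {ρ A : Hil X →L[ℂ] Hil X} (hρ : ρ = A ∘L A.adjoint) (x : Hil X) :
    ‖CFC.sqrt ρ x‖ = ‖A.adjoint x‖ := by
  have h0 : 0 ≤ ρ := by
    rw [hρ, ContinuousLinearMap.nonneg_iff_isPositive]
    exact ContinuousLinearMap.isPositive_self_comp_adjoint A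
  have h := norm_sqrt_apply_sq h0 x
  rw [hρ, ContinuousLinearMap.comp_apply, ← ContinuousLinearMap.adjoint_inner_left, ← hρ,
    inner_self_eq_norm_sq_to_K] at h
  have h2 : ‖CFC.sqrt ρ x‖ ^ 2 = ‖A.adjoint x‖ ^ 2 := by
    refine Complex.ofReal_injective ?_
    rw [h]
    push_cast
    rfl
  exact (pow_left_inj₀ (norm_nonneg _) (norm_nonneg _) two_ne_zero).1 h2

/-- `√(√ρ σ √ρ)` is the absolute value of `√σ √ρ`. -/
theorem norm_sqrt_sandwich_apply {ρ σ : Hil X →L[ℂ] Hil X} (hσ : 0 ≤ σ) (x : Hil X) :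
    ‖CFC.sqrt (CFC.sqrt ρ * σ * CFC.sqrt ρ) x‖ = ‖CFC.sqrt σ (CFC.sqrt ρ x)‖ := by
  have h : CFC.sqrt ρ * σ * CFC.sqrt ρ =
      (CFC.sqrt ρ ∘L CFC.sqrt σ) ∘L (CFC.sqrt ρ ∘L CFC.sqrt σ).adjoint := by
    rw [ContinuousLinearMap.adjoint_comp, adjoint_sqrt, adjoint_sqrt]
    conv_lhs => rw [← CFC.sqrt_mul_sqrt_self σ hσ]
    rfl
  rw [norm_sqrt_apply_of_eq h, ContinuousLinearMap.adjoint_comp, adjoint_sqrt, adjoint_sqrt]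
  rfl

variable [DecidableEq X]

theorem ket_apply (x y : X) : ket x y = if y = x then 1 else 0 := by
  change (lp.single 2 x (1 : ℂ) : ∀ _, ℂ) y = _
  rw [lp.single_apply]
  split_ifs with h
  · subst h; simp
  · simp [h]

theorem inner_ket (x : X) (f : Hil X) : ⟪ket x, f⟫_ℂ = f x := by
  refine (hasSum_inner (ket x) f).unique ?_
  convert hasSum_ite_eq x (f x) using 2 with y
  rw [ket_apply]
  split_ifs with h
  · subst h; simp
  · simp

theorem inner_ket_right (x : X) (f : Hil X) : ⟪f, ket x⟫_ℂ = star (f x) := by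
  rw [← inner_conj_symm, inner_ket]; rfl

theorem norm_ket (x : X) : ‖ket x‖ = 1 := by
  have h := inner_self_eq_norm_sq_to_K (𝕜 := ℂ) (ket x)
  rw [inner_ket, ket_apply, if_pos rfl] at h
  have : ‖ket x‖ ^ 2 = 1 := by
    have h' : ((‖ket x‖ ^ 2 : ℝ) : ℂ) = ((1 : ℝ) : ℂ) := by push_cast; exact h.symm
    exact Complex.ofReal_injective h'
  nlinarith [norm_nonneg (ket x)]

/-- The squared Hilbert–Schmidt norm, possibly infinite. -/
noncomputable def hsSq (T : Hil X →L[ℂ] Hil X) : ℝ≥0∞ := ∑' x, ENNReal.ofReal (‖T (ket x)‖ ^ 2)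

/-- Both sides are the sum of all squared matrix entries; with values in `ℝ≥0∞` the order of
summation is free. -/
theorem hsSq_adjoint (T : Hil X →L[ℂ] Hil X) : hsSq T.adjoint = hsSq T := by
  simp only [hsSq, ofReal_norm_sq]
  rw [ENNReal.tsum_comm]
  congr! 6 with x y
  rw [← inner_ket y, ← inner_ket x, ← norm_inner_symm, ContinuousLinearMap.adjoint_inner_left]

theorem hsSq_comp_left (C T : Hil X →L[ℂ] Hil X) (hC : ‖C‖ ≤ 1) : hsSq (C ∘L T) ≤ hsSq T := by
  refine ENNReal.tsum_le_tsum fun x => ENNReal.ofReal_le_ofReal ?_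
  gcongr
  exact (C.le_opNorm _).trans (mul_le_of_le_one_left (norm_nonneg _) hC)

theorem hsSq_comp_right (C T : Hil X →L[ℂ] Hil X) (hC : ‖C‖ ≤ 1) : hsSq (T ∘L C) ≤ hsSq T := by
  rw [← hsSq_adjoint, ContinuousLinearMap.adjoint_comp, ← hsSq_adjoint T]
  exact hsSq_comp_left _ _ (by rwa [LinearIsometryEquiv.norm_map])

theorem hsSq_eq_of_hasSum {T : Hil X →L[ℂ] Hil X} {c : ℝ}
    (h : HasSum (fun x => ‖T (ket x)‖ ^ 2) c) : hsSq T = ENNReal.ofReal c := by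
  rw [hsSq, ← h.tsum_eq, ENNReal.ofReal_tsum_of_nonneg (fun _ => by positivity) h.summable]

theorem summable_of_hsSq {T : Hil X →L[ℂ] Hil X} (h : hsSq T ≠ ∞) :
    Summable (fun x => ‖T (ket x)‖ ^ 2) := by
  have := ENNReal.summable_toReal h
  refine this.congr fun x => ENNReal.toReal_ofReal (by positivity)

theorem tsum_of_hsSq {T : Hil X →L[ℂ] Hil X} :
    ∑' x, ‖T (ket x)‖ ^ 2 = (hsSq T).toReal := by
  rw [hsSq, ENNReal.tsum_toReal_eq (fun _ => ENNReal.ofReal_ne_top)]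
  exact tsum_congr fun x => (ENNReal.toReal_ofReal (by positivity)).symm

theorem summable_norm_inner {A B : Hil X →L[ℂ] Hil X} (hA : hsSq A ≠ ∞) (hB : hsSq B ≠ ∞) :
    Summable (fun x => ‖⟪A (ket x), B (ket x)⟫_ℂ‖) :=
  Summable.of_nonneg_of_le (fun _ => norm_nonneg _) (fun _ => norm_inner_le_half _ _)
    (((summable_of_hsSq hA).add (summable_of_hsSq hB)).div_const 2)

theorem norm_tsum_inner_le {A B : Hil X →L[ℂ] Hil X} {t : ℝ} (ht : 0 ≤ t)
    (hA : hsSq A ≤ ENNReal.ofReal t) (hB : hsSq B ≤ ENNReal.ofReal t) :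
    ‖∑' x, ⟪A (ket x), B (ket x)⟫_ℂ‖ ≤ t := by
  have hA' : hsSq A ≠ ∞ := (hA.trans_lt ENNReal.ofReal_lt_top).ne
  have hB' : hsSq B ≠ ∞ := (hB.trans_lt ENNReal.ofReal_lt_top).ne
  have hs := summable_norm_inner hA' hB'
  refine (norm_tsum_le_tsum_norm hs).trans ?_
  refine (hs.tsum_le_tsum (fun _ => norm_inner_le_half _ _)
    (((summable_of_hsSq hA').add (summable_of_hsSq hB')).div_const 2)).trans ?_
  rw [tsum_div_const, (summable_of_hsSq hA').tsum_add (summable_of_hsSq hB'), tsum_of_hsSq,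
    tsum_of_hsSq]
  have h1 := ENNReal.toReal_mono ENNReal.ofReal_ne_top hA
  have h2 := ENNReal.toReal_mono ENNReal.ofReal_ne_top hB
  rw [ENNReal.toReal_ofReal ht] at h1 h2
  linarith

/-- Cyclicity of the trace for a product of Hilbert–Schmidt operators. -/
theorem tsum_inner_adjoint {A B : Hil X →L[ℂ] Hil X} (hA : hsSq A ≠ ∞) (hB : hsSq B ≠ ∞) :
    ∑' x, ⟪A (ket x), B (ket x)⟫_ℂ = ∑' x, ⟪B.adjoint (ket x), A.adjoint (ket x)⟫_ℂ := by
  have hsum : ∀ T : Hil X →L[ℂ] Hil X, hsSq T ≠ ∞ →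
      Summable (fun p : X × X => ‖T (ket p.1) p.2‖ ^ 2) := by
    intro T hT
    refine (summable_prod_of_nonneg fun p => sq_nonneg _).2
      ⟨fun x => (hasSum_norm_sq (T (ket x))).summable, ?_⟩
    exact (summable_of_hsSq hT).congr fun x => (hasSum_norm_sq (T (ket x))).tsum_eq.symm
  have key : Summable (fun p : X × X => B (ket p.1) p.2 * star (A (ket p.1) p.2)) := by
    refine Summable.of_norm_bounded (((hsum A hA).add (hsum B hB)).div_const 2) fun p => ?_
    rw [norm_mul, norm_star]
    nlinarith [sq_nonneg (‖A (ket p.1) p.2‖ - ‖B (ket p.1) p.2‖)]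
  have h1 : ∀ x, ⟪A (ket x), B (ket x)⟫_ℂ = ∑' y, B (ket x) y * star (A (ket x) y) :=
    fun x => (hasSum_inner _ _).tsum_eq.symm
  have h2 : ∀ y, ⟪B.adjoint (ket y), A.adjoint (ket y)⟫_ℂ
      = ∑' x, B (ket x) y * star (A (ket x) y) := by
    intro y
    rw [← (hasSum_inner _ _).tsum_eq]
    refine tsum_congr fun x => ?_
    rw [← inner_ket x, ← inner_ket x, ContinuousLinearMap.adjoint_inner_right,
      ContinuousLinearMap.adjoint_inner_right, inner_ket_right, inner_ket_right, star_star, mul_comm]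
  simp only [h1, h2]
  exact (Summable.tsum_comm (f := fun x y => B (ket x) y * star (A (ket x) y)) key).symm

theorem hsSq_sqrt {P : Hil X →L[ℂ] Hil X} (hP : 0 ≤ P) {t : ℝ}
    (h : HasSum (fun x => ⟪ket x, P (ket x)⟫_ℂ) t) : hsSq (CFC.sqrt P) = ENNReal.ofReal t := by
  refine hsSq_eq_of_hasSum ?_
  have h2 : HasSum (fun x => ((‖CFC.sqrt P (ket x)‖ ^ 2 : ℝ) : ℂ)) (t : ℂ) := by
    simpa only [norm_sqrt_apply_sq hP] using h
  exact_mod_cast h2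

/-- `|tr (C P D)| ≤ tr P` for contractions: write the trace as the Hilbert–Schmidt pairing of `√P
C†` and `√P D`, each of squared norm at most `tr P`. -/
theorem norm_tsum_contraction_le {P : Hil X →L[ℂ] Hil X} (hP : 0 ≤ P) {t : ℝ}
    (h : HasSum (fun x => ⟪ket x, P (ket x)⟫_ℂ) t) (C D : Hil X →L[ℂ] Hil X)
    (hC : ‖C‖ ≤ 1) (hD : ‖D‖ ≤ 1) : ‖∑' x, ⟪ket x, C (P (D (ket x)))⟫_ℂ‖ ≤ t := by
  have ht : 0 ≤ t := by
    have h2 : HasSum (fun x => ((‖CFC.sqrt P (ket x)‖ ^ 2 : ℝ) : ℂ)) (t : ℂ) := by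
      simpa only [norm_sqrt_apply_sq hP] using h
    have h3 : HasSum (fun x => ‖CFC.sqrt P (ket x)‖ ^ 2) t := by exact_mod_cast h2
    exact h3.nonneg fun x => by positivity
  have hQ := hsSq_sqrt hP h
  have := norm_tsum_inner_le ht (A := CFC.sqrt P ∘L C.adjoint) (B := CFC.sqrt P ∘L D)
    ((hsSq_comp_right _ _ (by rwa [LinearIsometryEquiv.norm_map])).trans hQ.le)
    ((hsSq_comp_right _ _ hD).trans hQ.le)
  refine le_of_eq_of_le ?_ this
  congr 1
  refine tsum_congr fun x => ?_
  conv_lhs => rw [← CFC.sqrt_mul_sqrt_self P hP]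
  rw [ContinuousLinearMap.comp_apply, ContinuousLinearMap.comp_apply, mul_apply_eq_comp,
    ← ContinuousLinearMap.adjoint_inner_left C,
    ← ContinuousLinearMap.adjoint_inner_left (CFC.sqrt P), adjoint_sqrt]

/-! ### Bounds on the fidelity -/

/-- This excludes the default value 0 of a divergent `tsum` in `fidelity`. The operator `√(√ρ σ √ρ)`
is `W √σ √ρ` with `W` a contraction, a product of two Hilbert–Schmidt operators. -/
theorem hasSum_trace_fidelity {ρ σ : Hil X →L[ℂ] Hil X} (hρ : 0 ≤ ρ) (hσ : 0 ≤ σ) {r s : ℝ}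
    (hr : HasSum (fun x => ⟪ket x, ρ (ket x)⟫_ℂ) r)
    (hs : HasSum (fun x => ⟪ket x, σ (ket x)⟫_ℂ) s) :
    HasSum (fun x => ⟪ket x, CFC.sqrt (CFC.sqrt ρ * σ * CFC.sqrt ρ) (ket x)⟫_ℂ)
      (fidelity ρ σ : ℝ) := by
  set Z := CFC.sqrt (CFC.sqrt ρ * σ * CFC.sqrt ρ) with hZ
  have hZ0 : 0 ≤ Z := CFC.sqrt_nonneg _
  obtain ⟨W, hW, hZW, -⟩ := exists_factor (CFC.sqrt σ ∘L CFC.sqrt ρ) Z zero_le_one fun x => by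
    rw [one_mul, hZ, norm_sqrt_sandwich_apply hσ]; rfl
  have hsum : Summable (fun x => ⟪ket x, Z (ket x)⟫_ℂ) := by
    have h1 : hsSq (CFC.sqrt σ ∘L W.adjoint) ≠ ∞ :=
      ((hsSq_comp_right _ _ (by rwa [LinearIsometryEquiv.norm_map])).trans_lt
        (by rw [hsSq_sqrt hσ hs]; exact ENNReal.ofReal_lt_top)).ne
    have h2 : hsSq (CFC.sqrt ρ) ≠ ∞ := by rw [hsSq_sqrt hρ hr]; exact ENNReal.ofReal_ne_top
    refine (summable_norm_inner h1 h2).of_norm.congr fun x => ?_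
    rw [hZW, ContinuousLinearMap.comp_apply, ContinuousLinearMap.comp_apply,
      ContinuousLinearMap.comp_apply, ← ContinuousLinearMap.adjoint_inner_left W,
      ← ContinuousLinearMap.adjoint_inner_left (CFC.sqrt σ), adjoint_sqrt]
  have : ((fidelity ρ σ : ℝ) : ℂ) = ∑' x, ⟪ket x, Z (ket x)⟫_ℂ := by
    rw [fidelity, trace, ← hZ]
    simp only [← norm_sqrt_apply_sq hZ0]
    rw [← Complex.ofReal_tsum, Complex.ofReal_re]
  rw [this]
  exact hsum.hasSum

/-- The hypothesis gives `T = √ρ C √σ` with a contraction `C`. By cyclicity `tr T = tr (C √σ √ρ) =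
tr (C V Z)`, where `√σ √ρ = V Z` with `Z = √(√ρ σ √ρ)` and `V` a contraction, and this is at most
`tr Z`. -/
theorem norm_trace_le_fidelity {ρ σ T : Hil X →L[ℂ] Hil X} (hρ : 0 ≤ ρ) (hσ : 0 ≤ σ) {r s : ℝ}
    (hr : HasSum (fun x => ⟪ket x, ρ (ket x)⟫_ℂ) r)
    (hs : HasSum (fun x => ⟪ket x, σ (ket x)⟫_ℂ) s)
    (h : ∀ x y, ‖⟪x, T y⟫_ℂ‖ ^ 2 ≤ ‖⟪x, ρ x⟫_ℂ‖ * ‖⟪y, σ y⟫_ℂ‖) :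
    ‖∑' x, ⟪ket x, T (ket x)⟫_ℂ‖ ≤ fidelity ρ σ := by
  have hF := hasSum_trace_fidelity hρ hσ hr hs
  set Z := CFC.sqrt (CFC.sqrt ρ * σ * CFC.sqrt ρ) with hZ
  obtain ⟨V, hV, hVZ, -⟩ := exists_factor Z (CFC.sqrt σ ∘L CFC.sqrt ρ) zero_le_one fun x => by
    rw [one_mul, hZ, norm_sqrt_sandwich_apply hσ]; rfl
  obtain ⟨C, hC, hT⟩ := exists_sandwich (CFC.sqrt ρ) (CFC.sqrt σ) T fun x y => by
    have := h x y
    rw [← norm_sqrt_apply_sq hρ, ← norm_sqrt_apply_sq hσ, Complex.norm_real, Complex.norm_real,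
      Real.norm_of_nonneg (by positivity), Real.norm_of_nonneg (by positivity), ← mul_pow] at this
    exact (pow_le_pow_iff_left₀ (norm_nonneg _) (by positivity) two_ne_zero).1 this
  have h1 : hsSq (C ∘L CFC.sqrt σ) ≠ ∞ :=
    ((hsSq_comp_left _ _ hC).trans_lt
      (by rw [hsSq_sqrt hσ hs]; exact ENNReal.ofReal_lt_top)).ne
  have h2 : hsSq (CFC.sqrt ρ) ≠ ∞ := by rw [hsSq_sqrt hρ hr]; exact ENNReal.ofReal_ne_top
  have hZ0 : 0 ≤ Z := CFC.sqrt_nonneg _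
  have h3 := norm_tsum_contraction_le hZ0 hF (C ∘L V) (ContinuousLinearMap.id ℂ _)
    ((ContinuousLinearMap.opNorm_comp_le _ _).trans (mul_le_one₀ hC (norm_nonneg _) hV))
    ContinuousLinearMap.norm_id_le
  refine le_of_eq_of_le ?_ h3
  have h4 : ∑' x, ⟪ket x, T (ket x)⟫_ℂ =
      ∑' x, ⟪CFC.sqrt ρ (ket x), (C ∘L CFC.sqrt σ) (ket x)⟫_ℂ := by
    refine tsum_congr fun x => ?_
    rw [hT, ContinuousLinearMap.comp_apply, ContinuousLinearMap.adjoint_inner_right]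
  rw [h4, tsum_inner_adjoint h2 h1, adjoint_sqrt]
  congr 1
  refine tsum_congr fun x => ?_
  rw [ContinuousLinearMap.adjoint_inner_left]
  congr 1
  exact congrArg C (congrArg (fun S : Hil X →L[ℂ] Hil X => S (ket x)) hVZ)

/-- Up to contractions `√ρ` is `A C†` and `√σ` is `D B†`, so `√(√ρ σ √ρ) = W D (B† A) C†`, whose
trace is at most that of the positive operator `B† A`. -/
theorem fidelity_le_of_factor {A B : Hil X →L[ℂ] Hil X} {r s t : ℝ}
    (hr : HasSum (fun x => ⟪ket x, (A ∘L A.adjoint) (ket x)⟫_ℂ) r)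
    (hs : HasSum (fun x => ⟪ket x, (B ∘L B.adjoint) (ket x)⟫_ℂ) s)
    (hP : 0 ≤ B.adjoint ∘L A)
    (ht : HasSum (fun x => ⟪ket x, (B.adjoint ∘L A) (ket x)⟫_ℂ) t) :
    fidelity (A ∘L A.adjoint) (B ∘L B.adjoint) ≤ t := by
  set ρ := A ∘L A.adjoint with hρA
  set σ := B ∘L B.adjoint with hσB
  have hρ : 0 ≤ ρ := (ContinuousLinearMap.nonneg_iff_isPositive _).2
    (ContinuousLinearMap.isPositive_self_comp_adjoint A)
  have hσ : 0 ≤ σ := (ContinuousLinearMap.nonneg_iff_isPositive _).2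
    (ContinuousLinearMap.isPositive_self_comp_adjoint B)
  have hF := hasSum_trace_fidelity hρ hσ hr hs
  set Z := CFC.sqrt (CFC.sqrt ρ * σ * CFC.sqrt ρ) with hZ
  obtain ⟨W, hW, hZW, -⟩ := exists_factor (CFC.sqrt σ ∘L CFC.sqrt ρ) Z zero_le_one fun x => by
    rw [one_mul, hZ, norm_sqrt_sandwich_apply hσ]; rfl
  obtain ⟨C, hC, hCA, -⟩ := exists_factor A.adjoint (CFC.sqrt ρ) zero_le_one fun x => by
    rw [one_mul, norm_sqrt_apply_of_eq hρA]
  obtain ⟨D, hD, hDB, -⟩ := exists_factor B.adjoint (CFC.sqrt σ) zero_le_one fun x => by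
    rw [one_mul, norm_sqrt_apply_of_eq hσB]
  have hCA' : CFC.sqrt ρ = A ∘L C.adjoint := by
    rw [← adjoint_sqrt, hCA, ContinuousLinearMap.adjoint_comp, ContinuousLinearMap.adjoint_adjoint]
  have h3 := norm_tsum_contraction_le hP ht (W ∘L D) C.adjoint
    ((ContinuousLinearMap.opNorm_comp_le _ _).trans (mul_le_one₀ hW (norm_nonneg _) hD))
    (by rwa [LinearIsometryEquiv.norm_map])
  have h4 : ∑' x, ⟪ket x, (W ∘L D) ((B.adjoint ∘L A) (C.adjoint (ket x)))⟫_ℂ =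
      (fidelity ρ σ : ℝ) := by
    rw [← hF.tsum_eq]
    refine tsum_congr fun x => ?_
    rw [hZW, hDB]
    congr 1
    exact congrArg (fun y => W (D (B.adjoint y)))
      (congrArg (fun S : Hil X →L[ℂ] Hil X => S (ket x)) hCA').symm
  rw [h4, Complex.norm_real] at h3
  exact (le_abs_self _).trans h3

end HilbertSchmidt
/-! ### Tensor products -/

/-- Any finite set of multi-indices lies in a box, where the sum of norms factorizes; this gives
absolute summability. The value is then the limit along the cubes `{0, …, N-1}^ι`. -/
theorem hasSum_prod_pi {𝕜 ι : Type} [RCLike 𝕜] [Fintype ι] {f : ι → ℕ → 𝕜} {a : ι → 𝕜}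
    (h : ∀ i, HasSum (f i) (a i)) : HasSum (fun n : ι → ℕ => ∏ i, f i (n i)) (∏ i, a i) := by
  classical
  have hs : Summable (fun n : ι → ℕ => ∏ i, f i (n i)) := by
    refine Summable.of_norm (summable_of_sum_le (c := ∏ i, ∑' k, ‖f i k‖)
      (fun _ => norm_nonneg _) fun u => ?_)
    calc ∑ n ∈ u, ‖∏ i, f i (n i)‖
        ≤ ∑ n ∈ Fintype.piFinset (fun i => u.image (fun n => n i)), ‖∏ i, f i (n i)‖ := by
          refine Finset.sum_le_sum_of_subset_of_nonneg ?_ fun _ _ _ => norm_nonneg _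
          intro n hn
          exact Fintype.mem_piFinset.2 fun i => Finset.mem_image_of_mem _ hn
      _ = ∏ i, ∑ k ∈ u.image (fun n => n i), ‖f i k‖ := by
          rw [Finset.prod_univ_sum]
          simp [norm_prod]
      _ ≤ ∏ i, ∑' k, ‖f i k‖ :=
          Finset.prod_le_prod (fun _ _ => by positivity) fun i _ =>
            (h i).summable.norm.sum_le_tsum _ fun _ _ => norm_nonneg _
  have hmono : Monotone (fun N : ℕ => Fintype.piFinset fun _ : ι => Finset.range N) := by
    intro N N' hN n hn
    rw [Fintype.mem_piFinset] at hn ⊢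
    exact fun i => Finset.range_mono hN (hn i)
  have ht := Filter.tendsto_atTop_finset_of_monotone hmono fun n =>
    ⟨∑ i, n i + 1, Fintype.mem_piFinset.2 fun i => Finset.mem_range.2
      (Nat.lt_succ_of_le (Finset.single_le_sum (fun _ _ => Nat.zero_le _) (Finset.mem_univ i)))⟩
  have h1 := hs.hasSum.comp ht
  have h2 : Filter.Tendsto (fun N => ∏ i, ∑ k ∈ Finset.range N, f i k) Filter.atTop
      (nhds (∏ i, a i)) := tendsto_finsetProd _ fun i _ => (h i).tendsto_sum_nat
  have h3 := tendsto_nhds_unique h1 (h2.congr fun N => by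
    rw [Finset.prod_univ_sum]; rfl)
  rw [← h3]
  exact hs.hasSum

theorem Hil.smul_apply {X : Type} (c : ℂ) (f : Hil X) (x : X) : (c • f) x = c * f x := rfl

section

variable {X : Type} [DecidableEq X]

theorem clm_ext_ket {T S : Hil X →L[ℂ] Hil X}
    (h : ∀ x y, ⟪ket x, T (ket y)⟫_ℂ = ⟪ket x, S (ket y)⟫_ℂ) : T = S := by
  have h1 : ∀ y, T.adjoint (ket y) = S.adjoint (ket y) := by
    refine fun y => Hil.ext fun x => ?_
    rw [← inner_ket, ← inner_ket, ContinuousLinearMap.adjoint_inner_right,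
      ContinuousLinearMap.adjoint_inner_right, ← inner_conj_symm, ← inner_conj_symm (S _), h]
  ext f
  refine Hil.ext fun x => ?_
  rw [← inner_ket, ← inner_ket, ← ContinuousLinearMap.adjoint_inner_left, h1,
    ContinuousLinearMap.adjoint_inner_left]

end

section

variable {ι : Type} [Fintype ι]

theorem inner_prodVec (ψ φ : ι → Hil ℕ) :
    ⟪prodVec ψ, prodVec φ⟫_ℂ = ∏ i, ⟪ψ i, φ i⟫_ℂ := by
  refine (hasSum_inner _ _).unique
    ((hasSum_prod_pi fun i => hasSum_inner (ψ i) (φ i)).congr_fun fun n => ?_)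
  rw [prodVec_apply, prodVec_apply, star_prod, Finset.prod_mul_distrib]

theorem norm_prodVec (ψ : ι → Hil ℕ) : ‖prodVec ψ‖ = ∏ i, ‖ψ i‖ := by
  have h := norm_inner_self_eq_sq (prodVec ψ)
  rw [inner_prodVec, norm_prod] at h
  simp only [norm_inner_self_eq_sq, Finset.prod_pow] at h
  exact ((pow_left_inj₀ (by positivity) (norm_nonneg _) two_ne_zero).1 h).symm

/-- The squared distance of two product vectors expands into products of single-mode norms and inner
products, which are visibly continuous. -/
theorem continuous_prodVec {Ω : Type} [TopologicalSpace Ω] {ψ : Ω → ι → Hil ℕ}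
    (h : ∀ i, Continuous fun ω => ψ ω i) : Continuous fun ω => prodVec (ψ ω) := by
  rw [continuous_iff_continuousAt]
  intro ω₀
  rw [ContinuousAt, tendsto_iff_norm_sub_tendsto_zero]
  have key : ∀ ω, ‖prodVec (ψ ω) - prodVec (ψ ω₀)‖ = Real.sqrt (∏ i, ‖ψ ω i‖ ^ 2 -
      2 * (∏ i, ⟪ψ ω i, ψ ω₀ i⟫_ℂ).re + ∏ i, ‖ψ ω₀ i‖ ^ 2) := by
    intro ω
    rw [← inner_prodVec, Finset.prod_pow, Finset.prod_pow, ← norm_prodVec, ← norm_prodVec]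
    rw [← Real.sqrt_sq (norm_nonneg (_ - _)), norm_sub_sq (𝕜 := ℂ)]
    rfl
  simp only [key]
  have hc : Continuous fun ω => Real.sqrt (∏ i, ‖ψ ω i‖ ^ 2 -
      2 * (∏ i, ⟪ψ ω i, ψ ω₀ i⟫_ℂ).re + ∏ i, ‖ψ ω₀ i‖ ^ 2) := by
    have h1 : Continuous fun ω => ∏ i, ⟪ψ ω i, ψ ω₀ i⟫_ℂ :=
      continuous_finsetProd _ fun i _ => (h i).inner continuous_const
    have h2 : Continuous fun ω => ∏ i, ‖ψ ω i‖ ^ 2 :=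
      continuous_finsetProd _ fun i _ => (h i).norm.pow 2
    exact ((h2.sub (continuous_const.mul (Complex.continuous_re.comp h1))).add
      continuous_const).sqrt
  have h0 := hc.tendsto ω₀
  simp only [← key, sub_self, norm_zero] at h0
  simpa only [key] using h0

theorem ket_pi (n : ι → ℕ) : ket n = prodVec fun i => ket (n i) := by
  refine Hil.ext fun x => ?_
  rw [ket_apply, prodVec_apply]
  simp only [ket_apply]
  split_ifs with h
  · subst h; simp
  · obtain ⟨i, hi⟩ := Function.ne_iff.1 h
    exact (Finset.prod_eq_zero (Finset.mem_univ i) (if_neg hi)).symm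

variable [DecidableEq ι]

theorem inner_ket_tensorOp (A : ι → Hil ℕ →L[ℂ] Hil ℕ) (m n : ι → ℕ) :
    ⟪ket m, tensorOp A (ket n)⟫_ℂ = ∏ i, ⟪ket (m i), A i (ket (n i))⟫_ℂ := by
  rw [ket_pi, ket_pi, tensorOp_prodVec, inner_prodVec]

theorem tensorOp_comp (A B : ι → Hil ℕ →L[ℂ] Hil ℕ) :
    tensorOp A ∘L tensorOp B = tensorOp fun i => A i ∘L B i := by
  refine clm_ext_ket fun x y => ?_
  rw [ket_pi, ket_pi, ContinuousLinearMap.comp_apply, tensorOp_prodVec, tensorOp_prodVec,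
    tensorOp_prodVec]
  rfl

theorem adjoint_tensorOp (A : ι → Hil ℕ →L[ℂ] Hil ℕ) :
    (tensorOp A).adjoint = tensorOp fun i => (A i).adjoint := by
  refine clm_ext_ket fun x y => ?_
  rw [ContinuousLinearMap.adjoint_inner_right, ket_pi, ket_pi, tensorOp_prodVec, tensorOp_prodVec,
    inner_prodVec, inner_prodVec]
  simp only [ContinuousLinearMap.adjoint_inner_right]

theorem tensorOp_smul (c : ι → ℂ) (A : ι → Hil ℕ →L[ℂ] Hil ℕ) :
    tensorOp (fun i => c i • A i) = (∏ i, c i) • tensorOp A := by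
  refine clm_ext_ket fun x y => ?_
  rw [inner_ket_tensorOp, smul_apply, inner_smul_right, inner_ket_tensorOp]
  simp only [smul_apply, inner_smul_right, Finset.prod_mul_distrib]

end

/-! ### Coherent vectors and displacements -/

theorem clm_ext_coh {T S : Hil ℕ →L[ℂ] Hil ℕ} (h : ∀ α, T (coh α) = S (coh α)) : T = S := by
  have h0 : ∀ x, (T - S).adjoint x = 0 := fun x => coh_total _ fun α => by
    rw [ContinuousLinearMap.adjoint_inner_left, sub_apply, h, sub_self, inner_zero_right]
  ext x
  rw [← sub_eq_zero, ← inner_self_eq_zero (𝕜 := ℂ), ← sub_apply,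
    ← ContinuousLinearMap.adjoint_inner_left, h0, inner_zero_left]

theorem clm_ext_inner_coh {T S : Hil ℕ →L[ℂ] Hil ℕ}
    (h : ∀ α β, ⟪coh α, T (coh β)⟫_ℂ = ⟪coh α, S (coh β)⟫_ℂ) : T = S := by
  refine clm_ext_coh fun β => ?_
  rw [← sub_eq_zero]
  refine coh_total _ fun α => ?_
  rw [← inner_conj_symm, inner_sub_right, h, sub_self, map_zero]

theorem norm_coh (α : ℂ) : ‖coh α‖ = 1 := by
  have h := norm_inner_self_eq_sq (coh α)
  rw [inner_coh] at h
  have h2 : (-(‖α‖ ^ 2 / 2 : ℝ) - (‖α‖ ^ 2 / 2 : ℝ) + star α * α : ℂ) = 0 := by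
    rw [← starRingEnd_apply, Complex.conj_mul']; push_cast; ring
  rw [h2, Complex.exp_zero, norm_one] at h
  exact ((pow_eq_one_iff_of_nonneg (norm_nonneg _) two_ne_zero).1 h.symm)

theorem continuous_coh : Continuous coh := by
  rw [continuous_iff_continuousAt]
  intro β
  rw [ContinuousAt, tendsto_iff_norm_sub_tendsto_zero]
  have key : ∀ α, ‖coh α - coh β‖ = Real.sqrt (1 - 2 * (Complex.exp
      (-(‖α‖ ^ 2 / 2 : ℝ) - (‖β‖ ^ 2 / 2 : ℝ) + star α * β)).re + 1) := by
    intro α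
    rw [← Real.sqrt_sq (norm_nonneg (_ - _)), norm_sub_sq (𝕜 := ℂ), inner_coh, norm_coh, norm_coh,
      one_pow]
    rfl
  have hc : Continuous fun α : ℂ => Real.sqrt (1 - 2 * (Complex.exp
      (-(‖α‖ ^ 2 / 2 : ℝ) - (‖β‖ ^ 2 / 2 : ℝ) + star α * β)).re + 1) := by
    fun_prop
  have h0 := hc.tendsto β
  simp only [← key, sub_self, norm_zero] at h0
  simpa only [key] using h0

theorem adjoint_displacement (ξ : ℂ) : (displacement ξ).adjoint = displacement (-ξ) := by
  refine clm_ext_inner_coh fun α β => ?_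
  rw [ContinuousLinearMap.adjoint_inner_right, displacement_coh, displacement_coh,
    inner_smul_left, inner_smul_right, inner_coh, inner_coh, ← Complex.exp_conj, ← Complex.exp_add,
    ← Complex.exp_add]
  congr 1
  simp only [Complex.ofReal_div, Complex.ofReal_pow, ← Complex.conj_mul', map_div₀, map_sub,
    map_mul, map_add, starRingEnd_apply, star_star, star_add, star_neg, star_ofNat,
    Complex.ofReal_ofNat]
  ring

/-- For real multiples of one `z` the Weyl phase vanishes. All displacements composed below are of
this collinear form, so phases never enter. -/
theorem displacement_comp_real (p q : ℝ) (z : ℂ) :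
    displacement (p * z) ∘L displacement (q * z) = displacement ((p + q : ℝ) * z) := by
  refine clm_ext_coh fun α => ?_
  rw [ContinuousLinearMap.comp_apply, displacement_coh, map_smul, displacement_coh,
    displacement_coh, smul_smul, ← Complex.exp_add]
  congr 2
  · simp only [← starRingEnd_apply, map_add, map_mul, Complex.conj_ofReal]
    push_cast
    ring
  · push_cast
    ring

theorem displacement_zero : displacement 0 = ContinuousLinearMap.id ℂ _ :=
  clm_ext_coh fun α => by simp [displacement_coh]

theorem displacement_neg_comp (ξ : ℂ) :
    displacement (-ξ) ∘L displacement ξ = ContinuousLinearMap.id ℂ _ := by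
  have := displacement_comp_real (-1) 1 ξ
  simpa [displacement_zero] using this

theorem norm_displacement_apply (ξ : ℂ) (x : Hil ℕ) : ‖displacement ξ x‖ = ‖x‖ := by
  have h := ContinuousLinearMap.adjoint_inner_left (displacement ξ) x (displacement ξ x)
  rw [adjoint_displacement, ← ContinuousLinearMap.comp_apply, displacement_neg_comp,
    ContinuousLinearMap.id_apply] at h
  have h2 := congrArg norm h
  rw [norm_inner_self_eq_sq, norm_inner_self_eq_sq] at h2
  exact ((pow_left_inj₀ (norm_nonneg _) (norm_nonneg _) two_ne_zero).1 h2).symm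

/-- Explicit on combinations of coherent vectors; these are dense and every `displacement ξ` is
isometric, so the approximation is uniform in `ξ`. -/
theorem continuous_displacement_apply (x : Hil ℕ) : Continuous fun ξ => displacement ξ x := by
  have h0 : ∀ y : ℂ →₀ ℂ, Continuous fun ξ =>
      displacement ξ (Finsupp.linearCombination ℂ coh y) := by
    intro y
    simp only [Finsupp.linearCombination_apply, Finsupp.sum, map_sum, map_smul, displacement_coh]
    have h1 : ∀ α, Continuous fun ξ : ℂ =>
        Complex.exp ((ξ * star α - star ξ * α) / 2) • coh (α + ξ) := fun α =>
      Continuous.smul (f := fun ξ : ℂ => Complex.exp ((ξ * star α - star ξ * α) / 2))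
        (by fun_prop) (continuous_coh.comp (continuous_const.add continuous_id))
    exact continuous_finsetSum _ fun α _ => (h1 α).const_smul (y α)
  refine continuous_of_uniform_approx_of_continuous fun u hu => ?_
  obtain ⟨ε, hε, hεu⟩ := Metric.mem_uniformity_dist.1 hu
  obtain ⟨_, ⟨y, rfl⟩, hy⟩ := Metric.mem_closure_iff.1 (denseRange_cohComb x) ε hε
  refine ⟨_, h0 y, fun ξ => hεu ?_⟩
  rwa [dist_eq_norm, ← map_sub, norm_displacement_apply, ← dist_eq_norm]

theorem continuous_displacement {Ω : Type} [TopologicalSpace Ω] {f : Ω → ℂ} {g : Ω → Hil ℕ}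
    (hf : Continuous f) (hg : Continuous g) : Continuous fun ω => displacement (f ω) (g ω) := by
  rw [continuous_iff_continuousAt]
  intro ω₀
  rw [ContinuousAt, tendsto_iff_norm_sub_tendsto_zero]
  have h1 := tendsto_iff_norm_sub_tendsto_zero.1
    (((continuous_displacement_apply (g ω₀)).comp hf).tendsto ω₀)
  have h2 := tendsto_iff_norm_sub_tendsto_zero.1 (hg.tendsto ω₀)
  refine squeeze_zero (fun _ => norm_nonneg _) (fun ω => ?_) (by simpa using h2.add h1)
  have : displacement (f ω) (g ω) - displacement (f ω₀) (g ω₀) =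
      displacement (f ω) (g ω - g ω₀) +
        (displacement (f ω) (g ω₀) - displacement (f ω₀) (g ω₀)) := by
    rw [map_sub]; abel
  rw [this]
  refine (norm_add_le _ _).trans ?_
  rw [norm_displacement_apply]

/-! ### Powers of the number operator -/

theorem sum_numPow_le (s : unitInterval) (f : Hil ℕ) (u : Finset ℕ) :
    ∑ n ∈ u, ‖((s : ℝ) ^ n : ℂ) * f n‖ ^ 2 ≤ (1 * ‖f‖) ^ 2 := by
  rw [one_mul]
  refine (Finset.sum_le_sum fun n _ => ?_).trans (sum_norm_sq_le f u)
  gcongr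
  rw [norm_mul, norm_pow, Complex.norm_real, Real.norm_of_nonneg s.2.1]
  exact mul_le_of_le_one_left (norm_nonneg _) (pow_le_one₀ s.2.1 s.2.2)

/-- The operator `s^{a†a}`, diagonal in the number basis. -/
noncomputable def numPow (s : unitInterval) : Hil ℕ →L[ℂ] Hil ℕ :=
  LinearMap.mkContinuous
    { toFun := fun f => ⟨fun n => ((s : ℝ) ^ n : ℂ) * f n,
        memℓp_two_of_bound _ _ (sum_numPow_le s f)⟩
      map_add' := fun f g => Hil.ext fun n => mul_add _ (f n) (g n)
      map_smul' := fun c f => Hil.ext fun n => mul_left_comm _ c (f n) } 1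
    fun f => norm_le_of_sum_le _ (by positivity) fun u => sum_numPow_le s f u

theorem numPow_apply (s : unitInterval) (f : Hil ℕ) (n : ℕ) :
    numPow s f n = ((s : ℝ) ^ n : ℂ) * f n := rfl

theorem numPow_ket (s : unitInterval) (n : ℕ) : numPow s (ket n) = ((s : ℝ) ^ n : ℂ) • ket n := by
  refine Hil.ext fun k => ?_
  rw [numPow_apply, Hil.smul_apply, ket_apply]
  split_ifs with h
  · rw [h]
  · simp

theorem numPow_coh (s : unitInterval) (α : ℂ) : numPow s (coh α) =
    Complex.exp (-((1 - (s : ℝ) ^ 2) * (star α * α)) / 2) • coh ((s : ℝ) * α) := by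
  refine Hil.ext fun n => ?_
  rw [numPow_apply, Hil.smul_apply, coh_apply, coh_apply, mul_pow, mul_div_assoc]
  have : (Real.exp (-‖α‖ ^ 2 / 2) : ℂ) = Complex.exp (-((1 - (s : ℝ) ^ 2) * (star α * α)) / 2) *
      (Real.exp (-‖((s : ℝ) : ℂ) * α‖ ^ 2 / 2) : ℂ) := by
    rw [Complex.ofReal_exp, Complex.ofReal_exp, ← Complex.exp_add, ← starRingEnd_apply,
      Complex.conj_mul', norm_mul, Complex.norm_real, Real.norm_of_nonneg s.2.1]
    congr 1
    push_cast
    ring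
  rw [this]
  ring

theorem adjoint_numPow (s : unitInterval) : (numPow s).adjoint = numPow s := by
  refine clm_ext_ket fun m n => ?_
  rw [ContinuousLinearMap.adjoint_inner_right, numPow_ket, numPow_ket, inner_smul_left,
    inner_smul_right, inner_ket, ket_apply]
  split_ifs with h
  · rw [h, map_pow, Complex.conj_ofReal]
  · simp

theorem numPow_comp (s t : unitInterval) : numPow s ∘L numPow t = numPow (s * t) := by
  ext f
  refine Hil.ext fun n => ?_
  rw [ContinuousLinearMap.comp_apply, numPow_apply, numPow_apply, numPow_apply]
  push_cast
  ring

/-- Moving the damping operators through a displacement. On a coherent vector `ha` equates the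
amplitudes, and `hb` is the same condition for the adjoint; together they also make the exponents
agree. -/
theorem numPow_displacement_numPow (s t : unitInterval) (ξ : ℂ) {a b : ℝ}
    (ha : a + s * t * b = s) (hb : s * t * a + b = t) :
    numPow s ∘L displacement ξ ∘L numPow t =
      Complex.exp (-((1 - a ^ 2 - b ^ 2 - 2 * a * b * (s * t : ℝ)) * (star ξ * ξ)) / 2) •
        (displacement (a * ξ) ∘L numPow (s * t) ∘L displacement (b * ξ)) := by
  have ha' : (a + s * t * b : ℂ) = s := by exact_mod_cast ha
  have hb' : (s * t * a + b : ℂ) = t := by exact_mod_cast hb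
  refine clm_ext_coh fun α => ?_
  simp only [ContinuousLinearMap.comp_apply, smul_apply, numPow_coh, displacement_coh,
    map_smul, smul_smul, ← Complex.exp_add]
  congr 2
  · simp only [← starRingEnd_apply, map_add, map_mul, Complex.conj_ofReal, Set.Icc.coe_mul,
      Complex.ofReal_mul]
    linear_combination (-(s * t / 2) * ξ * (starRingEnd ℂ) α - (s * t / 2) * (starRingEnd ℂ) ξ * α
      - (a + s * t * b + s) / 2 * ξ * (starRingEnd ℂ) ξ) * ha' + (starRingEnd ℂ) ξ * α * hb'
  · simp only [Set.Icc.coe_mul, Complex.ofReal_mul]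
    linear_combination -ξ * ha'

/-! ### Hilbert–Schmidt square roots of displaced thermal states -/

theorem hasSum_norm_adjoint_sq {X : Type} [DecidableEq X] {T : Hil X →L[ℂ] Hil X} {c : ℝ}
    (h : HasSum (fun x => ‖T (ket x)‖ ^ 2) c) : HasSum (fun x => ‖T.adjoint (ket x)‖ ^ 2) c := by
  have hT := hsSq_eq_of_hasSum h
  have hT' : hsSq T.adjoint ≠ ∞ := by rw [hsSq_adjoint, hT]; exact ENNReal.ofReal_ne_top
  have h1 := (summable_of_hsSq hT').hasSum
  rw [tsum_of_hsSq, hsSq_adjoint, hT,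
    ENNReal.toReal_ofReal (h.nonneg fun x => by positivity)] at h1
  exact h1

theorem hasSum_trace_comp_adjoint {X : Type} [DecidableEq X] {T : Hil X →L[ℂ] Hil X} {c : ℝ}
    (h : HasSum (fun x => ‖T (ket x)‖ ^ 2) c) :
    HasSum (fun x => ⟪ket x, (T ∘L T.adjoint) (ket x)⟫_ℂ) c := by
  have h1 : HasSum (fun x => ((‖T.adjoint (ket x)‖ ^ 2 : ℝ) : ℂ)) (c : ℂ) := by
    exact_mod_cast hasSum_norm_adjoint_sq h
  refine h1.congr_fun fun x => ?_
  rw [ContinuousLinearMap.comp_apply, ← ContinuousLinearMap.adjoint_inner_left,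
    inner_self_eq_norm_sq_to_K]
  push_cast
  rfl

/-- The square root `√(E/(1+E))` of the ratio of successive occupation probabilities of the thermal
state with `E` mean photons. -/
noncomputable def thermalRatio (E : ℝ) (hE : 0 ≤ E) : unitInterval :=
  ⟨Real.sqrt (E / (1 + E)), Real.sqrt_nonneg _,
    Real.sqrt_le_one.2 ((div_le_one (by linarith)).2 (by linarith))⟩

theorem thermalRatio_sq (E : ℝ) (hE : 0 ≤ E) : (thermalRatio E hE : ℝ) ^ 2 = E / (1 + E) :=
  Real.sq_sqrt (by positivity)

/-- `A` with `A A†` the thermal state with `E` mean photons displaced by `γ`. -/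
noncomputable def thermalFactor (E : ℝ) (hE : 0 ≤ E) (γ : ℂ) : Hil ℕ →L[ℂ] Hil ℕ :=
  (Real.sqrt (1 / (1 + E)) : ℂ) • (displacement γ ∘L numPow (thermalRatio E hE))

theorem thermalRatio_lt_one (E : ℝ) (hE : 0 ≤ E) : (thermalRatio E hE : ℝ) < 1 := by
  have h := thermalRatio_sq E hE
  have h2 : E / (1 + E) < 1 := (div_lt_one (by linarith)).2 (by linarith)
  nlinarith [(thermalRatio E hE).2.1, (thermalRatio E hE).2.2]

theorem hasSum_norm_numPow_sq (ζ : ℂ) {s : unitInterval} (hs : (s : ℝ) < 1) :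
    HasSum (fun k => ‖displacement ζ (numPow s (ket k))‖ ^ 2) (1 - (s : ℝ) ^ 2)⁻¹ := by
  have h2 : (s : ℝ) ^ 2 < 1 := by nlinarith [s.2.1]
  refine (hasSum_geometric_of_lt_one (by positivity) h2).congr_fun fun k => ?_
  rw [norm_displacement_apply, numPow_ket, norm_smul, norm_ket, norm_pow, Complex.norm_real,
    Real.norm_of_nonneg s.2.1, mul_one, ← pow_mul, ← pow_mul, mul_comm]

theorem hasSum_norm_thermalFactor_sq (E : ℝ) (hE : 0 ≤ E) (γ : ℂ) :
    HasSum (fun k => ‖thermalFactor E hE γ (ket k)‖ ^ 2) 1 := by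
  have h := (hasSum_norm_numPow_sq γ (thermalRatio_lt_one E hE)).mul_left (1 / (1 + E))
  have h1 : 1 / (1 + E) * (1 - (thermalRatio E hE : ℝ) ^ 2)⁻¹ = 1 := by
    rw [thermalRatio_sq]
    have : 1 + E ≠ 0 := by positivity
    field_simp
    simp
  rw [h1] at h
  refine h.congr_fun fun k => ?_
  rw [thermalFactor, smul_apply, norm_smul, mul_pow, Complex.norm_real,
    Real.norm_of_nonneg (Real.sqrt_nonneg _), Real.sq_sqrt (by positivity)]
  rfl

/-- The fidelity between displaced thermal states with displacements `γ` and `δ`, `r = |γ - δ|²`. -/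
noncomputable def thermalFidelity (E₁ E₂ r : ℝ) : ℝ :=
  Real.sqrt (noiseConst E₂ E₁) * Real.exp (-(r / (2 * (1 + E₁ + E₂))))

/-- The displacement by which a factor of the second state has to be rotated to be aligned with the
first. -/
noncomputable def alignShift (s t : ℝ) : ℝ := (s + t) / (1 + s * t)

/-- With `p² = 1 + u²` and `q² = 1 + v²` one has `1 + (v p - u q)² = (p q - u v)²`. Thus `√c` is the
product of the two thermal normalizations divided by `1 - s t`, the inverse of the trace of `(s
t)^{a†a}`. -/
theorem sqrt_noiseConst (E₁ E₂ : ℝ) (h₁ : 0 ≤ E₁) (h₂ : 0 ≤ E₂) :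
    Real.sqrt (noiseConst E₂ E₁) *
      (1 - (thermalRatio E₁ h₁ : ℝ) * (thermalRatio E₂ h₂ : ℝ)) =
      Real.sqrt (1 / (1 + E₁)) * Real.sqrt (1 / (1 + E₂)) := by
  change _ * (1 - Real.sqrt (E₁ / (1 + E₁)) * Real.sqrt (E₂ / (1 + E₂))) = _
  rw [noiseConst, Real.sqrt_mul h₂, Real.sqrt_mul h₁, Real.sqrt_div h₁, Real.sqrt_div h₂,
    Real.sqrt_div zero_le_one, Real.sqrt_div zero_le_one, Real.sqrt_one]
  have hp : 0 < Real.sqrt (1 + E₁) := by positivity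
  have hq : 0 < Real.sqrt (1 + E₂) := by positivity
  have hp2 : Real.sqrt (1 + E₁) ^ 2 = 1 + Real.sqrt E₁ ^ 2 := by
    rw [Real.sq_sqrt (by positivity), Real.sq_sqrt h₁]
  have hq2 : Real.sqrt (1 + E₂) ^ 2 = 1 + Real.sqrt E₂ ^ 2 := by
    rw [Real.sq_sqrt (by positivity), Real.sq_sqrt h₂]
  have hu : Real.sqrt E₁ < Real.sqrt (1 + E₁) := Real.sqrt_lt_sqrt h₁ (by linarith)
  have hv : Real.sqrt E₂ < Real.sqrt (1 + E₂) := Real.sqrt_lt_sqrt h₂ (by linarith)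
  have hpos : 0 < Real.sqrt (1 + E₁) * Real.sqrt (1 + E₂) - Real.sqrt E₁ * Real.sqrt E₂ := by
    nlinarith [Real.sqrt_nonneg E₁, Real.sqrt_nonneg E₂]
  generalize Real.sqrt (1 + E₁) = p at *
  generalize Real.sqrt (1 + E₂) = q at *
  generalize Real.sqrt E₁ = u at *
  generalize Real.sqrt E₂ = v at *
  have : 1 + (v * p - u * q) ^ 2 = (p * q - u * v) ^ 2 := by
    linear_combination (v ^ 2 - q ^ 2) * hp2 + (u ^ 2 - 1 - u ^ 2) * hq2
  rw [this, Real.sqrt_inv, Real.sqrt_sq hpos.le]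
  field_simp

/-- Multiplying the second factor on the right by a unitary does not change its state. A
displacement suffices: writing `t^{a†a} D((g-d)z) s^{a†a}` as a multiple of `D(a(g-d)z) (ts)^{a†a}
D(b(g-d)z)`, the extra `D(-(a+b)(g-d)z)` on the left turns it into a displaced copy of the positive
operator `(ts)^{a†a}`. -/
theorem thermalFactor_align (E₁ E₂ : ℝ) (h₁ : 0 ≤ E₁) (h₂ : 0 ≤ E₂) (g d : ℝ) (z : ℂ) :
    ∃ Q : Hil ℕ →L[ℂ] Hil ℕ, HasSum (fun k => ‖Q (ket k)‖ ^ 2) 1 ∧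
      (thermalFactor E₂ h₂ (d * z) ∘L displacement
        ((alignShift (thermalRatio E₁ h₁) (thermalRatio E₂ h₂) * (g - d) : ℝ) * z)).adjoint ∘L
        thermalFactor E₁ h₁ (g * z) =
      (thermalFidelity E₁ E₂ ((g - d) ^ 2 * ‖z‖ ^ 2) : ℂ) • (Q ∘L Q.adjoint) := by
  have hc := sqrt_noiseConst E₁ E₂ h₁ h₂
  have hs2 := thermalRatio_sq E₁ h₁
  have ht2 := thermalRatio_sq E₂ h₂
  have hs1 := thermalRatio_lt_one E₁ h₁
  have ht1 := thermalRatio_lt_one E₂ h₂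
  rw [thermalFactor, thermalFactor]
  set s := thermalRatio E₁ h₁
  set t := thermalRatio E₂ h₂
  have hs0 := s.2.1
  have ht0 := t.2.1
  have hw : (t : ℝ) * s < 1 := by nlinarith
  have hw0 : 0 ≤ (t : ℝ) * s := by positivity
  have hw2 : 1 - ((t : ℝ) * s) ^ 2 ≠ 0 := by nlinarith
  -- `a` and `b` solve the linear system `ha`, `hb`, of determinant `1 - (ts)²`.
  set a : ℝ := (t - t * s * s) / (1 - (t * s) ^ 2) with hadef
  set b : ℝ := (s - t * s * t) / (1 - (t * s) ^ 2) with hbdef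
  have han : a * (1 - (t * s) ^ 2) = t - t * s * s := div_mul_cancel₀ _ hw2
  have hbn : b * (1 - (t * s) ^ 2) = s - t * s * t := div_mul_cancel₀ _ hw2
  have ha : a + t * s * b = t := by
    refine mul_right_cancel₀ hw2 ?_
    linear_combination han + t * s * hbn
  have hb : t * s * a + b = s := by
    refine mul_right_cancel₀ hw2 ?_
    linear_combination t * s * han + hbn
  have hab : alignShift s t = a + b := by
    rw [alignShift, hadef, hbdef, ← add_div, div_eq_div_iff (by positivity) hw2]
    ring
  have hκ : 1 - a ^ 2 - b ^ 2 - 2 * a * b * (t * s : ℝ) = 1 / (1 + E₁ + E₂) := by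
    have h3 : 1 - a ^ 2 - b ^ 2 - 2 * a * b * (t * s : ℝ) =
        (1 - (s : ℝ) ^ 2) * (1 - (t : ℝ) ^ 2) / (1 - (s : ℝ) ^ 2 * (t : ℝ) ^ 2) := by
      have hw2' : 1 - (s : ℝ) ^ 2 * (t : ℝ) ^ 2 ≠ 0 := by
        rw [← mul_pow, mul_comm]; exact hw2
      rw [eq_div_iff hw2']
      linear_combination -((1 - (t * s) ^ 2) * a : ℝ) * ha - ((1 - (t * s) ^ 2) * b : ℝ) * hb
        - (t : ℝ) * han - (s : ℝ) * hbn
    rw [h3, hs2, ht2]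
    have : 1 + E₁ ≠ 0 := by positivity
    have : 1 + E₂ ≠ 0 := by positivity
    have : 1 + E₁ + E₂ ≠ 0 := by positivity
    have h4 : 1 - E₁ / (1 + E₁) * (E₂ / (1 + E₂)) = (1 + E₁ + E₂) / ((1 + E₁) * (1 + E₂)) := by
      field_simp
      ring
    rw [h4]
    field_simp
    ring
  -- `r^{a†a}` is the square root of `(ts)^{a†a}`; the factor `√(1 - ts)` normalizes its
  -- Hilbert–Schmidt norm.
  let r : unitInterval := ⟨Real.sqrt (t * s), Real.sqrt_nonneg _, Real.sqrt_le_one.2 hw.le⟩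
  have hr : r * r = t * s := Subtype.ext (Real.mul_self_sqrt hw0)
  have hr1 : (r : ℝ) < 1 := by
    have : (r : ℝ) * r = t * s := Real.mul_self_sqrt hw0
    nlinarith [r.2.1]
  refine ⟨(Real.sqrt (1 - t * s) : ℂ) • (displacement ((-(b * (g - d)) : ℝ) * z) ∘L numPow r),
    ?_, ?_⟩
  · have h := (hasSum_norm_numPow_sq ((-(b * (g - d)) : ℝ) * z) hr1).mul_left (1 - (t : ℝ) * s)
    have h5 : (r : ℝ) ^ 2 = t * s := Real.sq_sqrt hw0
    rw [h5, mul_inv_cancel₀ (by linarith)] at h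
    refine h.congr_fun fun k => ?_
    rw [smul_apply, norm_smul, mul_pow, Complex.norm_real,
      Real.norm_of_nonneg (Real.sqrt_nonneg _), Real.sq_sqrt (by linarith)]
    rfl
  · have key := numPow_displacement_numPow t s ((g - d : ℝ) * z) ha hb
    have hexp : Complex.exp (-((1 - (a : ℂ) ^ 2 - (b : ℂ) ^ 2 - 2 * a * b * (t * s : ℝ)) *
        (star ((g - d : ℝ) * z) * ((g - d : ℝ) * z))) / 2) =
        (Real.exp (-((g - d) ^ 2 * ‖z‖ ^ 2 / (2 * (1 + E₁ + E₂)))) : ℂ) := by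
      rw [← starRingEnd_apply, Complex.conj_mul', norm_mul, Complex.norm_real, Real.norm_eq_abs]
      have h6 : -((g - d) ^ 2 * ‖z‖ ^ 2 / (2 * (1 + E₁ + E₂))) =
          -((1 - a ^ 2 - b ^ 2 - 2 * a * b * (t * s : ℝ)) * (|g - d| ^ 2 * ‖z‖ ^ 2)) / 2 := by
        rw [hκ, sq_abs]
        field_simp
      rw [h6]
      push_cast
      congr 1
      ring
    rw [hexp] at key
    have hD : ∀ (p q : ℝ) (y : Hil ℕ), displacement (p * z) (displacement (q * z) y) =
        displacement ((p + q : ℝ) * z) y := fun p q y => by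
      rw [← displacement_comp_real]; rfl
    have hneg : ∀ p : ℝ, -((p : ℂ) * z) = ((-p : ℝ) : ℂ) * z := fun p => by push_cast; ring
    have hmul : ∀ p q : ℝ, (p : ℂ) * ((q : ℂ) * z) = ((p * q : ℝ) : ℂ) * z := fun p q => by
      push_cast; ring
    rw [hmul, hmul] at key
    ext x
    have hx := congrArg (fun T : Hil ℕ →L[ℂ] Hil ℕ => T x) key
    have hrr : ∀ y, numPow r (numPow r y) = numPow (t * s) y := fun y => by
      rw [← hr, ← numPow_comp]; rfl
    simp only [ContinuousLinearMap.comp_apply, smul_apply] at hx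
    simp only [ContinuousLinearMap.adjoint_comp, map_smulₛₗ, Complex.conj_ofReal,
      ContinuousLinearMap.comp_apply, smul_apply, adjoint_numPow, adjoint_displacement,
      hneg, hD, hrr]
    rw [neg_add_eq_sub, hx, map_smul, hD, smul_smul, smul_smul, smul_smul, smul_smul, hab, neg_neg]
    have e1 : -((a + b) * (g - d)) + a * (g - d) = -(b * (g - d)) := by ring
    rw [e1]
    congr 1
    rw [thermalFidelity]
    have h7 : Real.sqrt (1 - t * s) * Real.sqrt (1 - t * s) = 1 - t * s :=
      Real.mul_self_sqrt (by linarith)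
    have h7' : (Real.sqrt (1 - t * s) * Real.sqrt (1 - t * s) : ℂ) = 1 - t * s := by
      exact_mod_cast h7
    have hc' : (Real.sqrt (noiseConst E₂ E₁) * (1 - s * t) : ℂ) =
        Real.sqrt (1 / (1 + E₁)) * Real.sqrt (1 / (1 + E₂)) := by exact_mod_cast hc
    simp only [Complex.ofReal_mul]
    generalize (Real.exp (-((g - d) ^ 2 * ‖z‖ ^ 2 / (2 * (1 + E₁ + E₂)))) : ℂ) = e
    linear_combination -e * hc' - (Real.sqrt (noiseConst E₂ E₁) : ℂ) * e * h7'

/-! ### Fourier–Weyl inversion -/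

section Gaussian

open MeasureTheory

variable {b : ℝ} (hb : 0 < b) (p q : ℂ)

theorem cexp_quadratic_realProd (b : ℝ) (p q : ℂ) (v : ℝ × ℝ) :
    Complex.exp (-b * (star (Complex.measurableEquivRealProd.symm v) *
        Complex.measurableEquivRealProd.symm v) + p * Complex.measurableEquivRealProd.symm v +
        q * star (Complex.measurableEquivRealProd.symm v)) =
      Complex.exp (-(b : ℂ) * (v.1 : ℂ) ^ 2 + (p + q) * v.1 + 0) *
        Complex.exp (-(b : ℂ) * (v.2 : ℂ) ^ 2 + (Complex.I * (p - q)) * v.2 + 0) := by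
  have h : Complex.measurableEquivRealProd.symm v = v.1 + v.2 * Complex.I := by
    rw [Complex.measurableEquivRealProd_symm_apply]
    exact Complex.mk_eq_add_mul_I _ _
  rw [h, ← Complex.exp_add, ← starRingEnd_apply, map_add, map_mul, Complex.conj_ofReal,
    Complex.conj_ofReal, Complex.conj_I]
  congr 1
  linear_combination (b : ℂ) * (v.2 : ℂ) ^ 2 * Complex.I_sq

include hb

theorem integrable_cexp_quadratic_complex : Integrable fun ξ : ℂ =>
    Complex.exp (-b * (star ξ * ξ) + p * ξ + q * star ξ) := by
  rw [← Complex.volume_preserving_equiv_real_prod.symm.integrable_comp_emb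
    Complex.measurableEquivRealProd.symm.measurableEmbedding]
  simp only [Function.comp_def, cexp_quadratic_realProd]
  exact (integrable_cexp_quadratic (by simpa using hb) _ _).mul_prod
    (integrable_cexp_quadratic (by simpa using hb) _ _)

/-- In real coordinates the integrand splits into two one-dimensional Gaussians with linear terms `p
+ q` and `i(p - q)`; the squares of these differ from each other so as to leave `4pq`. -/
theorem integral_cexp_quadratic_complex :
    ∫ ξ : ℂ, Complex.exp (-b * (star ξ * ξ) + p * ξ + q * star ξ) =
      Real.pi / b * Complex.exp (p * q / b) := by
  have hb' : (-(b : ℂ)).re < 0 := by simpa using hb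
  have hb0 : (b : ℂ) ≠ 0 := by exact_mod_cast hb.ne'
  rw [← Complex.volume_preserving_equiv_real_prod.symm.integral_comp
    Complex.measurableEquivRealProd.symm.measurableEmbedding]
  simp only [cexp_quadratic_realProd]
  rw [Measure.volume_eq_prod, integral_prod_mul
    (fun x : ℝ => Complex.exp (-(b : ℂ) * (x : ℂ) ^ 2 + (p + q) * x + 0))
    (fun x : ℝ => Complex.exp (-(b : ℂ) * (x : ℂ) ^ 2 + (Complex.I * (p - q)) * x + 0)),
    integral_cexp_quadratic hb', integral_cexp_quadratic hb']
  have h2 : ((Real.pi / -(-(b : ℂ))) ^ (1 / 2 : ℂ)) * ((Real.pi / -(-(b : ℂ))) ^ (1 / 2 : ℂ)) =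
      Real.pi / b := by
    rw [neg_neg, ← Complex.cpow_add _ _ (div_ne_zero (by simp [Real.pi_ne_zero]) hb0)]
    norm_num
  rw [mul_mul_mul_comm, h2, ← Complex.exp_add]
  congr 2
  field_simp
  linear_combination ((p - q) ^ 2) * Complex.I_sq

end Gaussian

theorem inner_coh_displacement_neg (β β' ξ : ℂ) : ⟪coh β, displacement (-ξ) (coh β')⟫_ℂ =
    Complex.exp (-(‖β‖ ^ 2 / 2 : ℝ) - (‖β'‖ ^ 2 / 2 : ℝ) + star β * β') *
      Complex.exp (-(1 / 2 : ℝ) * (star ξ * ξ) + (-star β) * ξ + β' * star ξ) := by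
  rw [displacement_coh, inner_smul_right, inner_coh, ← Complex.exp_add, ← Complex.exp_add]
  congr 1
  simp only [Complex.ofReal_div, Complex.ofReal_pow, ← Complex.conj_mul',
    map_add, map_neg, starRingEnd_apply, star_neg, Complex.ofReal_ofNat,
    Complex.ofReal_one]
  ring

theorem integrable_inner_coh_displacement (β β' : ℂ) : MeasureTheory.Integrable
    fun ξ : ℂ => ⟪coh β, displacement (-ξ) (coh β')⟫_ℂ := by
  simp only [inner_coh_displacement_neg]
  exact (integrable_cexp_quadratic_complex one_half_pos _ _).const_mul _

theorem integrable_smul_displacement (β β' : ℂ) (y : Hil ℕ) : MeasureTheory.Integrable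
    fun ξ : ℂ => ⟪coh β, displacement (-ξ) (coh β')⟫_ℂ • displacement ξ y := by
  have hc : Continuous fun ξ : ℂ => ⟪coh β, displacement (-ξ) (coh β')⟫_ℂ :=
    continuous_const.inner (continuous_displacement continuous_neg continuous_const)
  refine ((integrable_inner_coh_displacement β β').norm.mul_const ‖y‖).mono'
    (hc.smul (continuous_displacement_apply y)).aestronglyMeasurable
    (Filter.Eventually.of_forall fun ξ => ?_)
  rw [norm_smul, norm_displacement_apply]

/-- `∫ ⟨β|D(-ξ)|β'⟩ D(ξ) dξ` as a bounded operator. -/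
theorem exists_weylIntegral (β β' : ℂ) : ∃ T : Hil ℕ →L[ℂ] Hil ℕ, ∀ y,
    T y = ∫ ξ : ℂ, ⟪coh β, displacement (-ξ) (coh β')⟫_ℂ • displacement ξ y := by
  refine ⟨LinearMap.mkContinuous
    { toFun := fun y => ∫ ξ : ℂ, ⟪coh β, displacement (-ξ) (coh β')⟫_ℂ • displacement ξ y
      map_add' := fun x y => ?_
      map_smul' := fun c y => ?_ } (∫ ξ : ℂ, ‖⟪coh β, displacement (-ξ) (coh β')⟫_ℂ‖)
    fun y => ?_, fun y => rfl⟩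
  · rw [← MeasureTheory.integral_add (integrable_smul_displacement β β' x)
      (integrable_smul_displacement β β' y)]
    simp only [map_add, smul_add]
  · rw [RingHom.id_apply, ← MeasureTheory.integral_smul]
    simp only [map_smul, smul_comm c]
  · refine (MeasureTheory.norm_integral_le_integral_norm _).trans_eq ?_
    rw [← MeasureTheory.integral_mul_const]
    simp only [norm_smul, norm_displacement_apply]

/-- The operator identity `∫ ⟨β|D(-ξ)|β'⟩ D(ξ) dξ = π |β'⟩⟨β|`. Both sides are bounded, so it is
enough to compare them between coherent vectors, where the left side is a Gaussian integral. It
makes the characteristic function determine a state. -/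
theorem weyl_inversion (β β' : ℂ) (x y : Hil ℕ) :
    ∫ ξ : ℂ, ⟪coh β, displacement (-ξ) (coh β')⟫_ℂ * ⟪x, displacement ξ y⟫_ℂ =
      Real.pi * (⟪x, coh β'⟫_ℂ * ⟪coh β, y⟫_ℂ) := by
  obtain ⟨T, hT⟩ := exists_weylIntegral β β'
  have hT2 : ∀ x y, ⟪x, T y⟫_ℂ =
      ∫ ξ : ℂ, ⟪coh β, displacement (-ξ) (coh β')⟫_ℂ * ⟪x, displacement ξ y⟫_ℂ := by
    intro x y
    rw [hT, ← integral_inner (integrable_smul_displacement β β' y)]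
    simp only [inner_smul_right]
  have h : T = (Real.pi : ℂ) • InnerProductSpace.rankOne ℂ (coh β') (coh β) := by
    refine clm_ext_inner_coh fun α α' => ?_
    rw [hT2, smul_apply, inner_smul_right, InnerProductSpace.inner_right_rankOne_apply]
    have hD : ∀ ξ : ℂ, ⟪coh α, displacement ξ (coh α')⟫_ℂ =
        Complex.exp (-(‖α‖ ^ 2 / 2 : ℝ) - (‖α'‖ ^ 2 / 2 : ℝ) + star α * α') *
          Complex.exp (-(1 / 2 : ℝ) * (star ξ * ξ) + (star α) * ξ + -α' * star ξ) := by
      intro ξ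
      have := inner_coh_displacement_neg α α' (-ξ)
      rw [neg_neg] at this
      rw [this]
      congr 2
      rw [star_neg]
      ring
    have hF : ∀ ξ : ℂ, ⟪coh β, displacement (-ξ) (coh β')⟫_ℂ * ⟪coh α, displacement ξ (coh α')⟫_ℂ =
        Complex.exp (-(‖β‖ ^ 2 / 2 : ℝ) - (‖β'‖ ^ 2 / 2 : ℝ) + star β * β' +
          (-(‖α‖ ^ 2 / 2 : ℝ) - (‖α'‖ ^ 2 / 2 : ℝ) + star α * α')) *
        Complex.exp (-(1 : ℝ) * (star ξ * ξ) + (star α - star β) * ξ + (β' - α') * star ξ) := by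
      intro ξ
      rw [hD, inner_coh_displacement_neg, mul_mul_mul_comm, ← Complex.exp_add, ← Complex.exp_add]
      congr 2
      push_cast
      ring
    simp only [hF]
    rw [MeasureTheory.integral_const_mul, integral_cexp_quadratic_complex one_pos, inner_coh,
      inner_coh, Complex.ofReal_one, div_one, div_one, mul_left_comm, ← Complex.exp_add,
      ← Complex.exp_add]
    congr 2
    ring
  rw [← hT2, h, smul_apply, inner_smul_right, InnerProductSpace.inner_right_rankOne_apply]

/-! ### Output of a phase-insensitive channel for coherent input -/

/-- The amplitude that `√μ` multiplies in the output for the coherent input `α`. -/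
noncomputable def PhaseKind.image (κ : PhaseKind) (α : ℂ) : ℂ :=
  match κ with
  | .covariant => α
  | .contravariant => star α

theorem PhaseKind.norm_image (κ : PhaseKind) (α : ℂ) : ‖κ.image α‖ = ‖α‖ := by
  cases κ
  · rfl
  · exact norm_star α

theorem PhaseKind.continuous_image (κ : PhaseKind) : Continuous κ.image := by
  cases κ
  · exact continuous_id
  · exact continuous_star

/-- The factor `e^{-μ|ξ|²/2}` here cancels the `μ` in the damping `e^{-(2E+1-μ)|ξ|²/2}` of the
channel and leaves the characteristic function of a thermal state with `E` photons, displaced by `√μ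
κ.image α`. -/
theorem inner_coh_displacement_scale (κ : PhaseKind) {μ : ℝ} (hμ : 0 ≤ μ) (α ξ : ℂ) :
    ⟪coh α, displacement (κ.scale μ ξ) (coh α)⟫_ℂ =
      Complex.exp (-(μ / 2 : ℝ) * (star ξ * ξ) + star (Real.sqrt μ * κ.image α) * ξ -
        Real.sqrt μ * κ.image α * star ξ) := by
  have hμ2 : (Real.sqrt μ : ℂ) ^ 2 = μ := by exact_mod_cast Real.sq_sqrt hμ
  rw [displacement_coh, inner_smul_right, inner_coh, ← Complex.exp_add]
  congr 1
  cases κ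
  all_goals
    simp only [PhaseKind.scale, PhaseKind.image, Complex.ofReal_div, Complex.ofReal_pow,
      ← Complex.conj_mul', ← starRingEnd_apply, map_add, map_mul, map_neg, Complex.conj_ofReal,
      Complex.ofReal_ofNat, Complex.conj_conj]
    linear_combination (-(ξ * (starRingEnd ℂ) ξ) / 2) * hμ2

theorem inner_coh_thermal (E : ℝ) (hE : 0 ≤ E) (γ β β' : ℂ) :
    ⟪coh β, (thermalFactor E hE γ ∘L (thermalFactor E hE γ).adjoint) (coh β')⟫_ℂ =
      1 / (1 + E) * Complex.exp (-(‖β‖ ^ 2 / 2 : ℝ) - (‖β'‖ ^ 2 / 2 : ℝ) + star β * β' +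
        (star γ - star β) * (β' - γ) / (1 + E)) := by
  have hs := thermalRatio_sq E hE
  have hE1 : (1 + E : ℂ) ≠ 0 := by exact_mod_cast (by positivity : (1 + E : ℝ) ≠ 0)
  have hs' : ((thermalRatio E hE : ℝ) : ℂ) ^ 2 = 1 - 1 / (1 + E) := by
    have : (thermalRatio E hE : ℝ) ^ 2 = 1 - 1 / (1 + E) := by
      rw [hs]
      field_simp
      ring
    exact_mod_cast this
  have hr : (Real.sqrt (1 / (1 + E)) : ℂ) * Real.sqrt (1 / (1 + E)) = 1 / (1 + E) := by
    have := Real.mul_self_sqrt (by positivity : 0 ≤ 1 / (1 + E))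
    exact_mod_cast this
  have hA : ∀ δ, (thermalFactor E hE γ).adjoint (coh δ) = (Real.sqrt (1 / (1 + E)) : ℂ) •
      Complex.exp ((-γ * star δ - star (-γ) * δ) / 2) •
      Complex.exp (-((1 - ((thermalRatio E hE : ℝ) : ℂ) ^ 2) * (star (δ + -γ) * (δ + -γ))) / 2) •
      coh ((thermalRatio E hE : ℝ) * (δ + -γ)) := by
    intro δ
    rw [thermalFactor, map_smulₛₗ, Complex.conj_ofReal, ContinuousLinearMap.adjoint_comp,
      adjoint_numPow, adjoint_displacement, smul_apply, ContinuousLinearMap.comp_apply,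
      displacement_coh, map_smul, numPow_coh]
  rw [ContinuousLinearMap.comp_apply, ← ContinuousLinearMap.adjoint_inner_left, hA, hA]
  simp only [inner_smul_left, inner_smul_right, inner_coh, Complex.conj_ofReal,
    ← Complex.exp_conj]
  have e : ∀ r a b c d f : ℂ, r * (a * (b * (r * (c * (d * f))))) = r * r * (a * b * c * d * f) := by
    intros
    ring
  rw [e, hr]
  congr 1
  simp only [← Complex.exp_add]
  congr 1
  simp only [Complex.ofReal_div, Complex.ofReal_pow, ← Complex.conj_mul', ← starRingEnd_apply,
    map_add, map_mul, map_neg, map_sub, map_div₀, map_one, map_pow, Complex.conj_ofReal,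
    Complex.ofReal_ofNat, Complex.conj_conj, map_ofNat]
  linear_combination ((starRingEnd ℂ) β - (starRingEnd ℂ) γ) * (β' - γ) * hs'

/-- A sequence of vectors whose mixture has the characteristic function of a displaced thermal state
is a decomposition of that state. -/
theorem hasSum_of_characteristic {φ : ℕ → Hil ℕ} (hφ : HasSum (fun j => ‖φ j‖ ^ 2) 1)
    (E : ℝ) (hE : 0 ≤ E) (γ : ℂ)
    (h : ∀ ξ : ℂ, HasSum (fun j => ⟪φ j, displacement ξ (φ j)⟫_ℂ)
      (Complex.exp (-(E + 1 / 2 : ℝ) * (star ξ * ξ) + star γ * ξ - γ * star ξ))) (x y : Hil ℕ) :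
    HasSum (fun j => ⟪x, φ j⟫_ℂ * ⟪φ j, y⟫_ℂ)
      ⟪x, (thermalFactor E hE γ ∘L (thermalFactor E hE γ).adjoint) y⟫_ℂ := by
  have hsum : Summable fun j => InnerProductSpace.rankOne ℂ (φ j) (φ j) := by
    refine Summable.of_norm (hφ.summable.congr fun j => ?_)
    rw [InnerProductSpace.norm_rankOne, pow_two]
  have hT : ∀ x y, HasSum (fun j => ⟪x, φ j⟫_ℂ * ⟪φ j, y⟫_ℂ)
      ⟪x, (∑' j, InnerProductSpace.rankOne ℂ (φ j) (φ j)) y⟫_ℂ := by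
    intro x y
    have h1 := hsum.hasSum.mapL ((innerSL ℂ x).comp (ContinuousLinearMap.apply ℂ (Hil ℕ) y))
    simpa [mul_comm] using h1
  suffices heq : (∑' j, InnerProductSpace.rankOne ℂ (φ j) (φ j)) =
      thermalFactor E hE γ ∘L (thermalFactor E hE γ).adjoint by
    rw [← heq]
    exact hT x y
  refine clm_ext_inner_coh fun β β' => ?_
  have hk := integrable_inner_coh_displacement β β'
  have hc : Continuous fun ξ : ℂ => ⟪coh β, displacement (-ξ) (coh β')⟫_ℂ :=
    continuous_const.inner (continuous_displacement continuous_neg continuous_const)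
  have hbound : ∀ j ξ, ‖⟪coh β, displacement (-ξ) (coh β')⟫_ℂ * ⟪φ j, displacement ξ (φ j)⟫_ℂ‖ ≤
      ‖φ j‖ ^ 2 * ‖⟪coh β, displacement (-ξ) (coh β')⟫_ℂ‖ := by
    intro j ξ
    rw [norm_mul, mul_comm]
    gcongr
    refine (norm_inner_le_norm _ _).trans_eq ?_
    rw [norm_displacement_apply, pow_two]
  have hint : ∀ j, MeasureTheory.Integrable fun ξ : ℂ =>
      ⟪coh β, displacement (-ξ) (coh β')⟫_ℂ * ⟪φ j, displacement ξ (φ j)⟫_ℂ := fun j =>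
    (hk.norm.const_mul (‖φ j‖ ^ 2)).mono'
      (hc.mul (continuous_const.inner (continuous_displacement_apply (φ j)))).aestronglyMeasurable
      (Filter.Eventually.of_forall (hbound j))
  -- Sum and integral are exchanged: each term is at most `‖φ j‖²` times one fixed integrable
  -- function.
  have hF := MeasureTheory.hasSum_integral_of_summable_integral_norm hint (by
    refine Summable.of_nonneg_of_le (fun j => MeasureTheory.integral_nonneg fun _ => norm_nonneg _)
      (fun j => MeasureTheory.integral_mono (hint j).norm (hk.norm.const_mul (‖φ j‖ ^ 2))
        (hbound j)) ?_
    simp only [MeasureTheory.integral_const_mul]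
    exact hφ.summable.mul_right _)
  simp only [weyl_inversion] at hF
  have hF2 : ∀ ξ : ℂ, ∑' j, ⟪coh β, displacement (-ξ) (coh β')⟫_ℂ * ⟪φ j, displacement ξ (φ j)⟫_ℂ =
      Complex.exp (-(‖β‖ ^ 2 / 2 : ℝ) - (‖β'‖ ^ 2 / 2 : ℝ) + star β * β') *
        Complex.exp (-(1 + E : ℝ) * (star ξ * ξ) + (star γ - star β) * ξ + (β' - γ) * star ξ) := by
    intro ξ
    rw [((h ξ).mul_left _).tsum_eq, inner_coh_displacement_neg, mul_assoc, ← Complex.exp_add]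
    congr 2
    push_cast
    ring
  have hE1 : (1 + E : ℂ) ≠ 0 := by exact_mod_cast (by positivity : (1 + E : ℝ) ≠ 0)
  have hpi : (Real.pi : ℂ) ≠ 0 := by exact_mod_cast Real.pi_ne_zero
  simp only [hF2] at hF
  rw [MeasureTheory.integral_const_mul,
    integral_cexp_quadratic_complex (by positivity : (0 : ℝ) < 1 + E)] at hF
  have h1 := ((hT (coh β) (coh β')).mul_left (Real.pi : ℂ)).unique
    (hF.congr_fun fun j => by rw [mul_comm ⟪coh β, φ j⟫_ℂ])
  rw [inner_coh_thermal]
  refine mul_left_cancel₀ hpi (h1.trans ?_)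
  rw [Complex.exp_add _ ((star γ - star β) * (β' - γ) / (1 + E))]
  push_cast
  ring

theorem IsPhaseInsensitiveGaussian.noise_nonneg {κ : PhaseKind} {μ E : ℝ} {Φ : QuantumChannel}
    (h : IsPhaseInsensitiveGaussian κ μ E Φ) : 0 ≤ E := h.2.1

theorem hasSum_kraus_coh {κ : PhaseKind} {μ E : ℝ} {Φ : QuantumChannel}
    (h : IsPhaseInsensitiveGaussian κ μ E Φ) (α : ℂ) (x y : Hil ℕ) :
    HasSum (fun j => ⟪x, Φ.kraus j (coh α)⟫_ℂ * ⟪Φ.kraus j (coh α), y⟫_ℂ)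
      ⟪x, (thermalFactor E h.noise_nonneg (Real.sqrt μ * κ.image α) ∘L
        (thermalFactor E h.noise_nonneg (Real.sqrt μ * κ.image α)).adjoint) y⟫_ℂ := by
  have h1 := Φ.complete (coh α)
  rw [norm_coh, one_pow] at h1
  refine hasSum_of_characteristic h1 E h.noise_nonneg _ (fun ξ => ?_) x y
  have h2 := h.2.2 ξ (coh α) (coh α)
  rw [inner_coh_displacement_scale κ h.1, Complex.ofReal_exp, ← Complex.exp_add] at h2
  convert h2 using 2
  simp only [← starRingEnd_apply, Complex.conj_mul']
  push_cast
  ring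

/-! ### Mixtures of factorized operators -/

section Mixture

open MeasureTheory

variable {X Ω : Type}

theorem inner_comp_adjoint (A B : Hil X →L[ℂ] Hil X) (x y : Hil X) :
    ⟪x, (A ∘L B.adjoint) y⟫_ℂ = ⟪A.adjoint x, B.adjoint y⟫_ℂ := by
  rw [ContinuousLinearMap.comp_apply, ContinuousLinearMap.adjoint_inner_left]

theorem inner_comp_adjoint_self (A : Hil X →L[ℂ] Hil X) (x : Hil X) :
    ⟪x, (A ∘L A.adjoint) x⟫_ℂ = ((‖A.adjoint x‖ ^ 2 : ℝ) : ℂ) := by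
  rw [inner_comp_adjoint, inner_self_eq_norm_sq_to_K]
  push_cast
  rfl

variable [DecidableEq X]

/-- The operator norm is at most the Hilbert–Schmidt norm. -/
theorem norm_adjoint_apply_le {A : Hil X →L[ℂ] Hil X}
    (hA : HasSum (fun k => ‖A (ket k)‖ ^ 2) 1) (x : Hil X) : ‖A.adjoint x‖ ≤ ‖x‖ := by
  have h : ‖A.adjoint x‖ ^ 2 ≤ 1 * ‖x‖ ^ 2 := by
    refine hasSum_le (fun k => ?_) (hasSum_norm_sq (A.adjoint x)) (hA.mul_right (‖x‖ ^ 2))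
    rw [← inner_ket, ContinuousLinearMap.adjoint_inner_right, ← mul_pow]
    gcongr
    exact norm_inner_le_norm _ _
  rw [one_mul] at h
  exact (pow_le_pow_iff_left₀ (norm_nonneg _) (norm_nonneg _) two_ne_zero).1 h

theorem norm_inner_comp_adjoint_le {A B : Hil X →L[ℂ] Hil X}
    (hA : HasSum (fun k => ‖A (ket k)‖ ^ 2) 1) (hB : HasSum (fun k => ‖B (ket k)‖ ^ 2) 1)
    (x y : Hil X) : ‖⟪x, (A ∘L B.adjoint) y⟫_ℂ‖ ≤ ‖x‖ * ‖y‖ := by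
  rw [inner_comp_adjoint]
  refine (norm_inner_le_norm _ _).trans ?_
  gcongr
  · exact norm_adjoint_apply_le hA x
  · exact norm_adjoint_apply_le hB y

variable [Countable X] [TopologicalSpace Ω] [MeasurableSpace Ω] [OpensMeasurableSpace Ω]

/-- Continuity is assumed only for the columns of `A` and `B`, not for their adjoints. The matrix
element is a countable series of continuous functions of the columns, hence measurable. -/
theorem measurable_inner_comp_adjoint {A B : Ω → Hil X →L[ℂ] Hil X}
    (hA : ∀ k, Continuous fun ω => A ω (ket k)) (hB : ∀ k, Continuous fun ω => B ω (ket k))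
    (x y : Hil X) : Measurable fun ω => ⟪x, (A ω ∘L (B ω).adjoint) y⟫_ℂ := by
  have h : ∀ ω, HasSum (fun k => ⟪B ω (ket k), y⟫_ℂ * ⟪x, A ω (ket k)⟫_ℂ)
      ⟪x, (A ω ∘L (B ω).adjoint) y⟫_ℂ := by
    intro ω
    rw [inner_comp_adjoint]
    refine (hasSum_inner _ _).congr_fun fun k => ?_
    rw [← inner_ket, ← inner_ket_right, ContinuousLinearMap.adjoint_inner_right,
      inner_ket_right, ← inner_ket, ← starRingEnd_apply, inner_conj_symm,
      ContinuousLinearMap.adjoint_inner_left]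
  refine measurable_of_tendsto_metrizable' Filter.atTop
    (f := fun (s : Finset X) ω => ∑ k ∈ s, ⟪B ω (ket k), y⟫_ℂ * ⟪x, A ω (ket k)⟫_ℂ)
    (fun s => ?_) (tendsto_pi_nhds.2 fun ω => h ω)
  exact Continuous.measurable (continuous_finsetSum _ fun k _ =>
    ((hB k).inner continuous_const).mul (continuous_const.inner (hA k)))

variable {P : Measure Ω} [IsProbabilityMeasure P] {A B : Ω → Hil X →L[ℂ] Hil X}

theorem integrable_inner_comp_adjoint
    (hA : ∀ k, Continuous fun ω => A ω (ket k)) (hB : ∀ k, Continuous fun ω => B ω (ket k))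
    (hA1 : ∀ ω, HasSum (fun k => ‖A ω (ket k)‖ ^ 2) 1)
    (hB1 : ∀ ω, HasSum (fun k => ‖B ω (ket k)‖ ^ 2) 1) (x y : Hil X) :
    Integrable (fun ω => ⟪x, (A ω ∘L (B ω).adjoint) y⟫_ℂ) P :=
  (integrable_const (‖x‖ * ‖y‖)).mono'
    (measurable_inner_comp_adjoint hA hB x y).aestronglyMeasurable
    (Filter.Eventually.of_forall fun ω => norm_inner_comp_adjoint_le (hA1 ω) (hB1 ω) x y)

theorem integrable_norm_adjoint_sq (hA : ∀ k, Continuous fun ω => A ω (ket k))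
    (hA1 : ∀ ω, HasSum (fun k => ‖A ω (ket k)‖ ^ 2) 1) (x : Hil X) :
    Integrable (fun ω => ‖(A ω).adjoint x‖ ^ 2) P := by
  have := (integrable_inner_comp_adjoint (P := P) hA hA hA1 hA1 x x).re
  simpa only [inner_comp_adjoint_self, RCLike.re_to_complex, Complex.ofReal_re] using this

/-- The mixture `∫ A A† dP` is a state. -/
theorem isState_of_mixture {ρ : Hil X →L[ℂ] Hil X} (hA : ∀ k, Continuous fun ω => A ω (ket k))
    (hA1 : ∀ ω, HasSum (fun k => ‖A ω (ket k)‖ ^ 2) 1)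
    (hρ : ∀ x, ⟪x, ρ x⟫_ℂ = ∫ ω, ⟪x, (A ω ∘L (A ω).adjoint) x⟫_ℂ ∂P) : IsState ρ := by
  have hρ' : ∀ x, ⟪x, ρ x⟫_ℂ = ((∫ ω, ‖(A ω).adjoint x‖ ^ 2 ∂P : ℝ) : ℂ) := by
    intro x
    rw [hρ, ← integral_complex_ofReal]
    simp only [inner_comp_adjoint_self]
  constructor
  · rw [ContinuousLinearMap.nonneg_iff_isPositive, ContinuousLinearMap.isPositive_iff_complex]
    intro x
    have h1 : ⟪ρ x, x⟫_ℂ = ((∫ ω, ‖(A ω).adjoint x‖ ^ 2 ∂P : ℝ) : ℂ) := by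
      rw [← inner_conj_symm, hρ', Complex.conj_ofReal]
    rw [h1]
    refine ⟨by simp, ?_⟩
    rw [RCLike.re_to_complex, Complex.ofReal_re]
    exact integral_nonneg fun _ => by positivity
  · have hint := fun k => integrable_norm_adjoint_sq (P := P) hA hA1 (ket k)
    have h1 := fun ω => hasSum_norm_adjoint_sq (hA1 ω)
    have h2 := hasSum_integral_of_summable_integral_norm hint (by
      refine summable_of_sum_le (c := 1) (fun k => integral_nonneg fun _ => norm_nonneg _) fun s => ?_
      rw [← integral_finsetSum _ fun k _ => (hint k).norm]
      refine (integral_mono (integrable_finsetSum _ fun k _ => (hint k).norm)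
        (integrable_const 1) fun ω => ?_).trans_eq (by simp)
      simp only [Real.norm_of_nonneg (sq_nonneg _)]
      exact sum_le_hasSum _ (fun _ _ => by positivity) (h1 ω))
    simp only [(h1 _).tsum_eq] at h2
    have h3 : HasSum (fun k => ((∫ ω, ‖(A ω).adjoint (ket k)‖ ^ 2 ∂P : ℝ) : ℂ)) 1 := by
      have : (∫ _ : Ω, (1 : ℝ) ∂P) = 1 := by simp
      rw [this] at h2
      have h4 := Complex.hasSum_ofReal.2 h2
      rwa [Complex.ofReal_one] at h4
    simpa only [hρ'] using h3

/-- The weak integral of `A B†` is a sesquilinear form bounded by 1, hence is represented by an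
operator. -/
theorem exists_mixture_operator
    (hA : ∀ k, Continuous fun ω => A ω (ket k)) (hB : ∀ k, Continuous fun ω => B ω (ket k))
    (hA1 : ∀ ω, HasSum (fun k => ‖A ω (ket k)‖ ^ 2) 1)
    (hB1 : ∀ ω, HasSum (fun k => ‖B ω (ket k)‖ ^ 2) 1) (P : Measure Ω) [IsProbabilityMeasure P] :
    ∃ T : Hil X →L[ℂ] Hil X, ∀ x y, ⟪x, T y⟫_ℂ = ∫ ω, ⟪x, (A ω ∘L (B ω).adjoint) y⟫_ℂ ∂P := by
  have hint := integrable_inner_comp_adjoint (P := P) hA hB hA1 hB1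
  have hint' : ∀ y x, Integrable (fun ω => ⟪(A ω ∘L (B ω).adjoint) y, x⟫_ℂ) P := by
    intro y x
    have := Complex.conjCLE.toContinuousLinearMap.integrable_comp (hint x y)
    simpa using this
  let f : Hil X →ₗ⋆[ℂ] Hil X →ₗ[ℂ] ℂ := LinearMap.mk₂'ₛₗ (starRingEnd ℂ) (RingHom.id ℂ)
    (fun y x => ∫ ω, ⟪(A ω ∘L (B ω).adjoint) y, x⟫_ℂ ∂P)
    (fun y y' x => by
      rw [← integral_add (hint' y x) (hint' y' x)]
      simp only [map_add, inner_add_left])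
    (fun c y x => by
      rw [smul_eq_mul, ← integral_const_mul]
      simp only [map_smul, inner_smul_left])
    (fun y x x' => by
      rw [← integral_add (hint' y x) (hint' y x')]
      simp only [inner_add_right])
    (fun c y x => by
      rw [RingHom.id_apply, smul_eq_mul, ← integral_const_mul]
      simp only [inner_smul_right])
  have hf : ∀ y x, ‖f y x‖ ≤ 1 * ‖y‖ * ‖x‖ := by
    intro y x
    refine (norm_integral_le_of_norm_le (integrable_const (1 * ‖y‖ * ‖x‖))
      (Filter.Eventually.of_forall fun ω => ?_)).trans_eq (by simp)
    rw [norm_inner_symm, one_mul, mul_comm]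
    exact norm_inner_comp_adjoint_le (hA1 ω) (hB1 ω) x y
  refine ⟨InnerProductSpace.continuousLinearMapOfBilin (f.mkContinuous₂ 1 hf), fun x y => ?_⟩
  rw [← inner_conj_symm, InnerProductSpace.continuousLinearMapOfBilin_apply]
  change (starRingEnd ℂ) (∫ ω, ⟪(A ω ∘L (B ω).adjoint) y, x⟫_ℂ ∂P) = _
  rw [← integral_conj]
  simp only [inner_conj_symm]

/-- Concavity of the fidelity, for explicitly aligned decompositions. -/
theorem integral_le_fidelity {ρ σ : Hil X →L[ℂ] Hil X}
    (hA : ∀ k, Continuous fun ω => A ω (ket k)) (hB : ∀ k, Continuous fun ω => B ω (ket k))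
    (hA1 : ∀ ω, HasSum (fun k => ‖A ω (ket k)‖ ^ 2) 1)
    (hB1 : ∀ ω, HasSum (fun k => ‖B ω (ket k)‖ ^ 2) 1)
    (hρ : ∀ x, ⟪x, ρ x⟫_ℂ = ∫ ω, ⟪x, (A ω ∘L (A ω).adjoint) x⟫_ℂ ∂P)
    (hσ : ∀ x, ⟪x, σ x⟫_ℂ = ∫ ω, ⟪x, (B ω ∘L (B ω).adjoint) x⟫_ℂ ∂P) {f : Ω → ℝ}
    (hf : ∀ ω, HasSum (fun k => ⟪ket k, ((B ω).adjoint ∘L A ω) (ket k)⟫_ℂ) (f ω)) :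
    ∫ ω, f ω ∂P ≤ fidelity ρ σ := by
  obtain ⟨T, hT⟩ := exists_mixture_operator hA hB hA1 hB1 P
  have hsρ := isState_of_mixture hA hA1 hρ
  have hsσ := isState_of_mixture hB hB1 hσ
  have hnρ : ∀ x, ‖⟪x, ρ x⟫_ℂ‖ = ∫ ω, ‖(A ω).adjoint x‖ ^ 2 ∂P := by
    intro x
    have : ⟪x, ρ x⟫_ℂ = ((∫ ω, ‖(A ω).adjoint x‖ ^ 2 ∂P : ℝ) : ℂ) := by
      rw [hρ, ← integral_complex_ofReal]
      simp only [inner_comp_adjoint_self]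
    rw [this, Complex.norm_real, Real.norm_of_nonneg (integral_nonneg fun _ => by positivity)]
  have hnσ : ∀ x, ‖⟪x, σ x⟫_ℂ‖ = ∫ ω, ‖(B ω).adjoint x‖ ^ 2 ∂P := by
    intro x
    have : ⟪x, σ x⟫_ℂ = ((∫ ω, ‖(B ω).adjoint x‖ ^ 2 ∂P : ℝ) : ℂ) := by
      rw [hσ, ← integral_complex_ofReal]
      simp only [inner_comp_adjoint_self]
    rw [this, Complex.norm_real, Real.norm_of_nonneg (integral_nonneg fun _ => by positivity)]
  have hIA := fun x => integrable_norm_adjoint_sq (P := P) hA hA1 x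
  have hIB := fun x => integrable_norm_adjoint_sq (P := P) hB hB1 x
  have hint := integrable_inner_comp_adjoint (P := P) hA hB hA1 hB1
  have hform : ∀ x y, ‖⟪x, T y⟫_ℂ‖ ^ 2 ≤ ‖⟪x, ρ x⟫_ℂ‖ * ‖⟪y, σ y⟫_ℂ‖ := by
    intro x y
    rw [hT, hnρ, hnσ]
    -- Cauchy–Schwarz for the integrals by the discriminant: the quadratic in `t` is nonnegative by
    -- integrating `2|t| ‖A†x‖ ‖B†y‖ ≤ t² ‖A†x‖² + ‖B†y‖²`.
    have hq : ∀ t : ℝ, 0 ≤ (∫ ω, ‖(A ω).adjoint x‖ ^ 2 ∂P) * (t * t) +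
        (-(2 * ‖∫ ω, ⟪x, (A ω ∘L (B ω).adjoint) y⟫_ℂ ∂P‖)) * t +
        ∫ ω, ‖(B ω).adjoint y‖ ^ 2 ∂P := by
      intro t
      have h1 := norm_integral_le_of_norm_le
        (f := fun ω => ((2 * t : ℝ) : ℂ) * ⟪x, (A ω ∘L (B ω).adjoint) y⟫_ℂ)
        (((hIA x).const_mul (t * t)).add (hIB y)) (Filter.Eventually.of_forall fun ω => by
          rw [norm_mul, Complex.norm_real, inner_comp_adjoint, Real.norm_eq_abs, abs_mul,
            abs_of_pos (two_pos : (0 : ℝ) < 2)]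
          have h2 := norm_inner_le_norm (𝕜 := ℂ) ((A ω).adjoint x) ((B ω).adjoint y)
          have h3 := mul_le_mul_of_nonneg_left h2 (abs_nonneg t)
          have h4 := sq_nonneg (|t| * ‖(A ω).adjoint x‖ - ‖(B ω).adjoint y‖)
          have h5 := sq_abs t
          simp only [Pi.add_apply]
          nlinarith)
      rw [integral_const_mul, norm_mul, Complex.norm_real, Real.norm_eq_abs,
        integral_add' ((hIA x).const_mul _) (hIB y), integral_const_mul] at h1
      have h2 := le_abs_self (2 * t)
      have h3 := mul_le_mul_of_nonneg_right h2
        (norm_nonneg (∫ ω, ⟪x, (A ω ∘L (B ω).adjoint) y⟫_ℂ ∂P))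
      linarith
    have := discrim_le_zero hq
    rw [discrim] at this
    nlinarith
  -- Cyclicity: the operator `T` that dominates is built from `A B†`, while the known trace is that
  -- of `B† A`.
  have htr : ∀ ω, ∑' k, ⟪ket k, (A ω ∘L (B ω).adjoint) (ket k)⟫_ℂ = f ω := by
    intro ω
    have h1 : hsSq (A ω).adjoint ≠ ∞ := by
      rw [hsSq_adjoint, hsSq_eq_of_hasSum (hA1 ω)]; exact ENNReal.ofReal_ne_top
    have h2 : hsSq (B ω).adjoint ≠ ∞ := by
      rw [hsSq_adjoint, hsSq_eq_of_hasSum (hB1 ω)]; exact ENNReal.ofReal_ne_top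
    simp only [inner_comp_adjoint]
    rw [tsum_inner_adjoint h1 h2, ← (hf ω).tsum_eq]
    simp only [ContinuousLinearMap.adjoint_adjoint, ContinuousLinearMap.comp_apply,
      ContinuousLinearMap.adjoint_inner_right]
  have hsum := hasSum_integral_of_summable_integral_norm (fun k => hint (ket k) (ket k)) (by
    refine Summable.of_nonneg_of_le (fun k => integral_nonneg fun _ => norm_nonneg _) (fun k => ?_)
      (((hsρ.2.summable.norm).add (hsσ.2.summable.norm)).div_const 2)
    rw [hnρ, hnσ, ← integral_add (hIA _) (hIB _), ← integral_div]
    refine integral_mono (hint _ _).norm (((hIA _).add (hIB _)).div_const 2) fun ω => ?_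
    simp only [inner_comp_adjoint]
    exact norm_inner_le_half _ _)
  simp only [htr, ← hT] at hsum
  have := norm_trace_le_fidelity hsρ.1 hsσ.1 (r := 1) (s := 1) (by exact_mod_cast hsρ.2)
    (by exact_mod_cast hsσ.2) hform
  rw [hsum.tsum_eq, integral_complex_ofReal, Complex.norm_real] at this
  exact (le_abs_self _).trans this

end Mixture

/-! ### Multimode outputs -/

section Output

open MeasureTheory

theorem opNorm_le_of_inner {H : Type} [NormedAddCommGroup H] [InnerProductSpace ℂ H]
    {T : H →L[ℂ] H} {c : ℝ} (hc : 0 ≤ c) (h : ∀ x y, ‖⟪x, T y⟫_ℂ‖ ≤ ‖x‖ * ‖y‖ * c) : ‖T‖ ≤ c := by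
  refine ContinuousLinearMap.opNorm_le_bound _ hc fun y => ?_
  have h1 := h (T y) y
  rw [norm_inner_self_eq_sq] at h1
  by_contra! hlt
  have h4 : 0 < ‖T y‖ := lt_of_le_of_lt (by positivity) hlt
  nlinarith

variable {ι : Type} [Fintype ι]

/-- The product coherent vector. -/
noncomputable def cohVec (α : ι → ℂ) : Hil (ι → ℕ) := prodVec fun i => coh (α i)

theorem norm_cohVec (α : ι → ℂ) : ‖cohVec α‖ = 1 := by
  simp [cohVec, norm_prodVec, norm_coh]

theorem continuous_cohVec : Continuous (cohVec : (ι → ℂ) → Hil (ι → ℕ)) :=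
  continuous_prodVec fun i => continuous_coh.comp (continuous_apply i)

theorem inner_coherentState (α : ι → ℂ) (x y : Hil (ι → ℕ)) :
    ⟪x, coherentState α y⟫_ℂ = ⟪x, cohVec α⟫_ℂ * ⟪cohVec α, y⟫_ℂ :=
  InnerProductSpace.inner_right_rankOne_apply _ _ _ _

variable [DecidableEq ι]

theorem hasSum_norm_tensorKraus_sq (Φ : ι → QuantumChannel) (α : ι → ℂ) :
    HasSum (fun j => ‖tensorKraus Φ j (cohVec α)‖ ^ 2) 1 := by
  have h := hasSum_prod_pi (𝕜 := ℝ) fun i => (Φ i).complete (coh (α i))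
  simp only [norm_coh, one_pow, Finset.prod_const_one] at h
  refine h.congr_fun fun j => ?_
  rw [tensorKraus, cohVec, tensorOp_prodVec, norm_prodVec, Finset.prod_pow]

/-- The product of the factors of displaced thermal states. -/
noncomputable def outFactor (E : ι → ℝ) (hE : ∀ i, 0 ≤ E i) (g : ι → ℝ) (z : ι → ℂ) :
    Hil (ι → ℕ) →L[ℂ] Hil (ι → ℕ) :=
  tensorOp fun i => thermalFactor (E i) (hE i) (g i * z i)

theorem hasSum_norm_tensorOp_sq {A : ι → Hil ℕ →L[ℂ] Hil ℕ}
    (h : ∀ i, HasSum (fun k => ‖A i (ket k)‖ ^ 2) 1) :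
    HasSum (fun n => ‖tensorOp A (ket n)‖ ^ 2) 1 := by
  have h1 := hasSum_prod_pi (𝕜 := ℝ) h
  rw [Finset.prod_const_one] at h1
  refine h1.congr_fun fun n => ?_
  rw [ket_pi, tensorOp_prodVec, norm_prodVec, Finset.prod_pow]

theorem hasSum_norm_outFactor_sq (E : ι → ℝ) (hE : ∀ i, 0 ≤ E i) (g : ι → ℝ) (z : ι → ℂ) :
    HasSum (fun n => ‖outFactor E hE g z (ket n)‖ ^ 2) 1 :=
  hasSum_norm_tensorOp_sq fun _ => hasSum_norm_thermalFactor_sq _ _ _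

variable {κ : PhaseKind} {μ E : ι → ℝ} {Φ : ι → QuantumChannel}

theorem hasSum_tensorKraus (h : ∀ i, IsPhaseInsensitiveGaussian κ (μ i) (E i) (Φ i)) (α : ι → ℂ)
    (x y : Hil (ι → ℕ)) :
    HasSum (fun j => ⟪x, tensorKraus Φ j (cohVec α)⟫_ℂ * ⟪tensorKraus Φ j (cohVec α), y⟫_ℂ)
      ⟪x, (outFactor E (fun i => (h i).noise_nonneg) (fun i => Real.sqrt (μ i)) (fun i => κ.image (α i)) ∘L
        (outFactor E (fun i => (h i).noise_nonneg) (fun i => Real.sqrt (μ i))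
          (fun i => κ.image (α i))).adjoint) y⟫_ℂ := by
  have hsum : Summable fun j => InnerProductSpace.rankOne ℂ (tensorKraus Φ j (cohVec α))
      (tensorKraus Φ j (cohVec α)) := by
    refine Summable.of_norm ((hasSum_norm_tensorKraus_sq Φ α).summable.congr fun j => ?_)
    rw [InnerProductSpace.norm_rankOne, pow_two]
  have hT : ∀ x y, HasSum
      (fun j => ⟪x, tensorKraus Φ j (cohVec α)⟫_ℂ * ⟪tensorKraus Φ j (cohVec α), y⟫_ℂ)
      ⟪x, (∑' j, InnerProductSpace.rankOne ℂ (tensorKraus Φ j (cohVec α))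
        (tensorKraus Φ j (cohVec α))) y⟫_ℂ := by
    intro x y
    have h1 := hsum.hasSum.mapL
      ((innerSL ℂ x).comp (ContinuousLinearMap.apply ℂ (Hil (ι → ℕ)) y))
    simpa [mul_comm] using h1
  suffices heq : (∑' j, InnerProductSpace.rankOne ℂ (tensorKraus Φ j (cohVec α))
      (tensorKraus Φ j (cohVec α))) =
      outFactor E (fun i => (h i).noise_nonneg) (fun i => Real.sqrt (μ i))
        (fun i => κ.image (α i)) ∘L (outFactor E (fun i => (h i).noise_nonneg)
          (fun i => Real.sqrt (μ i)) (fun i => κ.image (α i))).adjoint by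
    rw [← heq]
    exact hT x y
  -- Between number states both the tensor Kraus operators and the thermal factors split over the
  -- modes, so the claim is the product of the single-mode series `hasSum_kraus_coh`.
  refine clm_ext_ket fun m n => ?_
  rw [outFactor, adjoint_tensorOp, tensorOp_comp, inner_ket_tensorOp]
  refine (hT _ _).unique ((hasSum_prod_pi fun i =>
    hasSum_kraus_coh (h i) (α i) (ket (m i)) (ket (n i))).congr_fun fun j => ?_)
  rw [tensorKraus, cohVec, tensorOp_prodVec, ket_pi, ket_pi, inner_prodVec, inner_prodVec,
    Finset.prod_mul_distrib]

/-- The output for a classical input is the mixture of the outputs for the coherent inputs. -/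
theorem inner_applyKraus (h : ∀ i, IsPhaseInsensitiveGaussian κ (μ i) (E i) (Φ i))
    {P : Measure (ι → ℂ)} [IsProbabilityMeasure P] {ρ : Hil (ι → ℕ) →L[ℂ] Hil (ι → ℕ)}
    (hρ : ∀ x y, ⟪x, ρ y⟫_ℂ = ∫ α, ⟪x, coherentState α y⟫_ℂ ∂P) (x y : Hil (ι → ℕ)) :
    ⟪x, applyKraus (tensorKraus Φ) ρ y⟫_ℂ = ∫ α, ⟪x,
      (outFactor E (fun i => (h i).noise_nonneg) (fun i => Real.sqrt (μ i)) (fun i => κ.image (α i)) ∘L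
        (outFactor E (fun i => (h i).noise_nonneg) (fun i => Real.sqrt (μ i))
          (fun i => κ.image (α i))).adjoint) y⟫_ℂ ∂P := by
  set K := tensorKraus Φ
  have hc : ∀ j, Continuous fun α => K j (cohVec α) := fun j =>
    (K j).continuous.comp continuous_cohVec
  have hle : ∀ j α, ‖K j (cohVec α)‖ ^ 2 ≤ 1 := fun j α =>
    le_hasSum (hasSum_norm_tensorKraus_sq Φ α) j fun _ _ => by positivity
  have hint : ∀ j, Integrable (fun α => ‖K j (cohVec α)‖ ^ 2) P := fun j =>
    (integrable_const 1).mono' ((hc j).norm.pow 2).aestronglyMeasurable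
      (Filter.Eventually.of_forall fun α => by
        rw [Real.norm_of_nonneg (by positivity)]; exact hle j α)
  have hsum : Summable fun j => ∫ α, ‖K j (cohVec α)‖ ^ 2 ∂P := by
    refine summable_of_sum_le (c := 1) (fun j => integral_nonneg fun _ => by positivity) fun s => ?_
    rw [← integral_finsetSum _ fun j _ => hint j]
    refine (integral_mono (integrable_finsetSum _ fun j _ => hint j)
      (integrable_const 1) fun α => ?_).trans_eq (by simp)
    exact sum_le_hasSum _ (fun _ _ => by positivity) (hasSum_norm_tensorKraus_sq Φ α)
  have hbound : ∀ (x y : Hil (ι → ℕ)) j α, ‖⟪x, K j (cohVec α)⟫_ℂ * ⟪K j (cohVec α), y⟫_ℂ‖ ≤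
      ‖x‖ * ‖y‖ * ‖K j (cohVec α)‖ ^ 2 := by
    intro x y j α
    rw [norm_mul]
    calc _ ≤ (‖x‖ * ‖K j (cohVec α)‖) * (‖K j (cohVec α)‖ * ‖y‖) := by
          gcongr <;> exact norm_inner_le_norm _ _
      _ = _ := by ring
  have hterm : ∀ (x y : Hil (ι → ℕ)) j, ⟪x, (K j ∘L ρ ∘L (K j).adjoint) y⟫_ℂ =
      ∫ α, ⟪x, K j (cohVec α)⟫_ℂ * ⟪K j (cohVec α), y⟫_ℂ ∂P := by
    intro x y j
    rw [ContinuousLinearMap.comp_apply, ContinuousLinearMap.comp_apply,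
      ← ContinuousLinearMap.adjoint_inner_left, hρ]
    simp only [inner_coherentState]
    simp only [ContinuousLinearMap.adjoint_inner_left, ContinuousLinearMap.adjoint_inner_right]
  -- These bounds have sum at most 1, so the series in `applyKraus` converges in operator norm and
  -- its `tsum` is not the default value.
  have hnorm : ∀ j, ‖K j ∘L ρ ∘L (K j).adjoint‖ ≤ ∫ α, ‖K j (cohVec α)‖ ^ 2 ∂P := by
    intro j
    have hI : 0 ≤ ∫ α, ‖K j (cohVec α)‖ ^ 2 ∂P := integral_nonneg fun _ => by positivity
    refine opNorm_le_of_inner hI fun x y => ?_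
    rw [hterm, ← integral_const_mul]
    exact norm_integral_le_of_norm_le ((hint j).const_mul (‖x‖ * ‖y‖))
      (Filter.Eventually.of_forall (hbound x y j))
  have hsumK : Summable fun j => K j ∘L ρ ∘L (K j).adjoint :=
    Summable.of_norm_bounded hsum hnorm
  have h1 := hsumK.hasSum.mapL ((innerSL ℂ x).comp (ContinuousLinearMap.apply ℂ (Hil (ι → ℕ)) y))
  have h1' : HasSum (fun j => ⟪x, (K j ∘L ρ ∘L (K j).adjoint) y⟫_ℂ) ⟪x, applyKraus K ρ y⟫_ℂ := h1
  simp only [hterm] at h1'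
  have hint2 : ∀ j, Integrable (fun α => ⟪x, K j (cohVec α)⟫_ℂ * ⟪K j (cohVec α), y⟫_ℂ) P :=
    fun j => ((hint j).const_mul (‖x‖ * ‖y‖)).mono'
      ((continuous_const.inner (hc j)).mul ((hc j).inner continuous_const)).aestronglyMeasurable
      (Filter.Eventually.of_forall (hbound x y j))
  have h2 := hasSum_integral_of_summable_integral_norm hint2 (by
    refine Summable.of_nonneg_of_le (fun j => integral_nonneg fun _ => norm_nonneg _)
      (fun j => integral_mono (hint2 j).norm ((hint j).const_mul _) (hbound x y j)) ?_
    simp only [integral_const_mul]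
    exact hsum.mul_left _)
  rw [h1'.unique h2]
  exact integral_congr_ae (Filter.Eventually.of_forall fun α =>
    (hasSum_tensorKraus h α x y).tsum_eq)

/-! ### Fidelity of outputs -/

theorem continuous_outFactor (E : ι → ℝ) (hE : ∀ i, 0 ≤ E i) (g : ι → ℝ) (κ : PhaseKind)
    (n : ι → ℕ) : Continuous fun α : ι → ℂ => outFactor E hE g (fun i => κ.image (α i)) (ket n) := by
  simp only [outFactor, ket_pi n, tensorOp_prodVec]
  refine continuous_prodVec fun i => ?_
  simp only [thermalFactor, smul_apply, ContinuousLinearMap.comp_apply]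
  exact (continuous_displacement (continuous_const.mul
    (κ.continuous_image.comp (continuous_apply i))) continuous_const).const_smul
      (Real.sqrt (1 / (1 + E i)) : ℂ)

/-- The factor of the second output, rotated to be aligned with the first. -/
noncomputable def alignedFactor (E E' : ι → ℝ) (hE : ∀ i, 0 ≤ E i) (hE' : ∀ i, 0 ≤ E' i)
    (g g' : ι → ℝ) (z : ι → ℂ) : Hil (ι → ℕ) →L[ℂ] Hil (ι → ℕ) :=
  outFactor E' hE' g' z ∘L tensorOp fun i => displacement
    ((alignShift (thermalRatio (E i) (hE i)) (thermalRatio (E' i) (hE' i)) * (g i - g' i) : ℝ) * z i)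

theorem alignedFactor_comp_adjoint (E E' : ι → ℝ) (hE : ∀ i, 0 ≤ E i) (hE' : ∀ i, 0 ≤ E' i)
    (g g' : ι → ℝ) (z : ι → ℂ) :
    alignedFactor E E' hE hE' g g' z ∘L (alignedFactor E E' hE hE' g g' z).adjoint =
      outFactor E' hE' g' z ∘L (outFactor E' hE' g' z).adjoint := by
  simp only [alignedFactor, outFactor, adjoint_tensorOp, tensorOp_comp]
  congr 1
  funext i
  rw [ContinuousLinearMap.adjoint_comp, adjoint_displacement]
  have := displacement_neg_comp (-((alignShift (thermalRatio (E i) (hE i))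
    (thermalRatio (E' i) (hE' i)) * (g i - g' i) : ℝ) * z i))
  rw [neg_neg] at this
  ext x
  simp only [ContinuousLinearMap.comp_apply]
  congr 1
  exact congrArg (fun T : Hil ℕ →L[ℂ] Hil ℕ => T _) this

/-- The squared Hilbert–Schmidt norm is the trace of `B B†`, which the alignment does not change. -/
theorem hasSum_norm_alignedFactor_sq (E E' : ι → ℝ) (hE : ∀ i, 0 ≤ E i) (hE' : ∀ i, 0 ≤ E' i)
    (g g' : ι → ℝ) (z : ι → ℂ) :
    HasSum (fun n => ‖alignedFactor E E' hE hE' g g' z (ket n)‖ ^ 2) 1 := by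
  have h1 := hasSum_trace_comp_adjoint (hasSum_norm_outFactor_sq E' hE' g' z)
  rw [← alignedFactor_comp_adjoint E E' hE hE' g g' z] at h1
  simp only [inner_comp_adjoint_self] at h1
  have h2 := hasSum_norm_adjoint_sq (Complex.hasSum_ofReal.1 h1)
  rwa [ContinuousLinearMap.adjoint_adjoint] at h2

theorem continuous_alignedFactor (E E' : ι → ℝ) (hE : ∀ i, 0 ≤ E i) (hE' : ∀ i, 0 ≤ E' i)
    (g g' : ι → ℝ) (κ : PhaseKind) (n : ι → ℕ) : Continuous fun α : ι → ℂ =>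
      alignedFactor E E' hE hE' g g' (fun i => κ.image (α i)) (ket n) := by
  simp only [alignedFactor, outFactor, ket_pi n, ContinuousLinearMap.comp_apply, tensorOp_prodVec]
  refine continuous_prodVec fun i => ?_
  simp only [thermalFactor, smul_apply, ContinuousLinearMap.comp_apply]
  have hk : Continuous fun α : ι → ℂ => κ.image (α i) :=
    κ.continuous_image.comp (continuous_apply i)
  exact (continuous_displacement (continuous_const.mul hk) ((numPow _).continuous.comp
    (continuous_displacement (continuous_const.mul hk) continuous_const))).const_smul
      (Real.sqrt (1 / (1 + E' i)) : ℂ)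

theorem alignedFactor_align (E E' : ι → ℝ) (hE : ∀ i, 0 ≤ E i) (hE' : ∀ i, 0 ≤ E' i)
    (g g' : ι → ℝ) (z : ι → ℂ) :
    0 ≤ (alignedFactor E E' hE hE' g g' z).adjoint ∘L outFactor E hE g z ∧
    HasSum (fun n => ⟪ket n, ((alignedFactor E E' hE hE' g g' z).adjoint ∘L
      outFactor E hE g z) (ket n)⟫_ℂ)
      ((∏ i, thermalFidelity (E i) (E' i) ((g i - g' i) ^ 2 * ‖z i‖ ^ 2) : ℝ) : ℂ) := by
  choose Q hQ1 hQ using fun i =>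
    thermalFactor_align (E i) (E' i) (hE i) (hE' i) (g i) (g' i) (z i)
  have key : (alignedFactor E E' hE hE' g g' z).adjoint ∘L outFactor E hE g z =
      ((∏ i, thermalFidelity (E i) (E' i) ((g i - g' i) ^ 2 * ‖z i‖ ^ 2) : ℝ) : ℂ) •
        (tensorOp Q ∘L (tensorOp Q).adjoint) := by
    simp only [alignedFactor, outFactor, adjoint_tensorOp, tensorOp_comp, hQ, Complex.ofReal_prod]
    rw [tensorOp_smul]
  rw [key]
  have hf : 0 ≤ ∏ i, thermalFidelity (E i) (E' i) ((g i - g' i) ^ 2 * ‖z i‖ ^ 2) :=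
    Finset.prod_nonneg fun i _ => mul_nonneg (Real.sqrt_nonneg _) (Real.exp_pos _).le
  constructor
  · rw [ContinuousLinearMap.nonneg_iff_isPositive]
    exact (ContinuousLinearMap.isPositive_self_comp_adjoint _).smul_of_nonneg
      (by exact_mod_cast hf)
  · have h1 := (hasSum_trace_comp_adjoint (hasSum_norm_tensorOp_sq hQ1)).mul_left
      ((∏ i, thermalFidelity (E i) (E' i) ((g i - g' i) ^ 2 * ‖z i‖ ^ 2) : ℝ) : ℂ)
    rw [Complex.ofReal_one, mul_one] at h1
    refine h1.congr_fun fun n => ?_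
    rw [smul_apply, inner_smul_right]

variable {μ' E' : ι → ℝ} {Φ' : ι → QuantumChannel}

/-- Joint concavity along the P-representation. The aligning displacements are explicit and
continuous in `α`, so no measurable selection is involved. Having the same `κ` in both channels
makes the two amplitudes real multiples of the same `κ.image (α i)`. -/
theorem integral_le_fidelity_output (h : ∀ i, IsPhaseInsensitiveGaussian κ (μ i) (E i) (Φ i))
    (h' : ∀ i, IsPhaseInsensitiveGaussian κ (μ' i) (E' i) (Φ' i))
    {P : Measure (ι → ℂ)} [IsProbabilityMeasure P] {ρ : Hil (ι → ℕ) →L[ℂ] Hil (ι → ℕ)}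
    (hρ : ∀ x y, ⟪x, ρ y⟫_ℂ = ∫ α, ⟪x, coherentState α y⟫_ℂ ∂P) :
    ∫ α, ∏ i, thermalFidelity (E i) (E' i)
      ((Real.sqrt (μ i) - Real.sqrt (μ' i)) ^ 2 * ‖α i‖ ^ 2) ∂P ≤
      fidelity (applyKraus (tensorKraus Φ) ρ) (applyKraus (tensorKraus Φ') ρ) := by
  have := integral_le_fidelity (P := P) (ρ := applyKraus (tensorKraus Φ) ρ)
    (σ := applyKraus (tensorKraus Φ') ρ)
    (fun n => continuous_outFactor E (fun i => (h i).noise_nonneg) (fun i => Real.sqrt (μ i)) κ n)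
    (fun n => continuous_alignedFactor E E' (fun i => (h i).noise_nonneg) (fun i => (h' i).noise_nonneg)
      (fun i => Real.sqrt (μ i)) (fun i => Real.sqrt (μ' i)) κ n)
    (fun α => hasSum_norm_outFactor_sq _ _ _ _)
    (fun α => hasSum_norm_alignedFactor_sq _ _ _ _ _ _ _)
    (fun x => inner_applyKraus h hρ x x)
    (fun x => by simpa only [alignedFactor_comp_adjoint] using inner_applyKraus h' hρ x x)
    (fun α => (alignedFactor_align _ _ _ _ _ _ _).2)
  simpa only [PhaseKind.norm_image] using this

theorem isClassical_coherentState (α : ι → ℂ) : IsClassical (coherentState α) := by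
  refine ⟨⟨?_, ?_⟩, Measure.dirac α, inferInstance, fun x y => by rw [integral_dirac]⟩
  · rw [ContinuousLinearMap.nonneg_iff_isPositive]
    exact InnerProductSpace.isPositive_rankOne_self _
  · have h := hasSum_norm_sq (cohVec α)
    rw [norm_cohVec, one_pow] at h
    have h2 := Complex.hasSum_ofReal.2 h
    rw [Complex.ofReal_one] at h2
    refine h2.congr_fun fun n => ?_
    rw [inner_coherentState, inner_ket, inner_ket_right, ← starRingEnd_apply, Complex.mul_conj']
    push_cast
    rfl

/-- The upper bound comes from the aligned factors, the lower bound from concavity applied to a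
Dirac measure. -/
theorem fidelity_output_coherentState
    (h : ∀ i, IsPhaseInsensitiveGaussian κ (μ i) (E i) (Φ i))
    (h' : ∀ i, IsPhaseInsensitiveGaussian κ (μ' i) (E' i) (Φ' i)) (α : ι → ℂ) :
    fidelity (applyKraus (tensorKraus Φ) (coherentState α))
      (applyKraus (tensorKraus Φ') (coherentState α)) =
    ∏ i, thermalFidelity (E i) (E' i)
      ((Real.sqrt (μ i) - Real.sqrt (μ' i)) ^ 2 * ‖α i‖ ^ 2) := by
  have hd : ∀ x y, ⟪x, coherentState α y⟫_ℂ =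
      ∫ β, ⟪x, coherentState β y⟫_ℂ ∂(Measure.dirac α) := fun x y => by rw [integral_dirac]
  refine le_antisymm ?_ ?_
  · have e1 : applyKraus (tensorKraus Φ) (coherentState α) = _ := clm_ext_ket fun x y =>
      (inner_applyKraus h hd (ket x) (ket y)).trans (integral_dirac _ _)
    have e2 : applyKraus (tensorKraus Φ') (coherentState α) = _ := clm_ext_ket fun x y =>
      (inner_applyKraus h' hd (ket x) (ket y)).trans (integral_dirac _ _)
    have h0 := alignedFactor_align E E' (fun i => (h i).noise_nonneg) (fun i => (h' i).noise_nonneg)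
      (fun i => Real.sqrt (μ i)) (fun i => Real.sqrt (μ' i)) (fun i => κ.image (α i))
    rw [e1, e2, ← alignedFactor_comp_adjoint E E' (fun i => (h i).noise_nonneg) (fun i => (h' i).noise_nonneg)
      (fun i => Real.sqrt (μ i)) (fun i => Real.sqrt (μ' i))]
    have := fidelity_le_of_factor
      (hasSum_trace_comp_adjoint (hasSum_norm_outFactor_sq _ _ _ _))
      (hasSum_trace_comp_adjoint (hasSum_norm_alignedFactor_sq _ _ _ _ _ _ _)) h0.1 h0.2
    simpa only [PhaseKind.norm_image] using this
  · have := integral_le_fidelity_output h h' hd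
    rwa [integral_dirac] at this

end Output

/-! ### Energy of classical states -/

section Energy

open MeasureTheory

/-- The mean of a Poisson law: shifting the index by one turns `k |α|^{2k} / k!` into `|α|²` times
the normalization series. -/
theorem hasSum_mul_norm_coh_sq (α : ℂ) :
    HasSum (fun k : ℕ => (k : ℝ) * ‖coh α k‖ ^ 2) (‖α‖ ^ 2) := by
  have h0 := hasSum_norm_sq (coh α)
  rw [norm_coh, one_pow] at h0
  have h1 := h0.mul_left (‖α‖ ^ 2)
  rw [mul_one] at h1
  rw [← hasSum_nat_add_iff' 1]
  simp only [Finset.sum_range_one, Nat.cast_zero, zero_mul, sub_zero]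
  refine h1.congr_fun fun k => ?_
  have hk : ((k + 1 : ℕ) : ℝ) ≠ 0 := by positivity
  have hf : ((k.factorial : ℕ) : ℝ) ≠ 0 := by positivity
  simp only [coh_apply, norm_mul, norm_div, norm_pow, Complex.norm_real, mul_pow, div_pow,
    Real.norm_eq_abs, sq_abs, Real.sq_sqrt (Nat.cast_nonneg _), Nat.factorial_succ, Nat.cast_mul]
  field_simp
  rw [Real.sq_sqrt (by positivity)]
  ring

variable {ι : Type} [Fintype ι]

theorem hasSum_photons_cohVec (α : ι → ℂ) :
    HasSum (fun n : ι → ℕ => ((∑ i, n i : ℕ) : ℝ) * ‖cohVec α n‖ ^ 2) (∑ i, ‖α i‖ ^ 2) := by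
  classical
  have h1 : ∀ i, HasSum (fun n : ι → ℕ => (n i : ℝ) * ‖cohVec α n‖ ^ 2) (‖α i‖ ^ 2) := by
    intro i
    -- Only the mode `i` carries the weight `k`; every other mode contributes its norm 1 to the
    -- product.
    have h2 : ∀ l, HasSum (fun k : ℕ => (if l = i then (k : ℝ) else 1) * ‖coh (α l) k‖ ^ 2)
        (if l = i then ‖α l‖ ^ 2 else 1) := by
      intro l
      split_ifs
      · exact hasSum_mul_norm_coh_sq _
      · have := hasSum_norm_sq (coh (α l))
        rw [norm_coh, one_pow] at this
        simpa only [one_mul] using this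
    have h3 := hasSum_prod_pi (𝕜 := ℝ) h2
    rw [Finset.prod_ite_eq' Finset.univ i, if_pos (Finset.mem_univ i)] at h3
    refine h3.congr_fun fun n => ?_
    rw [Finset.prod_mul_distrib, Finset.prod_ite_eq' Finset.univ i, if_pos (Finset.mem_univ i),
      cohVec, prodVec_apply, norm_prod, Finset.prod_pow]
  refine (hasSum_sum fun i (_ : i ∈ Finset.univ) => h1 i).congr_fun fun n => ?_
  rw [Nat.cast_sum, Finset.sum_mul]

theorem continuous_cohVec_apply (n : ι → ℕ) : Continuous fun α : ι → ℂ => cohVec α n := by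
  simp only [← inner_ket n]
  exact continuous_const.inner continuous_cohVec

variable [DecidableEq ι]

/-- Tonelli in `ℝ≥0∞`, so no finiteness of the energy is needed. -/
theorem meanPhotonNumber_eq_lintegral {P : Measure (ι → ℂ)} [IsProbabilityMeasure P]
    {ρ : Hil (ι → ℕ) →L[ℂ] Hil (ι → ℕ)}
    (hρ : ∀ x y, ⟪x, ρ y⟫_ℂ = ∫ α, ⟪x, coherentState α y⟫_ℂ ∂P) :
    meanPhotonNumber ρ = ∫⁻ α, ENNReal.ofReal (∑ i, ‖α i‖ ^ 2) ∂P := by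
  have hc : ∀ n : ι → ℕ, Continuous fun α : ι → ℂ => ‖cohVec α n‖ ^ 2 := fun n =>
    (continuous_cohVec_apply n).norm.pow 2
  have hle : ∀ (n : ι → ℕ) (α : ι → ℂ), ‖cohVec α n‖ ^ 2 ≤ 1 := by
    intro n α
    have := sum_norm_sq_le (cohVec α) {n}
    rwa [Finset.sum_singleton, norm_cohVec, one_pow] at this
  have hint : ∀ n : ι → ℕ, Integrable (fun α : ι → ℂ => ‖cohVec α n‖ ^ 2) P := fun n =>
    (integrable_const 1).mono' (hc n).aestronglyMeasurable
      (Filter.Eventually.of_forall fun α => by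
        rw [Real.norm_of_nonneg (by positivity)]; exact hle n α)
  have h1 : ∀ n : ι → ℕ, ENNReal.ofReal (⟪ket n, ρ (ket n)⟫_ℂ).re =
      ∫⁻ α, ENNReal.ofReal (‖cohVec α n‖ ^ 2) ∂P := by
    intro n
    have h2 : ⟪ket n, ρ (ket n)⟫_ℂ = ((∫ α, ‖cohVec α n‖ ^ 2 ∂P : ℝ) : ℂ) := by
      rw [hρ, ← integral_complex_ofReal]
      refine integral_congr_ae (Filter.Eventually.of_forall fun α => ?_)
      simp only [inner_coherentState]
      rw [inner_ket, inner_ket_right]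
      rw [← starRingEnd_apply, Complex.mul_conj']
      push_cast
      rfl
    rw [h2, Complex.ofReal_re, ofReal_integral_eq_lintegral_ofReal (hint n)
      (Filter.Eventually.of_forall fun α => by positivity)]
  simp only [meanPhotonNumber, h1]
  have hm : ∀ n : ι → ℕ, Measurable fun α : ι → ℂ => ENNReal.ofReal (‖cohVec α n‖ ^ 2) :=
    fun n => (hc n).measurable.ennreal_ofReal
  simp only [← lintegral_const_mul _ (hm _)]
  rw [← lintegral_tsum fun n => ((hm n).const_mul _).aemeasurable]
  refine lintegral_congr fun α => ?_
  have h3 := hasSum_photons_cohVec α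
  rw [← h3.tsum_eq, ENNReal.ofReal_tsum_of_nonneg (fun n => by positivity) h3.summable]
  refine tsum_congr fun n => ?_
  rw [ENNReal.ofReal_mul (by positivity), ENNReal.ofReal_natCast]

theorem meanPhotonNumber_coherentState (α : ι → ℂ) :
    meanPhotonNumber (coherentState α) = ENNReal.ofReal (∑ i, ‖α i‖ ^ 2) := by
  rw [meanPhotonNumber_eq_lintegral (P := Measure.dirac α) fun x y => by rw [integral_dirac],
    lintegral_dirac]

end Energy

/-! ### Sums over pairs -/

section Pairs

variable {m : ℕ}

/-- Each index lies in `m - 1` pairs: index `k` is the larger element in `k` of them and the smaller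
one in `m - 1 - k`. -/
theorem sum_pairs_add (y : Fin m → ℝ) :
    ∑ k, ∑ k' ∈ Finset.Ioi k, (y k' + y k) = (m - 1) * ∑ k, y k := by
  have h1 : ∑ k, ∑ k' ∈ Finset.Ioi k, y k' = ∑ k' : Fin m, ((k' : ℕ) : ℝ) * y k' := by
    rw [Finset.sum_comm' (t' := Finset.univ) (s' := fun k' => Finset.Iio k') (by simp)]
    simp
  have h2 : ∑ k, ∑ k' ∈ Finset.Ioi k, y k = ∑ k : Fin m, ((m : ℝ) - 1 - (k : ℕ)) * y k := by
    refine Finset.sum_congr rfl fun k _ => ?_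
    have hk : 1 + (k : ℕ) ≤ m := by omega
    rw [Finset.sum_const, Fin.card_Ioi, nsmul_eq_mul, Nat.sub_sub, Nat.cast_sub hk]
    push_cast
    ring
  simp only [Finset.sum_add_distrib]
  rw [h1, h2, ← Finset.sum_add_distrib, Finset.mul_sum]
  refine Finset.sum_congr rfl fun k _ => ?_
  ring

theorem sum_pairs_const (a : ℝ) :
    ∑ k : Fin m, ∑ _k' ∈ Finset.Ioi k, a = m * (m - 1) / 2 * a := by
  have := sum_pairs_add (m := m) fun _ => a / 2
  simp only [add_halves, Finset.sum_const, Finset.card_univ, Fintype.card_fin, nsmul_eq_mul] at this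
  simp only [Finset.sum_const, nsmul_eq_mul]
  rw [this]
  ring

/-- The tangent line of the convex function `u ↦ exp (-q u)` at `u = 2L`. -/
theorem exp_tangent_le (q L u : ℝ) :
    Real.exp (-(2 * L * q)) * (1 - q * (u - 2 * L)) ≤ Real.exp (-(q * u)) := by
  have h : Real.exp (-(q * u)) = Real.exp (-(2 * L * q)) * Real.exp (-(q * (u - 2 * L))) := by
    rw [← Real.exp_add]
    congr 1
    ring
  rw [h]
  gcongr
  linarith [Real.add_one_le_exp (-(q * (u - 2 * L)))]

/-- The tangents have a common slope, so their sum sees only the total `∑ x k`; with nonpositive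
slope the constraint makes the linear correction nonnegative. -/
theorem sum_pairs_tangent (hm : 1 ≤ m) {q L : ℝ} (hq : 0 ≤ q) {x : Fin m → ℝ}
    (hx : ∑ k, x k ≤ m * L) :
    m * (m - 1) / 2 * Real.exp (-(2 * L * q)) ≤ ∑ k, ∑ k' ∈ Finset.Ioi k,
      Real.exp (-(2 * L * q)) * (1 - q * (x k' + x k - 2 * L)) := by
  have h1 : ∑ k, ∑ k' ∈ Finset.Ioi k, Real.exp (-(2 * L * q)) * (1 - q * (x k' + x k - 2 * L)) =
      Real.exp (-(2 * L * q)) * (m * (m - 1) / 2 * 1 - q * ((m - 1) * ∑ k, (x k - L))) := by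
    rw [← sum_pairs_add fun k => x k - L, ← sum_pairs_const (m := m) 1]
    simp only [Finset.mul_sum, ← Finset.sum_sub_distrib]
    refine Finset.sum_congr rfl fun k _ => Finset.sum_congr rfl fun k' _ => ?_
    ring
  have hm' : (1 : ℝ) ≤ m := by exact_mod_cast hm
  rw [h1, Finset.sum_sub_distrib, Finset.sum_const, Finset.card_univ, Fintype.card_fin,
    nsmul_eq_mul]
  have h2 : q * ((m - 1) * (∑ k, x k - m * L)) ≤ 0 :=
    mul_nonpos_of_nonneg_of_nonpos hq
      (mul_nonpos_of_nonneg_of_nonpos (by linarith) (by linarith))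
  nlinarith [Real.exp_pos (-(2 * L * q))]

theorem sum_pairs_exp_ge (hm : 1 ≤ m) {q L : ℝ} (hq : 0 ≤ q) {x : Fin m → ℝ}
    (hx : ∑ k, x k ≤ m * L) :
    m * (m - 1) / 2 * Real.exp (-(2 * L * q)) ≤
      ∑ k, ∑ k' ∈ Finset.Ioi k, Real.exp (-(q * (x k' + x k))) :=
  (sum_pairs_tangent hm hq hx).trans
    (Finset.sum_le_sum fun _ _ => Finset.sum_le_sum fun _ _ => exp_tangent_le _ _ _)

/-- Equality of the sums forces equality in each tangent inequality, and strict convexity then gives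
`x k' + x k = 2L` for every pair. A single pair would fix only a sum; the three pairs among 0, 1, 2
determine `x 0 = L` and hence every `x k`. -/
theorem eq_of_sum_pairs_exp_eq (hm : 3 ≤ m) {q L : ℝ} (hq : 0 < q) {x : Fin m → ℝ}
    (hx : ∑ k, x k ≤ m * L)
    (h : ∑ k, ∑ k' ∈ Finset.Ioi k, Real.exp (-(q * (x k' + x k))) =
      m * (m - 1) / 2 * Real.exp (-(2 * L * q))) (k : Fin m) : x k = L := by
  have h1 := sum_pairs_tangent (by omega) hq.le hx
  rw [← h] at h1
  have h2 := (Finset.sum_eq_sum_iff_of_le fun k (_ : k ∈ Finset.univ) =>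
    Finset.sum_le_sum fun k' (_ : k' ∈ Finset.Ioi k) => exp_tangent_le q L (x k' + x k)).1
      (le_antisymm (Finset.sum_le_sum fun _ _ => Finset.sum_le_sum fun _ _ =>
        exp_tangent_le _ _ _) h1)
  have h3 : ∀ k k', k < k' → x k' + x k = 2 * L := by
    intro k k' hk
    have h4 := (Finset.sum_eq_sum_iff_of_le fun k' (_ : k' ∈ Finset.Ioi k) =>
      exp_tangent_le q L (x k' + x k)).1 (h2 k (Finset.mem_univ k)) k' (Finset.mem_Ioi.2 hk)
    by_contra hne
    have h5 : -(q * (x k' + x k - 2 * L)) ≠ 0 :=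
      neg_ne_zero.2 (mul_ne_zero hq.ne' (sub_ne_zero.2 hne))
    have h6 := Real.add_one_lt_exp h5
    have h7 : Real.exp (-(q * (x k' + x k))) =
        Real.exp (-(2 * L * q)) * Real.exp (-(q * (x k' + x k - 2 * L))) := by
      rw [← Real.exp_add]
      congr 1
      ring
    rw [h7] at h4
    have h8 := mul_left_cancel₀ (Real.exp_pos _).ne' h4
    linarith
  have h01 := h3 ⟨0, by omega⟩ ⟨1, by omega⟩ (by simp [Fin.lt_def])
  have h02 := h3 ⟨0, by omega⟩ ⟨2, by omega⟩ (by simp [Fin.lt_def])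
  have h12 := h3 ⟨1, by omega⟩ ⟨2, by omega⟩ (by simp [Fin.lt_def])
  have h0 : x ⟨0, by omega⟩ = L := by linarith
  by_cases hk : k = ⟨0, by omega⟩
  · rw [hk, h0]
  · have := h3 ⟨0, by omega⟩ k (Fin.lt_def.2 (Nat.pos_of_ne_zero fun h => hk (Fin.ext h)))
    linarith

end Pairs

/-! ### Channel-position finding -/

section Position

open MeasureTheory

theorem noiseConst_comm (E₁ E₂ : ℝ) : noiseConst E₁ E₂ = noiseConst E₂ E₁ := by
  rw [noiseConst, noiseConst, ← neg_sub, neg_sq]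

theorem noiseConst_self (E : ℝ) : noiseConst E E = 1 := by simp [noiseConst]

theorem noiseConst_pos (E₁ E₂ : ℝ) : 0 < noiseConst E₁ E₂ := by
  rw [noiseConst]
  positivity

theorem thermalFidelity_self (E : ℝ) : thermalFidelity E E 0 = 1 := by
  simp [thermalFidelity, noiseConst_self]

theorem thermalFidelity_comm (E₁ E₂ r : ℝ) : thermalFidelity E₁ E₂ r = thermalFidelity E₂ E₁ r := by
  rw [thermalFidelity, thermalFidelity, noiseConst_comm, add_right_comm]

variable {m : ℕ} {Mk : Fin m → ℕ}

/-- The energy irradiated over subsystem `k`. -/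
noncomputable def subsystemEnergy (α : Modes Mk → ℂ) (k : Fin m) : ℝ := ∑ j, ‖α ⟨k, j⟩‖ ^ 2

theorem sum_subsystemEnergy (α : Modes Mk → ℂ) :
    ∑ k, subsystemEnergy α k = ∑ i, ‖α i‖ ^ 2 := by
  rw [Fintype.sum_sigma]
  rfl

/-- Outside the subsystems `k` and `k'` both global channels act as the background channel, and
these modes contribute fidelity 1. -/
theorem prod_thermalFidelity {k k' : Fin m} (hk : k' ≠ k) (μT ET μB EB : ℝ) (α : Modes Mk → ℂ) :
    ∏ i : Modes Mk, thermalFidelity (if i.1 = k' then ET else EB) (if i.1 = k then ET else EB)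
      ((Real.sqrt (if i.1 = k' then μT else μB) - Real.sqrt (if i.1 = k then μT else μB)) ^ 2 *
        ‖α i‖ ^ 2) =
    Real.sqrt (noiseConst EB ET) ^ (Mk k' + Mk k) *
      Real.exp (-((Real.sqrt μB - Real.sqrt μT) ^ 2 / (1 + EB + ET) / 2 *
        (subsystemEnergy α k' + subsystemEnergy α k))) := by
  have hf : ∀ r : ℝ, thermalFidelity EB ET ((Real.sqrt μB - Real.sqrt μT) ^ 2 * r) =
      Real.sqrt (noiseConst EB ET) *
        Real.exp (-((Real.sqrt μB - Real.sqrt μT) ^ 2 / (1 + EB + ET) / 2 * r)) := by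
    intro r
    rw [thermalFidelity, noiseConst_comm]
    rw [mul_div_right_comm, div_div, mul_comm (1 + EB + ET) 2]
  have hS : ∀ l : Fin m, ∏ j : Fin (Mk l),
      thermalFidelity EB ET ((Real.sqrt μB - Real.sqrt μT) ^ 2 * ‖α ⟨l, j⟩‖ ^ 2) =
      Real.sqrt (noiseConst EB ET) ^ Mk l *
        Real.exp (-((Real.sqrt μB - Real.sqrt μT) ^ 2 / (1 + EB + ET) / 2 *
          subsystemEnergy α l)) := by
    intro l
    simp only [hf]
    rw [Finset.prod_mul_distrib, Finset.prod_const, Finset.card_univ, Fintype.card_fin,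
      ← Real.exp_sum, subsystemEnergy, Finset.mul_sum, Finset.sum_neg_distrib]
  rw [Fintype.prod_sigma, Finset.prod_eq_mul k' k hk]
  · simp only [if_true, if_neg hk, if_neg hk.symm]
    simp only [thermalFidelity_comm ET EB, hS, ← neg_sub (Real.sqrt μB) (Real.sqrt μT), neg_sq]
    rw [mul_mul_mul_comm, ← pow_add, ← Real.exp_add]
    congr 2
    ring
  · rintro l - ⟨h1, h2⟩
    simp only [if_neg h1, if_neg h2, sub_self, zero_pow two_ne_zero, zero_mul,
      thermalFidelity_self, Finset.prod_const_one]
  · simp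
  · simp

variable {κ : PhaseKind} {μT ET μB EB : ℝ} {ΦT ΦB : QuantumChannel}

theorem isPhaseInsensitiveGaussian_ite (hT : IsPhaseInsensitiveGaussian κ μT ET ΦT)
    (hB : IsPhaseInsensitiveGaussian κ μB EB ΦB) (k : Fin m) (i : Modes Mk) :
    IsPhaseInsensitiveGaussian κ (if i.1 = k then μT else μB) (if i.1 = k then ET else EB)
      (if i.1 = k then ΦT else ΦB) := by
  split_ifs
  · exact hT
  · exact hB

theorem fidelity_cpfOutput_coherentState (hT : IsPhaseInsensitiveGaussian κ μT ET ΦT)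
    (hB : IsPhaseInsensitiveGaussian κ μB EB ΦB) {k k' : Fin m} (hk : k' ≠ k)
    (α : Modes Mk → ℂ) :
    fidelity (cpfOutput Mk ΦT ΦB (coherentState α) k') (cpfOutput Mk ΦT ΦB (coherentState α) k) =
    Real.sqrt (noiseConst EB ET) ^ (Mk k' + Mk k) *
      Real.exp (-((Real.sqrt μB - Real.sqrt μT) ^ 2 / (1 + EB + ET) / 2 *
        (subsystemEnergy α k' + subsystemEnergy α k))) :=
  (fidelity_output_coherentState (isPhaseInsensitiveGaussian_ite hT hB k')
    (isPhaseInsensitiveGaussian_ite hT hB k) α).trans (prod_thermalFidelity hk μT ET μB EB α)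

theorem sq_pairFidelity (c q u : ℝ) (hc : 0 ≤ c) (N : ℕ) :
    (Real.sqrt c ^ N * Real.exp (-(q / 2 * u))) ^ 2 = c ^ N * Real.exp (-(q * u)) := by
  rw [mul_pow, ← pow_mul, mul_comm N 2, pow_mul, Real.sq_sqrt hc, pow_two (Real.exp _),
    ← Real.exp_add]
  congr 2
  ring

/-- Concavity holds for the fidelity itself, so Jensen is applied to `F`, with rate `q / 2`, and the
result is squared afterwards. -/
theorem fidelity_sq_cpfOutput_ge (hT : IsPhaseInsensitiveGaussian κ μT ET ΦT)
    (hB : IsPhaseInsensitiveGaussian κ μB EB ΦB) {k k' : Fin m} (hk : k' ≠ k)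
    {P : Measure (Modes Mk → ℂ)} [IsProbabilityMeasure P]
    {ρ : Hil (Modes Mk → ℕ) →L[ℂ] Hil (Modes Mk → ℕ)}
    (hρ : ∀ x y, ⟪x, ρ y⟫_ℂ = ∫ α, ⟪x, coherentState α y⟫_ℂ ∂P)
    (hI : ∀ k, Integrable (fun α => subsystemEnergy α k) P) :
    noiseConst EB ET ^ (Mk k' + Mk k) *
      Real.exp (-((Real.sqrt μB - Real.sqrt μT) ^ 2 / (1 + EB + ET) *
        (∫ α, subsystemEnergy α k' ∂P + ∫ α, subsystemEnergy α k ∂P))) ≤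
    fidelity (cpfOutput Mk ΦT ΦB ρ k') (cpfOutput Mk ΦT ΦB ρ k) ^ 2 := by
  have h1 : ∫ α, ∏ i : Modes Mk, thermalFidelity (if i.1 = k' then ET else EB)
      (if i.1 = k then ET else EB) ((Real.sqrt (if i.1 = k' then μT else μB) -
        Real.sqrt (if i.1 = k then μT else μB)) ^ 2 * ‖α i‖ ^ 2) ∂P ≤
      fidelity (cpfOutput Mk ΦT ΦB ρ k') (cpfOutput Mk ΦT ΦB ρ k) :=
    integral_le_fidelity_output (isPhaseInsensitiveGaussian_ite hT hB k')
      (isPhaseInsensitiveGaussian_ite hT hB k) hρ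
  simp only [prod_thermalFidelity hk] at h1
  rw [integral_const_mul] at h1
  set q := (Real.sqrt μB - Real.sqrt μT) ^ 2 / (1 + EB + ET)
  have hq : 0 ≤ q := by
    have := hT.noise_nonneg
    have := hB.noise_nonneg
    positivity
  set y := ∫ α, subsystemEnergy α k' ∂P + ∫ α, subsystemEnergy α k ∂P with hy
  have hx0 : ∀ (α : Modes Mk → ℂ) l, 0 ≤ subsystemEnergy α l := fun α l =>
    Finset.sum_nonneg fun _ _ => by positivity
  have hIu : Integrable (fun α => subsystemEnergy α k' + subsystemEnergy α k) P :=
    (hI k').add (hI k)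
  have hIv : Integrable (fun α => subsystemEnergy α k' + subsystemEnergy α k - y) P :=
    hIu.sub (integrable_const y)
  have hIe : Integrable (fun α => Real.exp (-(q / 2 *
      (subsystemEnergy α k' + subsystemEnergy α k)))) P := by
    refine (integrable_const (1 : ℝ)).mono'
      (Real.continuous_exp.comp_aestronglyMeasurable (hIu.1.const_mul _).neg)
      (Filter.Eventually.of_forall fun α => ?_)
    rw [Real.norm_of_nonneg (Real.exp_pos _).le, Real.exp_le_one_iff, neg_nonpos]
    have := hx0 α k
    have := hx0 α k'
    positivity
  -- Jensen by integrating the tangent at the mean `y`, whose linear term averages to zero.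
  -- `exp_tangent_le` has its tangent point at `2 * L`, hence the argument `y / 2`.
  have hJ : Real.exp (-(q / 2 * y)) ≤ ∫ α, Real.exp (-(q / 2 *
      (subsystemEnergy α k' + subsystemEnergy α k))) ∂P := by
    have h2 : ∫ α, Real.exp (-(q / 2 * y)) * (1 - q / 2 *
        (subsystemEnergy α k' + subsystemEnergy α k - y)) ∂P = Real.exp (-(q / 2 * y)) := by
      rw [integral_const_mul, integral_sub (integrable_const 1)
        (hIv.const_mul _), integral_const_mul,
        integral_sub hIu (integrable_const y), integral_add (hI k') (hI k)]
      simp [hy]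
    rw [← h2]
    refine integral_mono (((integrable_const (1 : ℝ)).sub
      (hIv.const_mul _)).const_mul _) hIe fun α => ?_
    have h3 := exp_tangent_le (q / 2) (y / 2) (subsystemEnergy α k' + subsystemEnergy α k)
    have e1 : 2 * (y / 2) * (q / 2) = q / 2 * y := by ring
    have e2 : 2 * (y / 2) = y := by ring
    rwa [e1, e2] at h3
  rw [← sq_pairFidelity _ _ _ (noiseConst_pos EB ET).le]
  refine pow_le_pow_left₀ (by positivity) (le_trans ?_ h1) 2
  gcongr

theorem integrable_subsystemEnergy {P : Measure (Modes Mk → ℂ)} {e : ℝ} (he : 0 ≤ e)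
    (hP : ∫⁻ α, ENNReal.ofReal (∑ i, ‖α i‖ ^ 2) ∂P ≤ ENNReal.ofReal e) :
    (∀ k, Integrable (fun α : Modes Mk → ℂ => subsystemEnergy α k) P) ∧
      ∑ k, ∫ α, subsystemEnergy α k ∂P ≤ e := by
  have hc : ∀ k, Continuous fun α : Modes Mk → ℂ => subsystemEnergy α k := fun k =>
    continuous_finsetSum _ fun j _ => (continuous_apply _).norm.pow 2
  have hct : Continuous fun α : Modes Mk → ℂ => ∑ i, ‖α i‖ ^ 2 :=
    continuous_finsetSum _ fun j _ => (continuous_apply _).norm.pow 2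
  have hnn : ∀ α : Modes Mk → ℂ, 0 ≤ ∑ i, ‖α i‖ ^ 2 := fun α =>
    Finset.sum_nonneg fun _ _ => by positivity
  have hx0 : ∀ (α : Modes Mk → ℂ) l, 0 ≤ subsystemEnergy α l := fun α l =>
    Finset.sum_nonneg fun _ _ => by positivity
  have hIt : Integrable (fun α : Modes Mk → ℂ => ∑ i, ‖α i‖ ^ 2) P :=
    (lintegral_ofReal_ne_top_iff_integrable hct.aestronglyMeasurable
      (Filter.Eventually.of_forall hnn)).1 (hP.trans_lt ENNReal.ofReal_lt_top).ne
  have hI : ∀ k, Integrable (fun α : Modes Mk → ℂ => subsystemEnergy α k) P := fun k =>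
    hIt.mono' (hc k).aestronglyMeasurable (Filter.Eventually.of_forall fun α => by
      rw [Real.norm_of_nonneg (hx0 α k), ← sum_subsystemEnergy]
      exact Finset.single_le_sum (fun l _ => hx0 α l) (Finset.mem_univ k))
  refine ⟨hI, ?_⟩
  rw [← integral_finsetSum _ fun k _ => hI k]
  simp only [sum_subsystemEnergy]
  rw [← ofReal_integral_eq_lintegral_ofReal hIt (Filter.Eventually.of_forall hnn)] at hP
  exact (ENNReal.ofReal_le_ofReal_iff he).1 hP

theorem coherentState_mem_classicalInputs {e : ℝ} (he : 0 ≤ e) (α : Modes Mk → ℂ) :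
    coherentState α ∈ classicalInputs Mk e ↔ ∑ k, subsystemEnergy α k ≤ e := by
  rw [sum_subsystemEnergy, ← ENNReal.ofReal_le_ofReal_iff he, ← meanPhotonNumber_coherentState]
  exact ⟨fun h => h.2, fun h => ⟨isClassical_coherentState α, h⟩⟩

variable {C L : ℝ}

/-- The constant `C` lets one argument serve both parts: it is `c ^ (2M)` for equal numbers of
modes, and 1 when `EB = ET`, since then `c = 1` and the numbers of modes drop out. -/
theorem cpfLowerBound_coherentState (hT : IsPhaseInsensitiveGaussian κ μT ET ΦT)
    (hB : IsPhaseInsensitiveGaussian κ μB EB ΦB)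
    (hC : ∀ k k' : Fin m, k' ≠ k → noiseConst EB ET ^ (Mk k' + Mk k) = C) (α : Modes Mk → ℂ) :
    cpfLowerBound Mk ΦT ΦB (coherentState α) = 1 / m * (1 / m) * C *
      ∑ k, ∑ k' ∈ Finset.Ioi k, Real.exp (-((Real.sqrt μB - Real.sqrt μT) ^ 2 / (1 + EB + ET) *
        (subsystemEnergy α k' + subsystemEnergy α k))) := by
  simp only [cpfLowerBound, fidelityLowerBound, Finset.mul_sum]
  refine Finset.sum_congr rfl fun k _ => Finset.sum_congr rfl fun k' hk' => ?_
  have hne : k' ≠ k := (Finset.mem_Ioi.1 hk').ne'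
  rw [fidelity_cpfOutput_coherentState hT hB hne, sq_pairFidelity _ _ _ (noiseConst_pos EB ET).le,
    hC k k' hne]
  ring

theorem le_cpfLowerBound (hm : 1 ≤ m) (hT : IsPhaseInsensitiveGaussian κ μT ET ΦT)
    (hB : IsPhaseInsensitiveGaussian κ μB EB ΦB) (hL : 0 ≤ L) (hC0 : 0 ≤ C)
    (hC : ∀ k k' : Fin m, k' ≠ k → noiseConst EB ET ^ (Mk k' + Mk k) = C)
    {ρ : Hil (Modes Mk → ℕ) →L[ℂ] Hil (Modes Mk → ℕ)} (hρ : ρ ∈ classicalInputs Mk (m * L)) :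
    1 / m * (1 / m) * C * (m * (m - 1) / 2 *
      Real.exp (-(2 * L * ((Real.sqrt μB - Real.sqrt μT) ^ 2 / (1 + EB + ET))))) ≤
      cpfLowerBound Mk ΦT ΦB ρ := by
  obtain ⟨⟨-, P, hP, hρP⟩, he⟩ := hρ
  rw [meanPhotonNumber_eq_lintegral hρP] at he
  obtain ⟨hI, hsum⟩ := integrable_subsystemEnergy (by positivity) he
  have hq : 0 ≤ (Real.sqrt μB - Real.sqrt μT) ^ 2 / (1 + EB + ET) := by
    have := hT.noise_nonneg
    have := hB.noise_nonneg
    positivity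
  refine (mul_le_mul_of_nonneg_left (sum_pairs_exp_ge hm hq hsum) (by positivity)).trans ?_
  simp only [cpfLowerBound, fidelityLowerBound, Finset.mul_sum]
  refine Finset.sum_le_sum fun k _ => Finset.sum_le_sum fun k' hk' => ?_
  have hne : k' ≠ k := (Finset.mem_Ioi.1 hk').ne'
  rw [mul_assoc _ C, ← hC k k' hne]
  gcongr
  exact fidelity_sq_cpfOutput_ge hT hB hne hρP hI

theorem cpfLowerBound_coherentState_of_uniform (hT : IsPhaseInsensitiveGaussian κ μT ET ΦT)
    (hB : IsPhaseInsensitiveGaussian κ μB EB ΦB)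
    (hC : ∀ k k' : Fin m, k' ≠ k → noiseConst EB ET ^ (Mk k' + Mk k) = C) {α : Modes Mk → ℂ}
    (hα : ∀ k, subsystemEnergy α k = L) :
    cpfLowerBound Mk ΦT ΦB (coherentState α) = 1 / m * (1 / m) * C * (m * (m - 1) / 2 *
      Real.exp (-(2 * L * ((Real.sqrt μB - Real.sqrt μT) ^ 2 / (1 + EB + ET))))) := by
  rw [cpfLowerBound_coherentState hT hB hC]
  simp only [hα]
  rw [sum_pairs_const]
  congr 4
  ring

theorem subsystemEnergy_eq_of_cpfLowerBound (hm : 3 ≤ m)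
    (hT : IsPhaseInsensitiveGaussian κ μT ET ΦT) (hB : IsPhaseInsensitiveGaussian κ μB EB ΦB)
    (hμ : μB ≠ μT) (hL : 0 ≤ L) (hC0 : 0 < C)
    (hC : ∀ k k' : Fin m, k' ≠ k → noiseConst EB ET ^ (Mk k' + Mk k) = C) {α : Modes Mk → ℂ}
    (hα : coherentState α ∈ classicalInputs Mk (m * L))
    (h : cpfLowerBound Mk ΦT ΦB (coherentState α) = 1 / m * (1 / m) * C * (m * (m - 1) / 2 *
      Real.exp (-(2 * L * ((Real.sqrt μB - Real.sqrt μT) ^ 2 / (1 + EB + ET))))))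
    (k : Fin m) : subsystemEnergy α k = L := by
  rw [coherentState_mem_classicalInputs (by positivity)] at hα
  rw [cpfLowerBound_coherentState hT hB hC] at h
  have hq : 0 < (Real.sqrt μB - Real.sqrt μT) ^ 2 / (1 + EB + ET) := by
    have := hT.noise_nonneg
    have := hB.noise_nonneg
    have h1 : Real.sqrt μB - Real.sqrt μT ≠ 0 :=
      sub_ne_zero.2 fun h => hμ ((Real.sqrt_inj hB.1 hT.1).1 h)
    positivity
  have hm' : (0 : ℝ) < m := by exact_mod_cast (by omega : 0 < m)
  exact eq_of_sum_pairs_exp_eq hm hq hα (mul_left_cancel₀ (by positivity) h) k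

theorem subsystemEnergy_coherentInput (θ N : (k : Fin m) → Fin (Mk k) → ℝ)
    (hN : ∀ k i, 0 ≤ N k i) (k : Fin m) :
    subsystemEnergy (fun i : Modes Mk =>
      Complex.exp (Complex.I * (θ i.1 i.2 : ℂ)) * (Real.sqrt (N i.1 i.2) : ℂ)) k = ∑ i, N k i := by
  refine Finset.sum_congr rfl fun i _ => ?_
  rw [norm_mul, Complex.norm_exp_I_mul_ofReal, one_mul, Complex.norm_real,
    Real.norm_of_nonneg (Real.sqrt_nonneg _), Real.sq_sqrt (hN k i)]

end Position

theorem subsystemEnergy_const {m : ℕ} {e : ℝ} (he : 0 ≤ e) (k : Fin m) :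
    subsystemEnergy (fun _ : Modes (fun _ : Fin m => 1) => (Real.sqrt e : ℂ)) k = e := by
  simp [subsystemEnergy, Real.sq_sqrt he]

end CPF

/-! ### The optimal classical value and its minimizers -/

theorem lemma3 (m M : ℕ) (hm : 1 ≤ m) (N_S : ℝ) (hN : 0 ≤ N_S)
    (κ : CPF.PhaseKind) (μT ET μB EB : ℝ) (ΦT ΦB : CPF.QuantumChannel)
    (hT : CPF.IsPhaseInsensitiveGaussian κ μT ET ΦT)
    (hB : CPF.IsPhaseInsensitiveGaussian κ μB EB ΦB) :
    -- `M` modes on each subsystem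
    (∀ v : ℝ, v = (m - 1) / (2 * m) * CPF.noiseConst EB ET ^ (2 * M) *
        Real.exp (-(2 * M * N_S * (Real.sqrt μB - Real.sqrt μT) ^ 2 / (1 + EB + ET))) →
      (∀ ρ ∈ CPF.classicalInputs (fun _ : Fin m => M) (m * M * N_S),
        v ≤ CPF.cpfLowerBound (fun _ => M) ΦT ΦB ρ) ∧
      (∀ θ N : Fin m → Fin M → ℝ, (∀ k i, 0 ≤ N k i) → (∀ k, ∑ i, N k i = M * N_S) →
        CPF.coherentInput (fun _ => M) θ N ∈ CPF.classicalInputs (fun _ => M) (m * M * N_S) ∧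
        CPF.cpfLowerBound (fun _ => M) ΦT ΦB (CPF.coherentInput (fun _ => M) θ N) = v) ∧
      (3 ≤ m → μB ≠ μT → ∀ θ N : Fin m → Fin M → ℝ, (∀ k i, 0 ≤ N k i) →
        CPF.coherentInput (fun _ => M) θ N ∈ CPF.classicalInputs (fun _ => M) (m * M * N_S) →
        CPF.cpfLowerBound (fun _ => M) ΦT ΦB (CPF.coherentInput (fun _ => M) θ N) = v →
        ∀ k, ∑ i, N k i = M * N_S)) ∧
    -- no passive signature: arbitrary numbers of modes on the subsystems
    (∀ E v : ℝ, ET = E → EB = E → v = (m - 1) / (2 * m) *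
        Real.exp (-(2 * M * N_S * (Real.sqrt μB - Real.sqrt μT) ^ 2 / (1 + 2 * E))) →
      (∀ Mk : Fin m → ℕ, ∀ ρ ∈ CPF.classicalInputs Mk (m * M * N_S),
        v ≤ CPF.cpfLowerBound Mk ΦT ΦB ρ) ∧
      (∀ (Mk : Fin m → ℕ) (θ N : (k : Fin m) → Fin (Mk k) → ℝ), (∀ k i, 0 ≤ N k i) →
        (∀ k, ∑ i, N k i = M * N_S) →
        CPF.coherentInput Mk θ N ∈ CPF.classicalInputs Mk (m * M * N_S) ∧
        CPF.cpfLowerBound Mk ΦT ΦB (CPF.coherentInput Mk θ N) = v) ∧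
      CPF.coherentState (fun _ : CPF.Modes (fun _ : Fin m => 1) => (Real.sqrt (M * N_S) : ℂ)) ∈
        CPF.classicalInputs (fun _ => 1) (m * M * N_S) ∧
      CPF.cpfLowerBound (fun _ => 1) ΦT ΦB
        (CPF.coherentState fun _ : CPF.Modes (fun _ : Fin m => 1) =>
          (Real.sqrt (M * N_S) : ℂ)) = v) := by
  have hm0 : (m : ℝ) ≠ 0 := Nat.cast_ne_zero.2 (by omega)
  have hL : 0 ≤ (M : ℝ) * N_S := by positivity
  -- The form used by the lemmas: the two priors `1 / m`, the number `m (m - 1) / 2` of pairs, and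
  -- `L = M N_S`.
  have hv : ∀ C d s : ℝ, (m - 1) / (2 * m) * C * Real.exp (-(2 * M * N_S * d / s)) =
      1 / m * (1 / m) * C * (m * (m - 1) / 2 * Real.exp (-(2 * (M * N_S) * (d / s)))) := by
    intro C d s
    rw [mul_assoc 2 (M : ℝ) N_S, mul_div_assoc]
    field_simp
  have he : 0 ≤ (m : ℝ) * (M * N_S) := by positivity
  rw [mul_assoc (m : ℝ) M N_S]
  have hmem : ∀ {Mk : Fin m → ℕ} {α : CPF.Modes Mk → ℂ},
      (∀ k, CPF.subsystemEnergy α k = M * N_S) →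
      CPF.coherentState α ∈ CPF.classicalInputs Mk (m * (M * N_S)) := by
    intro Mk α h
    rw [CPF.coherentState_mem_classicalInputs he]
    simp [h]
  constructor
  · rintro v rfl
    rw [hv]
    have hC : ∀ k k' : Fin m, k' ≠ k →
        CPF.noiseConst EB ET ^ (M + M) = CPF.noiseConst EB ET ^ (2 * M) := by
      intro _ _ _
      rw [two_mul]
    have hC0 : 0 < CPF.noiseConst EB ET ^ (2 * M) := pow_pos (CPF.noiseConst_pos EB ET) _
    refine ⟨fun ρ hρ => CPF.le_cpfLowerBound hm hT hB hL hC0.le hC hρ, ?_, ?_⟩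
    · intro θ N hN0 hN
      have h := fun k => (CPF.subsystemEnergy_coherentInput θ N hN0 k).trans (hN k)
      exact ⟨hmem h, CPF.cpfLowerBound_coherentState_of_uniform hT hB hC h⟩
    · intro h3 hμ θ N hN0 hmem' h k
      rw [← CPF.subsystemEnergy_coherentInput θ N hN0 k]
      exact CPF.subsystemEnergy_eq_of_cpfLowerBound h3 hT hB hμ hL hC0 hC hmem' h k
  · rintro E v rfl rfl rfl
    have hC : ∀ (Mk : Fin m → ℕ) (k k' : Fin m), k' ≠ k →
        CPF.noiseConst EB EB ^ (Mk k' + Mk k) = 1 := by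
      intro _ _ _ _
      rw [CPF.noiseConst_self, one_pow]
    -- The inserted factor 1 plays the role of `C` in `hv`, and `1 + 2 E` becomes `1 + EB + EB`.
    rw [← mul_one (((m : ℝ) - 1) / (2 * m)), hv, two_mul EB, ← add_assoc]
    refine ⟨fun Mk ρ hρ => CPF.le_cpfLowerBound hm hT hB hL zero_le_one (hC Mk) hρ, ?_, ?_, ?_⟩
    · intro Mk θ N hN0 hN
      have h := fun k => (CPF.subsystemEnergy_coherentInput θ N hN0 k).trans (hN k)
      exact ⟨hmem h, CPF.cpfLowerBound_coherentState_of_uniform hT hB (hC Mk) h⟩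
    · exact hmem (CPF.subsystemEnergy_const hL)
    · exact CPF.cpfLowerBound_coherentState_of_uniform hT hB (hC _) (CPF.subsystemEnergy_const hL)
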